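/- A server with $L\ge 1$ threads receives $N$ read requests at deterministic times $0=a_1\le a_2\le\cdots\le a_N$. The file of request $i$ is stored as $n_i$ coded chunks of an $(n_i,k_i)$ MDS code, $1\le k_i\le n_i$, so that request $i$ is completed as soon as any $k_i$ of its $n_i$ chunks have been downloaded; let $d_i=n_i-k_i+1$ and $d_{\min}=\min_i d_i$. At any time each thread may serve one not yet downloaded chunk of an arrived, unfinished request (different threads serve different chunks). Preemption is allowed: a thread may switch to another chunk at any time, and an interrupted download is later resumed from the point of interruption. The downloading times of the chunks are i.i.d. exponential with mean $1/\mu$, $\mu>0$. A (possibly randomized) policy is online if its decision at time $t$ depends neither on the number and parameters of the requests arriving after $t$ nor on the (remaining) downloading times of the chunks not downloaded by time $t$. The average flow time of a policy $\pi$ is $\overline D_\pi=\frac1N\sum_{i=1}^N(\mathbb E[c_{i,\pi}]-a_i)$, where $c_{i,\pi}$ is the completion time of request $i$, and $\overline D_{\mathrm{opt}}=\inf_\pi\overline D_\pi$ over all online policies. For an infinite sequence of requests, $\overline D_\pi$ is the $\limsup$ as $N\to\infty$ of the average flow time for its first $N$ requests, and $d_{\min}=\min_{i\ge1}d_i$.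 Preemptive SERPT-R is an online policy that, at every time, assigns the threads to available chunks of the unfinished requests in increasing order of the number of chunks that remain to be downloaded to complete the request (ties broken arbitrarily), until all $L$ threads are occupied or all available chunks of the unfinished requests are under service. Then such a policy exists and, for every finite or infinite sequence of request parameters $(a_i,k_i,n_i)$ (with $d_{\min}<L$ allowed), every preemptive SERPT-R policy satisfies $$\overline D_{\mathrm{opt}}\le\overline D_{\text{SERPT-R}}\le\overline D_{\mathrm{opt}}+\frac1\mu\sum_{l=d_{\min}}^{L-1}\frac1l ,$$ where the sum is $0$ if $d_{\min}\ge L$. Moreover $\frac1\mu\sum_{l=d_{\min}}^{L-1}\frac1l\le\frac{\ln L+1}\mu$, so the gap is bounded independently of the arrival process and the load. -/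

import Mathlib

open MeasureTheory ProbabilityTheory Filter

noncomputable section

namespace CloudStorage

/-- `(i, j)` is the `j`-th coded chunk of the file of request `i` (both counted from `0`). -/
abbrev Chunk := ℕ × ℕ

/-- A finite sequence of read requests: `N` requests, request `i < N` arriving at time `a i` for a
file stored with an `(n i, k i)` MDS code.  Values at indices `i ≥ N` play no role. -/
structure Requests where
  N : ℕ
  a : ℕ → ℝ
  k : ℕ → ℕ
  n : ℕ → ℕ
  N_pos : 0 < N
  a_zero : a 0 = 0
  a_mono : ∀ i j, i ≤ j → j < N → a i ≤ a j
  k_pos : ∀ i < N, 1 ≤ k i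
  k_le_n : ∀ i < N, k i ≤ n i

namespace Requests

/-- Request `i` has arrived by time `t`. -/
def Arrived (R : Requests) (t : ℝ) (i : ℕ) : Prop := i < R.N ∧ R.a i ≤ t

/-- The minimum over all requests of the code distance `d i = n i - k i + 1`. -/
def dmin (R : Requests) : ℕ := sInf {d | ∃ i < R.N, d = R.n i - R.k i + 1}

/-- The amount of service that chunk `c` has received by time `t`, when `σ s` is the set of chunks
that are being downloaded at time `s`.  Service is cumulative: the download of a preempted chunk is
resumed from the point of interruption. -/
def service (σ : ℝ → Finset Chunk) (c : Chunk) (t : ℝ) : ENNReal :=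
  volume {s : ℝ | 0 ≤ s ∧ s ≤ t ∧ c ∈ σ s}

open Classical in
/-- The set of coded chunks (given by their numbers `j < n i`) of the file of request `i` whose
download is complete at time `t`, when `x c` is the downloading time of chunk `c`. -/
def downloaded (R : Requests) (σ : ℝ → Finset Chunk) (x : Chunk → ℝ) (t : ℝ) (i : ℕ) : Finset ℕ :=
  (Finset.range (R.n i)).filter fun j => ENNReal.ofReal (x (i, j)) ≤ service σ (i, j) t

/-- The number of chunks that remain to be downloaded at time `t` in order to complete
request `i`. -/
def remaining (R : Requests) (σ : ℝ → Finset Chunk) (x : Chunk → ℝ) (t : ℝ) (i : ℕ) : ℕ :=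
  R.k i - (R.downloaded σ x t i).card

/-- Request `i` is in the system at time `t`: it has arrived and is not yet completed. -/
def Unfinished (R : Requests) (σ : ℝ → Finset Chunk) (x : Chunk → ℝ) (t : ℝ) (i : ℕ) : Prop :=
  R.Arrived t i ∧ 0 < R.remaining σ x t i

/-- Chunk `c` is available at time `t`: it is a not yet downloaded coded chunk of the file of an
unfinished request. -/
def Available (R : Requests) (σ : ℝ → Finset Chunk) (x : Chunk → ℝ) (t : ℝ) (c : Chunk) : Prop :=
  R.Unfinished σ x t c.1 ∧ c.2 < R.n c.1 ∧ c.2 ∉ R.downloaded σ x t c.1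

/-- The completion time of request `i`: the first time at which `k i` chunks of its file are
downloaded (`∞` if this never happens). -/
def completionTime (R : Requests) (σ : ℝ → Finset Chunk) (x : Chunk → ℝ) (i : ℕ) : ENNReal :=
  ⨅ (t : ℝ) (_ : 0 ≤ t ∧ R.k i ≤ (R.downloaded σ x t i).card), ENNReal.ofReal t

end Requests

/-- The law of the downloading times: i.i.d. exponential with mean `1 / μ`, over all chunks. -/
def downloadLaw (μ : ℝ) : Measure (Chunk → ℝ) := Measure.infinitePi fun _ : Chunk => expMeasure μ

/-- A (possibly randomized) preemptive online policy for `L` threads.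
`assign R u x t` is the set of chunks that are under service at time `t`, when the requests are `R`,
the policy's own random seed (independent of the downloading times) is `u`, and the downloading time
of each chunk `c` is `x c`.  -/
structure OnlinePolicy (L : ℕ) where
  Seed : Type
  [seedSpace : MeasurableSpace Seed]
  seedLaw : Measure Seed
  [seedProb : IsProbabilityMeasure seedLaw]
  assign : Requests → Seed → (Chunk → ℝ) → ℝ → Finset Chunk
  measurable_assign : ∀ (R : Requests) (c : Chunk),
    MeasurableSet {p : Seed × (Chunk → ℝ) × ℝ | c ∈ assign R p.1 p.2.1 p.2.2}
  /-- Each of the `L` threads serves at most one chunk. -/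
  card_le : ∀ R u x t, (assign R u x t).card ≤ L
  /-- Only available chunks are under service. -/
  available : ∀ R u x t, ∀ c ∈ assign R u x t, R.Available (assign R u x) x t c
  /-- The decision at time `t` depends only on the seed, on the requests that have arrived by time
  `t` and their parameters, and on which of their chunks have been downloaded by each time `r ≤ t`;
  neither on the number and parameters of the later requests, nor on the downloading times of the
  chunks that are not downloaded by time `t`. -/
  online : ∀ (R R' : Requests) (u : Seed) (x x' : Chunk → ℝ) (t : ℝ),
    (∀ i, R.Arrived t i ↔ R'.Arrived t i) →
    (∀ i, R.Arrived t i → R.a i = R'.a i ∧ R.k i = R'.k i ∧ R.n i = R'.n i) →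
    (∀ i, R.Arrived t i → ∀ r ≤ t,
      R.downloaded (assign R u x) x r i = R'.downloaded (assign R' u x') x' r i) →
    assign R u x t = assign R' u x' t

attribute [instance] OnlinePolicy.seedSpace OnlinePolicy.seedProb

namespace OnlinePolicy

/-- The expected completion time of request `i` under the policy. -/
def meanCompletion {L : ℕ} (π : OnlinePolicy L) (μ : ℝ) (R : Requests) (i : ℕ) : ENNReal :=
  ∫⁻ u, ∫⁻ x, R.completionTime (π.assign R u x) x i ∂(downloadLaw μ) ∂π.seedLaw

/-- The average flow time of the policy.  The subtraction in `[0, ∞]` is never truncated, since a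
request needs at least one chunk and is served only after its arrival. -/
def avgFlowTime {L : ℕ} (π : OnlinePolicy L) (μ : ℝ) (R : Requests) : ENNReal :=
  (∑ i ∈ Finset.range R.N, (π.meanCompletion μ R i - ENNReal.ofReal (R.a i))) / (R.N : ENNReal)

/-- The policy is a preemptive SERPT-R policy: at any time, threads are assigned to available chunks
of the unfinished requests in increasing order of the number of remaining chunks (ties are broken
arbitrarily), until all `L` threads are occupied or all available chunks are under service. -/
def IsSERPTR {L : ℕ} (π : OnlinePolicy L) : Prop :=
  ∀ (R : Requests) (u : π.Seed) (x : Chunk → ℝ) (t : ℝ),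
    (∀ c ∈ π.assign R u x t, ∀ c', R.Available (π.assign R u x) x t c' →
      R.remaining (π.assign R u x) x t c'.1 < R.remaining (π.assign R u x) x t c.1 →
        c' ∈ π.assign R u x t) ∧
    ((π.assign R u x t).card < L →
      ∀ c, R.Available (π.assign R u x) x t c → c ∈ π.assign R u x t)

end OnlinePolicy

/-- The optimal average flow time among all online policies. -/
def optFlowTime (L : ℕ) (μ : ℝ) (R : Requests) : ENNReal :=
  ⨅ π : OnlinePolicy L, π.avgFlowTime μ R

/-- An infinite sequence of read requests. -/
structure RequestStream where
  a : ℕ → ℝ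
  k : ℕ → ℕ
  n : ℕ → ℕ
  a_zero : a 0 = 0
  a_mono : Monotone a
  k_pos : ∀ i, 1 ≤ k i
  k_le_n : ∀ i, k i ≤ n i

namespace RequestStream

/-- The minimum code distance of the stream. -/
def dmin (S : RequestStream) : ℕ := sInf {d | ∃ i, d = S.n i - S.k i + 1}

/-- The first `m + 1` requests of the stream. -/
def first (S : RequestStream) (m : ℕ) : Requests where
  N := m + 1
  a := S.a
  k := S.k
  n := S.n
  N_pos := m.succ_pos
  a_zero := S.a_zero
  a_mono := fun _ _ h _ => S.a_mono h
  k_pos := fun i _ => S.k_pos i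
  k_le_n := fun i _ => S.k_le_n i

end RequestStream

/-- The average flow time for an infinite stream: the upper limit, as `N → ∞`, of the average flow
time for the first `N` requests. -/
def OnlinePolicy.limAvgFlowTime {L : ℕ} (π : OnlinePolicy L) (μ : ℝ) (S : RequestStream) :
    ENNReal :=
  limsup (fun m : ℕ => π.avgFlowTime μ (S.first m)) atTop

/-- The optimal average flow time for an infinite stream among all online policies. -/
def limOptFlowTime (L : ℕ) (μ : ℝ) (S : RequestStream) : ENNReal :=
  ⨅ π : OnlinePolicy L, π.limAvgFlowTime μ S

/-- The delay gap `(1 / μ) * ∑_{l = d}^{L - 1} 1 / l` (zero if `d ≥ L`). -/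
def delayGap (L : ℕ) (μ : ℝ) (d : ℕ) : ℝ := (1 / μ) * ∑ l ∈ Finset.Ico d L, 1 / (l : ℝ)

end CloudStorage

end

/-! Fix the seeds. The backlog of order `m` is the least number of further downloads after which `m`
of the arrived requests are complete. The number of incomplete requests, those yet to arrive
included, equals the number of `m ≤ N` with a positive backlog. Integrated over time, this turns the
sum of the completion times into the total time during which backlogs are positive
(`sum_completionTime_eq`).

By lack of memory, under any online policy each chunk under service finishes at rate `μ` whatever
the past; `dynkin` makes this precise. One download lowers a backlog by at most one, so no policy
lowers backlogs faster than at rate `L * μ` (`evolve_le`). Under SERPT-R a backlog `v > 0` is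
lowered either by all `L` threads or by at least `v + dmin - 1` of them
(`Greedy.le_card_decreasing`): the cheapest `m` requests lack `v` chunks in total but offer at least
`v + dmin - 1` available ones, since an unfinished request always has at least `dmin - 1` spare
chunks.

Put `D = L - dmin`. The excess of the SERPT-R backlogs over `D` falls at the full rate `L * μ`
(`le_evolve`), and arrivals act on backlogs by a monotone map. Hence this excess is stochastically
at most the backlog under any other online policy (`excess_backlog_le`).

What remains is the time during which a SERPT-R backlog lies in `1, ..., D`. At level `v` it falls
at rate at least `μ * (v + dmin - 1)`, and arrivals never raise it, so the expected time is at most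
`(1 / μ) * ∑ 1 / (v + dmin - 1)` over `1 ≤ v ≤ D`, which is the delay gap
(`lintegral_small_backlog_le`). This loss occurs once for each of the `N` orders `m`, and the
average divides by `N`.

A SERPT-R policy exists because its feedback rule can be run from event to event, with finitely many
events in bounded time (`Simulation.le_event`). -/

noncomputable section

namespace CloudStorage

open Topology
open scoped Classical

/-! ### Downloaded chunks and cumulative service along one trajectory. -/

namespace Requests

/-- The finite set of all coded chunks of the requests. -/
def chunks (R : Requests) : Finset Chunk :=
  (Finset.range R.N).biUnion fun i => (Finset.range (R.n i)).image (Prod.mk i)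

@[simp] lemma mem_chunks {R : Requests} {c : Chunk} :
    c ∈ R.chunks ↔ c.1 < R.N ∧ c.2 < R.n c.1 := by
  obtain ⟨i, j⟩ := c
  simp [chunks]

/-- The finite set of all chunks whose download is complete at time `t`. -/
def done (R : Requests) (σ : ℝ → Finset Chunk) (x : Chunk → ℝ) (t : ℝ) : Finset Chunk :=
  R.chunks.filter fun c => ENNReal.ofReal (x c) ≤ service σ c t

/-- The number of chunks of request `i` that are missing when exactly the chunks in `B` are
downloaded. -/
def missing (R : Requests) (B : Finset Chunk) (i : ℕ) : ℕ :=
  R.k i - (B.filter fun c => c.1 = i).card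

lemma done_subset (R : Requests) (σ : ℝ → Finset Chunk) (x : Chunk → ℝ) (t : ℝ) :
    R.done σ x t ⊆ R.chunks := Finset.filter_subset _ _

lemma mem_done {R : Requests} {σ : ℝ → Finset Chunk} {x : Chunk → ℝ} {t : ℝ} {c : Chunk} :
    c ∈ R.done σ x t ↔ c ∈ R.chunks ∧ ENNReal.ofReal (x c) ≤ service σ c t := by
  simp [done]

lemma mem_downloaded {R : Requests} {σ : ℝ → Finset Chunk} {x : Chunk → ℝ} {t : ℝ} {i j : ℕ} :
    j ∈ R.downloaded σ x t i ↔ j < R.n i ∧ ENNReal.ofReal (x (i, j)) ≤ service σ (i, j) t := by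
  simp [downloaded]

lemma mem_downloaded_iff_mem_done {R : Requests} {σ : ℝ → Finset Chunk} {x : Chunk → ℝ} {t : ℝ}
    {i j : ℕ} (hi : i < R.N) : j ∈ R.downloaded σ x t i ↔ (i, j) ∈ R.done σ x t := by
  rw [mem_downloaded, mem_done, mem_chunks]
  simp [hi]

lemma card_downloaded {R : Requests} {σ : ℝ → Finset Chunk} {x : Chunk → ℝ} {t : ℝ}
    {i : ℕ} (hi : i < R.N) :
    (R.downloaded σ x t i).card = ((R.done σ x t).filter fun c => c.1 = i).card := by
  rw [← Finset.card_image_of_injective _ (Prod.mk_right_injective i)]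
  congr 1
  ext ⟨i', j⟩
  simp only [Finset.mem_image, Prod.mk.injEq, Finset.mem_filter]
  constructor
  · rintro ⟨j', h, rfl, rfl⟩
    exact ⟨(mem_downloaded_iff_mem_done hi).1 h, rfl⟩
  · rintro ⟨h, rfl⟩
    exact ⟨j, (mem_downloaded_iff_mem_done hi).2 h, rfl, rfl⟩

lemma remaining_eq {R : Requests} {σ : ℝ → Finset Chunk} {x : Chunk → ℝ} {t : ℝ}
    {i : ℕ} (hi : i < R.N) : R.remaining σ x t i = R.missing (R.done σ x t) i := by
  rw [remaining, missing, card_downloaded hi]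

lemma available_iff {R : Requests} {σ : ℝ → Finset Chunk} {x : Chunk → ℝ} {t : ℝ} {c : Chunk} :
    R.Available σ x t c ↔ c ∈ R.chunks ∧ R.a c.1 ≤ t ∧ 0 < R.missing (R.done σ x t) c.1 ∧
      c ∉ R.done σ x t := by
  obtain ⟨i, j⟩ := c
  simp only [Available, Unfinished, Arrived, mem_chunks]
  constructor
  · rintro ⟨⟨⟨h1, h2⟩, h3⟩, h4, h5⟩
    rw [remaining_eq h1] at h3
    exact ⟨⟨h1, h4⟩, h2, h3, fun h => h5 ((mem_downloaded_iff_mem_done h1).2 h)⟩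
  · rintro ⟨⟨h1, h4⟩, h2, h3, h5⟩
    rw [← remaining_eq h1] at h3
    exact ⟨⟨⟨h1, h2⟩, h3⟩, h4, fun h => h5 ((mem_downloaded_iff_mem_done h1).1 h)⟩

section Service

variable {σ σ' : ℝ → Finset Chunk} {c : Chunk} {s t : ℝ}

lemma service_mono (h : s ≤ t) : service σ c s ≤ service σ c t :=
  measure_mono fun _ hr => ⟨hr.1, hr.2.1.trans h, hr.2.2⟩

lemma service_of_nonpos (h : t ≤ 0) : service σ c t = 0 := by
  have hsub : {s : ℝ | 0 ≤ s ∧ s ≤ t ∧ c ∈ σ s} ⊆ {0} := fun s hs =>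
    le_antisymm (hs.2.1.trans h) hs.1
  exact measure_mono_null hsub (by simp)

lemma service_le_add (σ : ℝ → Finset Chunk) (c : Chunk) (s t : ℝ) :
    service σ c t ≤ service σ c s + ENNReal.ofReal (t - s) := by
  have hsub : {r : ℝ | 0 ≤ r ∧ r ≤ t ∧ c ∈ σ r} ⊆
      {r : ℝ | 0 ≤ r ∧ r ≤ s ∧ c ∈ σ r} ∪ Set.Icc s t := by
    rintro r ⟨h0, h1, h2⟩
    rcases le_total r s with h3 | h3
    · exact Or.inl ⟨h0, h3, h2⟩
    · exact Or.inr ⟨h3, h1⟩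
  refine (measure_mono hsub).trans ((measure_union_le _ _).trans ?_)
  rw [Real.volume_Icc]
  rfl

lemma service_le (σ : ℝ → Finset Chunk) (c : Chunk) (t : ℝ) :
    service σ c t ≤ ENNReal.ofReal t := by
  rcases le_total t 0 with h | h
  · simp [service_of_nonpos h]
  · simpa [service_of_nonpos le_rfl] using service_le_add σ c 0 t

lemma service_ne_top : service σ c t ≠ ⊤ :=
  ((service_le σ c t).trans_lt ENNReal.ofReal_lt_top).ne

lemma service_congr (h : ∀ s < t, σ s = σ' s) : service σ c t = service σ' c t := by
  have key : ∀ {σ₁ σ₂ : ℝ → Finset Chunk}, (∀ s < t, σ₁ s = σ₂ s) →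
      service σ₁ c t ≤ service σ₂ c t := by
    intro σ₁ σ₂ h12
    have hsub : {r : ℝ | 0 ≤ r ∧ r ≤ t ∧ c ∈ σ₁ r} ⊆
        {r : ℝ | 0 ≤ r ∧ r ≤ t ∧ c ∈ σ₂ r} ∪ {t} := by
      rintro r ⟨h0, h1, h2⟩
      rcases h1.eq_or_lt with h3 | h3
      · exact Or.inr h3
      · exact Or.inl ⟨h0, h1, h12 r h3 ▸ h2⟩
    refine (measure_mono hsub).trans ((measure_union_le _ _).trans ?_)
    simp [service]
  exact le_antisymm (key h) (key fun s hs => (h s hs).symm)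

end Service

/-- Service is nondecreasing and grows at most at unit rate, so each of the finitely many incomplete
chunks keeps a positive deficit for a while. This right-continuity replaces induction over jump
times. -/
lemma eventually_done_eq (R : Requests) (σ : ℝ → Finset Chunk) (x : Chunk → ℝ) (t : ℝ) :
    ∀ᶠ s in 𝓝[≥] t, R.done σ x s = R.done σ x t := by
  have h : ∀ᶠ s in 𝓝[≥] t, ∀ c ∈ R.chunks,
      (ENNReal.ofReal (x c) ≤ service σ c s ↔ ENNReal.ofReal (x c) ≤ service σ c t) := by
    rw [Filter.eventually_all_finset]
    intro c _
    by_cases hc : ENNReal.ofReal (x c) ≤ service σ c t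
    · filter_upwards [self_mem_nhdsWithin] with s hs
      simp [hc, hc.trans (service_mono hs)]
    · have hcont : Continuous fun s : ℝ => service σ c t + ENNReal.ofReal (s - t) :=
        continuous_const.add (ENNReal.continuous_ofReal.comp (by fun_prop))
      have hlt : service σ c t + ENNReal.ofReal (t - t) < ENNReal.ofReal (x c) := by
        simpa using hc
      filter_upwards [self_mem_nhdsWithin,
        nhdsWithin_le_nhds (hcont.continuousAt.eventually_lt continuousAt_const hlt)] with s hs hs'
      have := (service_le_add σ c t s).trans_lt hs'
      simp [hc, this]
  filter_upwards [h] with s hs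
  exact Finset.filter_congr hs

end Requests

/-! ### Policies for fixed requests and seed, and their nonanticipation. -/

open Requests

/-- The service assignments `σ x t`, for downloading times `x`, that an online policy can produce
for the requests `R` and a fixed random seed. -/
structure IsControl (R : Requests) (L : ℕ) (σ : (Chunk → ℝ) → ℝ → Finset Chunk) : Prop where
  measurable : ∀ c, MeasurableSet {p : (Chunk → ℝ) × ℝ | c ∈ σ p.1 p.2}
  card_le : ∀ x t, (σ x t).card ≤ L
  available : ∀ x t, ∀ c ∈ σ x t, R.Available (σ x) x t c
  online : ∀ x x' t,
    (∀ i, R.Arrived t i → ∀ r ≤ t, R.downloaded (σ x) x r i = R.downloaded (σ x') x' r i) →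
    σ x t = σ x' t

lemma OnlinePolicy.isControl {L : ℕ} (π : OnlinePolicy L) (R : Requests) (u : π.Seed) :
    IsControl R L (π.assign R u) where
  measurable c := measurable_prodMk_left (π.measurable_assign R c)
  card_le := π.card_le R u
  available := π.available R u
  online x x' t h := π.online R R u x x' t (fun _ => Iff.rfl) (fun _ _ => ⟨rfl, rfl, rfl⟩) h

namespace IsControl

variable {R : Requests} {L : ℕ} {σ : (Chunk → ℝ) → ℝ → Finset Chunk}

lemma online_done (hσ : IsControl R L σ) {x x' : Chunk → ℝ} {t : ℝ}
    (h : ∀ r ≤ t, R.done (σ x) x r = R.done (σ x') x' r) : σ x t = σ x' t := by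
  refine hσ.online x x' t fun i hi r hr => ?_
  ext j
  rw [mem_downloaded_iff_mem_done hi.1, mem_downloaded_iff_mem_done hi.1, h r hr]

/-- Two realizations of the downloading times that differ only in chunks which are not yet
downloaded by time `t` lead to the same decisions up to time `t`. -/
lemma agree (hσ : IsControl R L σ) {x x' : Chunk → ℝ} {t : ℝ}
    (h : ∀ c ∈ R.chunks, x c = x' c ∨
      (service (σ x) c t < ENNReal.ofReal (x c) ∧ service (σ x) c t < ENNReal.ofReal (x' c))) :
    ∀ s ≤ t, σ x s = σ x' s := by
  -- A chunk on which `x` and `x'` differ is incomplete at `r` in both realizations, because the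
  -- service it has received is the same in both and below either downloading time.
  have step : ∀ r ≤ t, (∀ s < r, σ x s = σ x' s) → R.done (σ x) x r = R.done (σ x') x' r := by
    intro r hr hs
    refine Finset.filter_congr fun c hc => ?_
    rw [← service_congr hs]
    rcases h c hc with h1 | ⟨h1, h2⟩
    · rw [h1]
    · have h3 := service_mono (σ := σ x) (c := c) hr
      simp only [(h3.trans_lt h1).not_ge, (h3.trans_lt h2).not_ge]
  have zero : ∀ r ≤ t, r ≤ 0 → R.done (σ x) x r = R.done (σ x') x' r := by
    intro r hr hr0
    refine Finset.filter_congr fun c hc => ?_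
    have h0 : service (σ x) c r = service (σ x') c r := by
      rw [service_of_nonpos hr0, service_of_nonpos hr0]
    rw [← h0]
    rcases h c hc with h1 | ⟨h1, h2⟩
    · rw [h1]
    · have h3 := service_mono (σ := σ x) (c := c) hr
      simp only [(h3.trans_lt h1).not_ge, (h3.trans_lt h2).not_ge]
  -- Induction over real time: at the infimum of the times of disagreement the two done sets still
  -- agree, by `step`, and both stay constant for a while afterwards, so disagreement cannot begin
  -- there.
  have all : ∀ r ≤ t, R.done (σ x) x r = R.done (σ x') x' r := by
    by_contra! hcon
    set S : Set ℝ := {r | r ≤ t ∧ R.done (σ x) x r ≠ R.done (σ x') x' r} with hS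
    have hne : S.Nonempty := hcon
    have hpos : ∀ r ∈ S, 0 < r := fun r hr => by
      by_contra hr0
      exact hr.2 (zero r hr.1 (not_lt.1 hr0))
    have hbdd : BddBelow S := ⟨0, fun r hr => (hpos r hr).le⟩
    have hlt : ∀ r < sInf S, r ≤ t → R.done (σ x) x r = R.done (σ x') x' r := by
      intro r hr hrt
      by_contra hne'
      exact (notMem_of_lt_csInf hr hbdd) ⟨hrt, hne'⟩
    obtain ⟨r₁, hr₁⟩ := hne
    have hle : sInf S ≤ t := (csInf_le hbdd hr₁).trans hr₁.1
    have heq : R.done (σ x) x (sInf S) = R.done (σ x') x' (sInf S) :=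
      step _ hle fun s hs => hσ.online_done fun r hr =>
        hlt r (hr.trans_lt hs) ((hr.trans hs.le).trans hle)
    have hev := (R.eventually_done_eq (σ x) x (sInf S)).and
      (R.eventually_done_eq (σ x') x' (sInf S))
    obtain ⟨u, hu, hu'⟩ := (mem_nhdsGE_iff_exists_Ico_subset).1 hev
    obtain ⟨r, hr, hru⟩ := exists_lt_of_csInf_lt ⟨r₁, hr₁⟩ (show sInf S < u from hu)
    have := hu' ⟨csInf_le hbdd hr, hru⟩
    exact hr.2 (by rw [this.1, this.2, heq])
  exact fun s hs => hσ.online_done fun r hr => all r (hr.trans hs)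

end IsControl

end CloudStorage

end

/-! ### Measurability, the exponential law, and a calculus lemma. -/

noncomputable section

namespace CloudStorage

open Topology Requests
open scoped Classical

section Measurability

variable {Ω : Type*} [MeasurableSpace Ω] {σ : Ω → ℝ → Finset Chunk} {X : Ω → Chunk → ℝ}

lemma measurable_service
    (hσ : ∀ c, MeasurableSet {p : Ω × ℝ | c ∈ σ p.1 p.2}) (c : Chunk) :
    Measurable fun p : Ω × ℝ => service (σ p.1) c p.2 := by
  have h : MeasurableSet {q : (Ω × ℝ) × ℝ | 0 ≤ q.2 ∧ q.2 ≤ q.1.2 ∧ c ∈ σ q.1.1 q.2} := by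
    refine (measurableSet_le measurable_const measurable_snd).inter
      ((measurableSet_le measurable_snd (measurable_snd.comp measurable_fst)).inter ?_)
    exact ((measurable_fst.comp measurable_fst).prodMk measurable_snd) (hσ c)
  exact measurable_measure_prodMk_left h

lemma measurableSet_ofReal_le_service
    (hσ : ∀ c, MeasurableSet {p : Ω × ℝ | c ∈ σ p.1 p.2}) (hX : Measurable X) (c : Chunk) :
    MeasurableSet {p : Ω × ℝ | ENNReal.ofReal (X p.1 c) ≤ service (σ p.1) c p.2} := by
  refine measurableSet_le (Measurable.ennreal_ofReal ?_) (measurable_service hσ c)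
  exact (measurable_pi_apply c).comp (hX.comp measurable_fst)

lemma measurableSet_assign_eq
    (hσ : ∀ c, MeasurableSet {p : Ω × ℝ | c ∈ σ p.1 p.2}) (B : Finset Chunk) :
    MeasurableSet {p : Ω × ℝ | σ p.1 p.2 = B} := by
  have : {p : Ω × ℝ | σ p.1 p.2 = B} = ⋂ c, {p | c ∈ σ p.1 p.2 ↔ c ∈ B} := by
    ext p
    simp [Finset.ext_iff]
  rw [this]
  refine MeasurableSet.iInter fun c => ?_
  by_cases hc : c ∈ B
  · simpa [hc] using hσ c
  · simp only [hc, iff_false]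
    exact (hσ c).compl

lemma measurableSet_done_eq
    (hσ : ∀ c, MeasurableSet {p : Ω × ℝ | c ∈ σ p.1 p.2}) (hX : Measurable X) (R : Requests) (B : Finset Chunk) :
    MeasurableSet {p : Ω × ℝ | R.done (σ p.1) (X p.1) p.2 = B} := by
  have : {p : Ω × ℝ | R.done (σ p.1) (X p.1) p.2 = B} = ⋂ c : Chunk,
      {p | c ∈ R.done (σ p.1) (X p.1) p.2 ↔ c ∈ B} := by
    ext p
    simp [Finset.ext_iff]
  rw [this]
  refine MeasurableSet.iInter fun c => ?_
  have hm : MeasurableSet {p : Ω × ℝ | c ∈ R.done (σ p.1) (X p.1) p.2} := by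
    by_cases hc : c ∈ R.chunks
    · simpa only [mem_done, hc, true_and] using measurableSet_ofReal_le_service hσ hX c
    · simp [mem_done, hc]
  by_cases hc : c ∈ B
  · simpa [hc] using hm
  · simp only [hc, iff_false]
    exact hm.compl

end Measurability

section DownloadLaw

variable {μ : ℝ}

lemma isProbabilityMeasure_downloadLaw (hμ : 0 < μ) : IsProbabilityMeasure (downloadLaw μ) := by
  have := isProbabilityMeasure_expMeasure hμ
  unfold downloadLaw
  infer_instance

lemma expMeasure_real_Ioi (hμ : 0 < μ) {a : ℝ} (ha : 0 ≤ a) :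
    (expMeasure μ).real (Set.Ioi a) = Real.exp (-(μ * a)) := by
  have := isProbabilityMeasure_expMeasure hμ
  have h := cdf_expMeasure_eq hμ a
  rw [cdf_eq_real, if_pos ha] at h
  rw [← Set.compl_Iic, probReal_compl_eq_one_sub measurableSet_Iic, h]
  ring

lemma downloadLaw_real_pi (hμ : 0 < μ) (A : Finset Chunk) {r : Chunk → ℝ} (hr : ∀ c ∈ A, 0 ≤ r c) :
    (downloadLaw μ).real (Set.pi A fun c => Set.Ioi (r c)) = Real.exp (-(μ * ∑ c ∈ A, r c)) := by
  have := isProbabilityMeasure_expMeasure hμ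
  rw [Measure.real, downloadLaw, Measure.infinitePi_pi _ fun _ _ => measurableSet_Ioi,
    ENNReal.toReal_prod, Finset.mul_sum, ← Finset.sum_neg_distrib, Real.exp_sum]
  exact Finset.prod_congr rfl fun c hc => expMeasure_real_Ioi hμ (hr c hc)

lemma ae_pos (hμ : 0 < μ) : ∀ᵐ x ∂downloadLaw μ, ∀ c, 0 < x c := by
  have := isProbabilityMeasure_downloadLaw hμ
  rw [ae_all_iff]
  intro c
  have h := downloadLaw_real_pi hμ {c} (r := fun _ => 0) (by simp)
  have hm : MeasurableSet (Set.pi (({c} : Finset Chunk) : Set Chunk)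
      fun _ => Set.Ioi (0 : ℝ)) :=
    MeasurableSet.pi (Finset.countable_toSet _) fun _ _ => measurableSet_Ioi
  have h1 : (downloadLaw μ) (Set.pi (({c} : Finset Chunk) : Set Chunk)
      fun _ => Set.Ioi (0 : ℝ)) = 1 := by
    rw [← ENNReal.toReal_eq_one_iff]
    simpa [Measure.real] using h
  have h2 := (prob_compl_eq_zero_iff hm).2 h1
  filter_upwards [compl_mem_ae_iff.2 h2] with x hx
  simpa using hx

/-- Resampling the downloading times of the chunks in `A` preserves the law. -/
lemma measurePreserving_piecewise (hμ : 0 < μ) (A : Finset Chunk) :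
    MeasurePreserving (fun p : (Chunk → ℝ) × (Chunk → ℝ) => A.piecewise p.2 p.1)
      ((downloadLaw μ).prod (downloadLaw μ)) (downloadLaw μ) := by
  have := isProbabilityMeasure_expMeasure hμ
  have hmeas : Measurable fun p : (Chunk → ℝ) × (Chunk → ℝ) => A.piecewise p.2 p.1 := by
    rw [measurable_pi_iff]
    intro c
    by_cases hc : c ∈ A
    · simp only [Finset.piecewise_eq_of_mem _ _ _ hc]
      exact (measurable_pi_apply c).comp measurable_snd
    · simp only [Finset.piecewise_eq_of_notMem _ _ _ hc]
      exact (measurable_pi_apply c).comp measurable_fst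
  refine ⟨hmeas, ?_⟩
  have := isProbabilityMeasure_downloadLaw hμ
  refine Measure.eq_infinitePi _ fun s t ht => ?_
  rw [Measure.map_apply hmeas (MeasurableSet.pi s.countable_toSet fun i _ => ht i)]
  have hpre : (fun p : (Chunk → ℝ) × (Chunk → ℝ) => A.piecewise p.2 p.1) ⁻¹' (Set.pi s t) =
      (Set.pi (s.filter (· ∉ A) : Finset Chunk) t) ×ˢ (Set.pi (s.filter (· ∈ A) : Finset Chunk) t) := by
    ext p
    simp only [Set.mem_preimage, Set.mem_pi, Set.mem_prod, Finset.coe_filter, Set.mem_ofPred_eq,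
      Finset.mem_coe]
    constructor
    · intro h
      refine ⟨fun c hc => ?_, fun c hc => ?_⟩
      · simpa [Finset.piecewise_eq_of_notMem _ _ _ hc.2] using h c hc.1
      · simpa [Finset.piecewise_eq_of_mem _ _ _ hc.2] using h c hc.1
    · rintro ⟨h1, h2⟩ c hc
      by_cases hA : c ∈ A
      · simpa [Finset.piecewise_eq_of_mem _ _ _ hA] using h2 c ⟨hc, hA⟩
      · simpa [Finset.piecewise_eq_of_notMem _ _ _ hA] using h1 c ⟨hc, hA⟩
  rw [hpre, Measure.prod_prod, downloadLaw, Measure.infinitePi_pi _ fun i _ => ht i,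
    Measure.infinitePi_pi _ fun i _ => ht i, mul_comm]
  exact Finset.prod_filter_mul_prod_filter_not s (· ∈ A) _

end DownloadLaw

section Calculus

lemma abs_exp_neg_sub_le {x y : ℝ} (hx : 0 ≤ x) (hy : 0 ≤ y) :
    |Real.exp (-x) - Real.exp (-y)| ≤ |x - y| := by
  wlog h : x ≤ y generalizing x y
  · rw [abs_sub_comm, abs_sub_comm x]
    exact this hy hx (le_of_not_ge h)
  rw [abs_of_nonneg (sub_nonneg.2 (Real.exp_le_exp.2 (by linarith))),
    abs_of_nonpos (by linarith)]
  have h1 : Real.exp (-y) = Real.exp (-x) * Real.exp (-(y - x)) := by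
    rw [← Real.exp_add]; ring_nf
  have h2 : 1 - (y - x) ≤ Real.exp (-(y - x)) := by
    have := Real.add_one_le_exp (-(y - x)); linarith
  have h3 : Real.exp (-x) ≤ 1 := Real.exp_le_one_iff.2 (by linarith)
  have h4 := Real.exp_pos (-x)
  rw [h1]
  nlinarith

/-- The fundamental theorem of calculus for `f s * exp (-μ ∫₀ˢ g)`. -/
lemma integral_mul_exp_neg {μ : ℝ} (hμ : 0 < μ) {g f f' : ℝ → ℝ} {M : ℝ} (hgm : Measurable g)
    (hg0 : ∀ s, 0 ≤ g s) (hgM : ∀ s, g s ≤ M) (hf : ∀ s, HasDerivAt f (f' s) s)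
    (hf' : Continuous f') {a b : ℝ} (ha : 0 ≤ a) (hab : a ≤ b) :
    ∫ s in a..b, (f' s - μ * f s * g s) * Real.exp (-(μ * ∫ r in (0 : ℝ)..s, g r)) =
      f b * Real.exp (-(μ * ∫ r in (0 : ℝ)..b, g r)) -
        f a * Real.exp (-(μ * ∫ r in (0 : ℝ)..a, g r)) := by
  have hgi : ∀ s t, IntervalIntegrable g volume s t := fun s t => by
    rw [intervalIntegrable_iff]
    refine Measure.integrableOn_of_bounded (M := M) (by simp) hgm.aestronglyMeasurable ?_
    exact Eventually.of_forall fun s => by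
      rw [Real.norm_eq_abs, abs_of_nonneg (hg0 s)]; exact hgM s
  set θ : ℝ → ℝ := fun s => ∫ r in (0 : ℝ)..s, g r with hθ
  have hθ0 : ∀ s, 0 ≤ s → 0 ≤ θ s := fun s hs =>
    intervalIntegral.integral_nonneg hs fun r _ => hg0 r
  have hM : 0 ≤ M := (hg0 0).trans (hgM 0)
  have hθd : ∀ s t, |θ s - θ t| ≤ M * |s - t| := fun s t => by
    rw [hθ]
    simp only
    rw [intervalIntegral.integral_interval_sub_left (hgi _ _) (hgi _ _), ← Real.norm_eq_abs]
    refine intervalIntegral.norm_integral_le_of_norm_le_const fun r _ => ?_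
    rw [Real.norm_eq_abs, abs_of_nonneg (hg0 r)]; exact hgM r
  set e : ℝ → ℝ := fun s => Real.exp (-(μ * θ s)) with he
  have hIcc : ∀ s ∈ Set.uIcc a b, 0 ≤ s := fun s hs => by
    rw [Set.uIcc_of_le hab] at hs; exact ha.trans hs.1
  -- As `g` is only bounded and measurable, `θ` is merely Lipschitz; the fundamental theorem is
  -- therefore used in its absolutely continuous form, with the derivative of `θ` known almost
  -- everywhere.
  have heac : AbsolutelyContinuousOnInterval e a b := by
    refine LipschitzOnWith.absolutelyContinuousOnInterval (K := (μ * M).toNNReal) ?_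
    refine LipschitzOnWith.of_dist_le_mul fun s hs t ht => ?_
    rw [Real.dist_eq, Real.dist_eq, Real.coe_toNNReal _ (by positivity)]
    refine (abs_exp_neg_sub_le (mul_nonneg hμ.le (hθ0 s (hIcc s hs)))
      (mul_nonneg hμ.le (hθ0 t (hIcc t ht)))).trans ?_
    rw [← mul_sub, abs_mul, abs_of_pos hμ, mul_assoc]
    exact mul_le_mul_of_nonneg_left (hθd s t) hμ.le
  have hfac : AbsolutelyContinuousOnInterval f a b := by
    have h1 : AbsolutelyContinuousOnInterval (fun s => ∫ r in a..s, f' r) a b :=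
      (hf'.intervalIntegrable a b).absolutelyContinuousOnInterval_intervalIntegral (by simp)
    have h2 : AbsolutelyContinuousOnInterval (fun _ : ℝ => f a) a b :=
      (LipschitzWith.const (f a)).lipschitzOnWith.absolutelyContinuousOnInterval
    have h3 : f = (fun s => ∫ r in a..s, f' r) + fun _ => f a := by
      funext s
      simp [intervalIntegral.integral_eq_sub_of_hasDerivAt (fun r _ => hf r)
        (hf'.intervalIntegrable a s)]
    rw [h3]
    exact h1.add h2
  refine Eq.trans ?_ (hfac.mul heac).integral_deriv_eq_sub
  refine intervalIntegral.integral_congr_ae ?_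
  have hloc : ∀ᵐ s, s ∈ Set.uIcc 0 b → ∀ c ∈ Set.uIcc 0 b,
      HasDerivAt (fun s => ∫ r in c..s, g r) (g s) s := (hgi 0 b).ae_hasDerivAt_integral
  filter_upwards [hloc] with s hs hsab
  have hs' : s ∈ Set.uIcc 0 b := by
    rw [Set.uIoc_of_le hab] at hsab
    rw [Set.uIcc_of_le (ha.trans hab)]
    exact ⟨ha.trans hsab.1.le, hsab.2⟩
  have hd := hs hs' 0 (by simp)
  have hde : HasDerivAt e (Real.exp (-(μ * θ s)) * (-(μ * g s))) s :=
    ((hd.const_mul μ).neg).exp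
  have := ((hf s).mul hde).deriv
  rw [this]
  ring

end Calculus

end CloudStorage

end

/-! ### Dynkin's formula for the set of downloaded chunks. -/

noncomputable section

namespace CloudStorage

open Topology Requests
open scoped Classical

/-- The generator of the download process: the drift of `F` at time `s` when the chunks in `B` are
downloaded and those in `S` are under service. -/
def drift (μ : ℝ) (F F' : ℝ → Finset Chunk → ℝ) (s : ℝ) (B S : Finset Chunk) : ℝ :=
  F' s B + μ * ∑ c ∈ S, (F s (insert c B) - F s B)

namespace IsControl

variable {R : Requests} {L : ℕ} {σ : (Chunk → ℝ) → ℝ → Finset Chunk}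

lemma subset_chunks (hσ : IsControl R L σ) (x : Chunk → ℝ) (t : ℝ) : σ x t ⊆ R.chunks :=
  fun c hc => (available_iff.1 (hσ.available x t c hc)).1

lemma measurableSet_state (hσ : IsControl R L σ) (B S : Finset Chunk) :
    MeasurableSet {p : ℝ × (Chunk → ℝ) | R.done (σ p.2) p.2 p.1 = B ∧ σ p.2 p.1 = S} :=
  (measurable_swap (measurableSet_done_eq hσ.measurable measurable_id R B)).inter
    (measurable_swap (measurableSet_assign_eq hσ.measurable S))

/-- The pair of done and served sets takes finitely many values, so every function of it is a finite
sum of indicators. The integrability lemmas below rest on this and need no regularity of `H` in the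
two sets. -/
lemma eq_sum_state (hσ : IsControl R L σ) (H : Finset Chunk → Finset Chunk → ℝ) (s : ℝ)
    (x : Chunk → ℝ) : H (R.done (σ x) x s) (σ x s) =
      ∑ B ∈ R.chunks.powerset, ∑ S ∈ R.chunks.powerset,
        if R.done (σ x) x s = B ∧ σ x s = S then H B S else 0 := by
  rw [Finset.sum_eq_single_of_mem _ (Finset.mem_powerset.2 (R.done_subset (σ x) x s)),
    Finset.sum_eq_single_of_mem _ (Finset.mem_powerset.2 (hσ.subset_chunks x s))]
  · simp
  · intro S _ hS
    rw [if_neg fun h => hS h.2.symm]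
  · intro B _ hB
    exact Finset.sum_eq_zero fun S _ => if_neg fun h => hB h.1.symm

lemma integrable_prod_state (hσ : IsControl R L σ) (ν : Measure (Chunk → ℝ))
    [IsProbabilityMeasure ν] {H : ℝ → Finset Chunk → Finset Chunk → ℝ}
    (hH : ∀ B S, Continuous fun s => H s B S) (a b : ℝ) :
    Integrable (fun p : ℝ × (Chunk → ℝ) => H p.1 (R.done (σ p.2) p.2 p.1) (σ p.2 p.1))
      ((volume.restrict (Set.uIoc a b)).prod ν) := by
  have h : (fun p : ℝ × (Chunk → ℝ) => H p.1 (R.done (σ p.2) p.2 p.1) (σ p.2 p.1)) =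
      fun p => ∑ B ∈ R.chunks.powerset, ∑ S ∈ R.chunks.powerset,
        Set.indicator {p : ℝ × (Chunk → ℝ) | R.done (σ p.2) p.2 p.1 = B ∧ σ p.2 p.1 = S}
          (fun p => H p.1 B S) p := by
    funext p
    rw [hσ.eq_sum_state (H p.1) p.1 p.2]
    simp only [Set.indicator_apply, Set.mem_ofPred_eq]
  rw [h]
  refine integrable_finsetSum _ fun B _ => integrable_finsetSum _ fun S _ => ?_
  refine Integrable.indicator ?_ (hσ.measurableSet_state B S)
  have h1 : Integrable (fun s => H s B S) (volume.restrict (Set.uIoc a b)) :=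
    intervalIntegrable_iff.1 ((hH B S).intervalIntegrable a b)
  exact h1.comp_fst ν

lemma integrable_state (hσ : IsControl R L σ) (ν : Measure (Chunk → ℝ))
    [IsProbabilityMeasure ν] (H : Finset Chunk → Finset Chunk → ℝ) (s : ℝ) :
    Integrable (fun x : Chunk → ℝ => H (R.done (σ x) x s) (σ x s)) ν := by
  have h : (fun x : Chunk → ℝ => H (R.done (σ x) x s) (σ x s)) =
      fun x => ∑ B ∈ R.chunks.powerset, ∑ S ∈ R.chunks.powerset,
        Set.indicator {x : Chunk → ℝ | R.done (σ x) x s = B ∧ σ x s = S} (fun _ => H B S) x := by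
    funext x
    rw [hσ.eq_sum_state H s x]
    simp only [Set.indicator_apply, Set.mem_ofPred_eq]
  rw [h]
  refine integrable_finsetSum _ fun B _ => integrable_finsetSum _ fun S _ => ?_
  exact (integrable_const _).indicator (measurable_prodMk_left (hσ.measurableSet_state B S))

lemma intervalIntegrable_state (hσ : IsControl R L σ) (ν : Measure (Chunk → ℝ))
    [IsProbabilityMeasure ν] {H : ℝ → Finset Chunk → Finset Chunk → ℝ}
    (hH : ∀ B S, Continuous fun s => H s B S) (a b : ℝ) :
    IntervalIntegrable (fun s => ∫ x, H s (R.done (σ x) x s) (σ x s) ∂ν) volume a b :=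
  intervalIntegrable_iff.2 (hσ.integrable_prod_state ν hH a b).integral_prod_left

/-- Dynkin's formula for the time-dependent functional `F` on the interval `[a, b]`. -/
def Dynkin (R : Requests) (σ : (Chunk → ℝ) → ℝ → Finset Chunk) (μ a b : ℝ)
    (F F' : ℝ → Finset Chunk → ℝ) : Prop :=
  ∫ x, F b (R.done (σ x) x b) ∂downloadLaw μ - ∫ x, F a (R.done (σ x) x a) ∂downloadLaw μ =
    ∫ s in a..b, ∫ x, drift μ F F' s (R.done (σ x) x s) (σ x s) ∂downloadLaw μ

lemma continuous_drift {μ : ℝ} {F F' : ℝ → Finset Chunk → ℝ}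
    (hF : ∀ B s, HasDerivAt (fun s => F s B) (F' s B) s)
    (hF' : ∀ B, Continuous fun s => F' s B) (B S : Finset Chunk) :
    Continuous fun s => drift μ F F' s B S := by
  have hc : ∀ B, Continuous fun s => F s B := fun B =>
    continuous_iff_continuousAt.2 fun s => (hF B s).continuousAt
  unfold drift
  exact (hF' B).add (continuous_const.mul (continuous_finsetSum _ fun c _ => (hc _).sub (hc _)))

section Resampling

variable {b : ℝ} {A : Finset Chunk} {x y : Chunk → ℝ} {s : ℝ}

/-- The value `b + 1` serves as "never completed before `b`", since service by time `s ≤ b` is at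
most `b`. The trajectory with this value on `A` is a reference that does not depend on `y`. -/
lemma agree_base (hσ : IsControl R L σ) (hsb : s ≤ b) (hb : 0 ≤ b)
    (h : ∀ c ∈ A, service (σ (A.piecewise (fun _ => b + 1) x)) c s < ENNReal.ofReal (y c)) :
    ∀ r ≤ s, σ (A.piecewise (fun _ => b + 1) x) r = σ (A.piecewise y x) r := by
  refine hσ.agree fun c _ => ?_
  by_cases hcA : c ∈ A
  · right
    rw [Finset.piecewise_eq_of_mem _ _ _ hcA, Finset.piecewise_eq_of_mem _ _ _ hcA]
    refine ⟨(service_le _ c s).trans_lt ?_, h c hcA⟩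
    exact (ENNReal.ofReal_lt_ofReal_iff (by linarith)).2 (by linarith)
  · left
    rw [Finset.piecewise_eq_of_notMem _ _ _ hcA, Finset.piecewise_eq_of_notMem _ _ _ hcA]

/-- While no chunk of `A` is complete, the policy cannot distinguish `y` from the reference value.
The event thus becomes a product of half-lines in `y`, with end points fixed by the reference
trajectory. -/
lemma disjoint_done_iff (hσ : IsControl R L σ) (hA : A ⊆ R.chunks) (hsb : s ≤ b) (hb : 0 ≤ b) :
    Disjoint (R.done (σ (A.piecewise y x)) (A.piecewise y x) s) A ↔
      ∀ c ∈ A, service (σ (A.piecewise (fun _ => b + 1) x)) c s < ENNReal.ofReal (y c) := by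
  constructor
  · intro hdis
    have hlt : ∀ c ∈ A, service (σ (A.piecewise y x)) c s < ENNReal.ofReal (y c) := by
      intro c hc
      by_contra hle
      refine Finset.disjoint_right.1 hdis hc (mem_done.2 ⟨hA hc, ?_⟩)
      rw [Finset.piecewise_eq_of_mem _ _ _ hc]
      exact not_lt.1 hle
    have hag : ∀ r ≤ s, σ (A.piecewise y x) r = σ (A.piecewise (fun _ => b + 1) x) r := by
      refine hσ.agree fun c _ => ?_
      by_cases hcA : c ∈ A
      · right
        rw [Finset.piecewise_eq_of_mem _ _ _ hcA, Finset.piecewise_eq_of_mem _ _ _ hcA]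
        refine ⟨hlt c hcA, (service_le _ c s).trans_lt ?_⟩
        exact (ENNReal.ofReal_lt_ofReal_iff (by linarith)).2 (by linarith)
      · left
        rw [Finset.piecewise_eq_of_notMem _ _ _ hcA, Finset.piecewise_eq_of_notMem _ _ _ hcA]
    intro c hc
    rw [← service_congr fun r hr => hag r hr.le]
    exact hlt c hc
  · intro h
    have hag := hσ.agree_base hsb hb h
    refine Finset.disjoint_right.2 fun c hc hcd => ?_
    have h1 := (mem_done.1 hcd).2
    rw [Finset.piecewise_eq_of_mem _ _ _ hc, ← service_congr fun r hr => hag r hr.le] at h1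
    exact (h c hc).not_ge h1

/-- On the event the assignment is that of the reference trajectory, a constant in `y`; the
probability of a product of half-lines under the exponential law is the exponential factor. -/
lemma integral_disjoint_done (hσ : IsControl R L σ) {μ : ℝ} (hμ : 0 < μ) (hA : A ⊆ R.chunks)
    (hsb : s ≤ b) (hb : 0 ≤ b) (x : Chunk → ℝ) (w : Finset Chunk → ℝ) :
    ∫ y, (if Disjoint (R.done (σ (A.piecewise y x)) (A.piecewise y x) s) A
        then w (σ (A.piecewise y x) s) else 0) ∂downloadLaw μ =
      w (σ (A.piecewise (fun _ => b + 1) x) s) *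
        Real.exp (-(μ * ∑ c ∈ A, (service (σ (A.piecewise (fun _ => b + 1) x)) c s).toReal)) := by
  set x₀ := A.piecewise (fun _ => b + 1) x with hx₀
  have heq : (fun y : Chunk → ℝ =>
      if Disjoint (R.done (σ (A.piecewise y x)) (A.piecewise y x) s) A
        then w (σ (A.piecewise y x) s) else 0) =
      Set.indicator (Set.pi A fun c => Set.Ioi (service (σ x₀) c s).toReal)
        fun _ => w (σ x₀ s) := by
    funext y
    have hmem : y ∈ (Set.pi A fun c => Set.Ioi (service (σ x₀) c s).toReal) ↔
        ∀ c ∈ A, service (σ x₀) c s < ENNReal.ofReal (y c) := by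
      simp only [Set.mem_pi, Finset.mem_coe, Set.mem_Ioi]
      exact forall₂_congr fun c _ => (ENNReal.lt_ofReal_iff_toReal_lt service_ne_top).symm
    by_cases h : ∀ c ∈ A, service (σ x₀) c s < ENNReal.ofReal (y c)
    · rw [if_pos ((hσ.disjoint_done_iff hA hsb hb).2 h), Set.indicator_of_mem (hmem.2 h),
        hσ.agree_base hsb hb h s le_rfl]
    · rw [if_neg fun h' => h ((hσ.disjoint_done_iff hA hsb hb).1 h'),
        Set.indicator_of_notMem fun h' => h (hmem.1 h')]
  rw [heq, integral_indicator_const, downloadLaw_real_pi hμ, smul_eq_mul, mul_comm]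
  · exact fun c _ => ENNReal.toReal_nonneg
  · exact MeasurableSet.pi A.countable_toSet fun c _ => measurableSet_Ioi

end Resampling

lemma toReal_service_eq_integral (hσ : IsControl R L σ) (x : Chunk → ℝ) (c : Chunk) {t : ℝ}
    (ht : 0 ≤ t) : (service (σ x) c t).toReal = ∫ s in (0 : ℝ)..t, if c ∈ σ x s then 1 else 0 := by
  have hm : MeasurableSet {s : ℝ | c ∈ σ x s} := measurable_prodMk_left (hσ.measurable c)
  have h1 : (fun s : ℝ => if c ∈ σ x s then (1 : ℝ) else 0) =
      Set.indicator {s : ℝ | c ∈ σ x s} fun _ => (1 : ℝ) := by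
    funext s
    simp [Set.indicator_apply]
  rw [h1, intervalIntegral.integral_of_le ht, ← integral_Icc_eq_integral_Ioc,
    setIntegral_indicator hm, setIntegral_const, smul_eq_mul, mul_one, service, Measure.real]
  congr 2
  ext s
  simp [and_assoc]

/-- Conditionally on the downloading times outside `A`, the survival probability of `A` is `exp (-μ
θ)`, where `θ` is the service given to `A` on the reference trajectory. Its logarithmic derivative
is `-μ` times the number of chunks of `A` under service, which is what the generator prescribes. -/
lemma dynkin_disjoint (hσ : IsControl R L σ) {μ : ℝ} (hμ : 0 < μ) {A : Finset Chunk}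
    (hA : A ⊆ R.chunks) {a b : ℝ} (ha : 0 ≤ a) (hab : a ≤ b) {f f' : ℝ → ℝ}
    (hf : ∀ s, HasDerivAt f (f' s) s) (hf' : Continuous f') :
    Dynkin R σ μ a b (fun s B => f s * if Disjoint B A then 1 else 0)
      (fun s B => f' s * if Disjoint B A then 1 else 0) := by
  have hν := isProbabilityMeasure_downloadLaw hμ
  set ν := downloadLaw μ with hνdef
  have hmp := measurePreserving_piecewise hμ A
  have hb : 0 ≤ b := ha.trans hab
  set z : (Chunk → ℝ) → (Chunk → ℝ) → Chunk → ℝ := fun x y => A.piecewise y x with hz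
  set x₀ : (Chunk → ℝ) → Chunk → ℝ := fun x => A.piecewise (fun _ => b + 1) x with hx₀
  set g : (Chunk → ℝ) → ℝ → ℝ := fun x s => ∑ c ∈ A, if c ∈ σ (x₀ x) s then 1 else 0 with hg
  set F : ℝ → Finset Chunk → ℝ := fun s B => f s * if Disjoint B A then 1 else 0 with hF
  set F' : ℝ → Finset Chunk → ℝ := fun s B => f' s * if Disjoint B A then 1 else 0 with hF'
  have hFd : ∀ B s, HasDerivAt (fun s => F s B) (F' s B) s := fun B s => (hf s).mul_const _
  have hF'c : ∀ B, Continuous fun s => F' s B := fun B => hf'.mul continuous_const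
  have hH := continuous_drift (μ := μ) hFd hF'c
  -- Downloading a chunk of `A` destroys the indicator and any other download leaves it unchanged.
  have hdrift : ∀ s B S, drift μ F F' s B S =
      if Disjoint B A then f' s - μ * f s * ∑ c ∈ A, (if c ∈ S then 1 else 0) else 0 := by
    intro s B S
    have hsum : ∑ c ∈ S, (F s (insert c B) - F s B) =
        if Disjoint B A then - f s * ∑ c ∈ A, (if c ∈ S then 1 else 0) else 0 := by
      by_cases hd : Disjoint B A
      · have h1 : ∀ c ∈ S, F s (insert c B) - F s B = if c ∈ A then - f s else 0 := by
          intro c _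
          simp only [hF, Finset.disjoint_insert_left, hd, and_true, if_true]
          by_cases hc : c ∈ A <;> simp [hc]
        rw [Finset.sum_congr rfl h1, if_pos hd, ← Finset.sum_filter, ← Finset.sum_filter,
          Finset.sum_const, Finset.sum_const, Finset.filter_mem_eq_inter,
          Finset.filter_mem_eq_inter, Finset.inter_comm]
        simp [mul_comm]
      · rw [if_neg hd]
        refine Finset.sum_eq_zero fun c _ => ?_
        simp [hF, Finset.disjoint_insert_left, hd]
    rw [drift, hsum]
    by_cases hd : Disjoint B A
    · simp only [hF', hd, if_true]; ring
    · simp [hF', hd]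
  have hθ : ∀ x s, 0 ≤ s → ∑ c ∈ A, (service (σ (x₀ x)) c s).toReal =
      ∫ r in (0 : ℝ)..s, g x r := by
    intro x s hs
    rw [hg]
    simp only
    rw [intervalIntegral.integral_finsetSum]
    · exact Finset.sum_congr rfl fun c _ => hσ.toReal_service_eq_integral _ c hs
    · intro c _
      rw [intervalIntegrable_iff]
      refine Measure.integrableOn_of_bounded (M := 1) (by simp) ?_ ?_
      · exact (Measurable.ite (measurable_prodMk_left (hσ.measurable c)) measurable_const
          measurable_const).aestronglyMeasurable
      · exact Eventually.of_forall fun s => by split_ifs <;> simp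
  -- The formula for fixed times outside `A`, with only the coordinates in `A` averaged. It is
  -- integrated over `x` at the end, where Fubini exchanges that average with the time integral.
  have hpath : ∀ x, ∫ y, F b (R.done (σ (z x y)) (z x y) b) ∂ν -
      ∫ y, F a (R.done (σ (z x y)) (z x y) a) ∂ν =
      ∫ s in a..b, ∫ y, drift μ F F' s (R.done (σ (z x y)) (z x y) s) (σ (z x y) s) ∂ν := by
    intro x
    have hend : ∀ s, 0 ≤ s → s ≤ b → ∫ y, F s (R.done (σ (z x y)) (z x y) s) ∂ν =
        f s * Real.exp (-(μ * ∫ r in (0 : ℝ)..s, g x r)) := by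
      intro s hs hsb
      rw [← hθ x s hs]
      have := hσ.integral_disjoint_done hμ hA hsb hb x fun _ => f s
      rw [← this]
      refine integral_congr_ae (Eventually.of_forall fun y => ?_)
      simp [hF, hz]
    rw [hend b hb le_rfl, hend a ha hab,
      ← integral_mul_exp_neg (M := A.card) hμ ?_ ?_ ?_ hf hf' ha hab]
    · refine intervalIntegral.integral_congr fun s hs => ?_
      rw [Set.uIcc_of_le hab] at hs
      have := hσ.integral_disjoint_done hμ hA hs.2 hb x
        fun S => f' s - μ * f s * ∑ c ∈ A, (if c ∈ S then 1 else 0)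
      simp only [hdrift]
      rw [← hθ x s (ha.trans hs.1)]
      exact this.symm
    · exact Finset.measurable_sum _ fun c _ => Measurable.ite
        (measurable_prodMk_left (hσ.measurable c)) measurable_const measurable_const
    · exact fun s => Finset.sum_nonneg fun c _ => by split_ifs <;> simp
    · intro s
      calc g x s ≤ ∑ c ∈ A, (1 : ℝ) := Finset.sum_le_sum fun c _ => by split_ifs <;> simp
        _ = A.card := by simp
  have hres : ∀ G : (Chunk → ℝ) → ℝ, Integrable G ν →
      ∫ x, G x ∂ν = ∫ x, ∫ y, G (z x y) ∂ν ∂ν ∧ Integrable (fun x => ∫ y, G (z x y) ∂ν) ν := by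
    intro G hG
    have hi : Integrable (fun p : (Chunk → ℝ) × (Chunk → ℝ) => G (z p.1 p.2)) (ν.prod ν) :=
      hmp.integrable_comp_of_integrable hG
    refine ⟨?_, hi.integral_prod_left⟩
    have h1 := integral_map (f := G) hmp.aemeasurable
      (by rw [hmp.map_eq]; exact hG.aestronglyMeasurable)
    rwa [hmp.map_eq, integral_prod _ hi] at h1
  have hE : ∀ s, Integrable (fun x => F s (R.done (σ x) x s)) ν := fun s =>
    hσ.integrable_state ν (fun B _ => F s B) s
  have hprod : Integrable (fun p : ℝ × ((Chunk → ℝ) × (Chunk → ℝ)) =>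
      drift μ F F' p.1 (R.done (σ (z p.2.1 p.2.2)) (z p.2.1 p.2.2) p.1) (σ (z p.2.1 p.2.2) p.1))
      ((volume.restrict (Set.uIoc a b)).prod (ν.prod ν)) :=
    ((MeasurePreserving.id _).prod hmp).integrable_comp_of_integrable
      (hσ.integrable_prod_state ν hH a b)
  have hassoc : Integrable (fun p : (ℝ × (Chunk → ℝ)) × (Chunk → ℝ) =>
      drift μ F F' p.1.1 (R.done (σ (z p.1.2 p.2)) (z p.1.2 p.2) p.1.1) (σ (z p.1.2 p.2) p.1.1))
      (((volume.restrict (Set.uIoc a b)).prod ν).prod ν) :=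
    (measurePreserving_prodAssoc _ _ _).integrable_comp_of_integrable hprod
  unfold Dynkin
  rw [(hres _ (hE b)).1, (hres _ (hE a)).1, ← integral_sub (hres _ (hE b)).2 (hres _ (hE a)).2]
  simp only [hpath]
  have hswap := intervalIntegral_integral_swap (μ := ν) (a := a) (b := b)
    (f := fun s x => ∫ y, drift μ F F' s (R.done (σ (z x y)) (z x y) s) (σ (z x y) s) ∂ν)
    hassoc.integral_prod_left
  rw [← hswap]
  refine intervalIntegral.integral_congr fun s _ => ?_
  exact ((hres _ (hσ.integrable_state ν (drift μ F F' s) s)).1).symm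

/-- Done sets and served chunks lie in `R.chunks`, so only the values on subsets of `R.chunks`
enter. -/
lemma dynkin_congr (hσ : IsControl R L σ) {μ a b : ℝ} {F F' G G' : ℝ → Finset Chunk → ℝ}
    (h : ∀ s, ∀ B ⊆ R.chunks, F s B = G s B) (h' : ∀ s, ∀ B ⊆ R.chunks, F' s B = G' s B)
    (hG : Dynkin R σ μ a b G G') : Dynkin R σ μ a b F F' := by
  have hdrift : ∀ s x, drift μ F F' s (R.done (σ x) x s) (σ x s) =
      drift μ G G' s (R.done (σ x) x s) (σ x s) := by
    intro s x
    have hD := R.done_subset (σ x) x s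
    unfold drift
    rw [h' s _ hD, Finset.sum_congr rfl fun c hc => by
      rw [h s _ hD, h s _ (Finset.insert_subset (hσ.subset_chunks x s hc) hD)]]
  unfold Dynkin at hG ⊢
  simp only [hdrift]
  rw [← hG]
  simp only [h _ _ (R.done_subset _ _ _)]

lemma dynkin_sub (hσ : IsControl R L σ) {μ : ℝ} (hμ : 0 < μ) {a b : ℝ}
    {F F' G G' : ℝ → Finset Chunk → ℝ}
    (hF : ∀ B s, HasDerivAt (fun s => F s B) (F' s B) s) (hF' : ∀ B, Continuous fun s => F' s B)
    (hG : ∀ B s, HasDerivAt (fun s => G s B) (G' s B) s) (hG' : ∀ B, Continuous fun s => G' s B)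
    (hdF : Dynkin R σ μ a b F F') (hdG : Dynkin R σ μ a b G G') :
    Dynkin R σ μ a b (fun s B => F s B - G s B) (fun s B => F' s B - G' s B) := by
  have hν := isProbabilityMeasure_downloadLaw hμ
  have hdrift : ∀ s B S, drift μ (fun s B => F s B - G s B) (fun s B => F' s B - G' s B) s B S =
      drift μ F F' s B S - drift μ G G' s B S := by
    intro s B S
    have : ∑ c ∈ S, (F s (insert c B) - G s (insert c B) - (F s B - G s B)) =
        ∑ c ∈ S, (F s (insert c B) - F s B) - ∑ c ∈ S, (G s (insert c B) - G s B) := by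
      rw [← Finset.sum_sub_distrib]
      exact Finset.sum_congr rfl fun _ _ => by ring
    simp only [drift, this]
    ring
  have hi := fun (H : ℝ → Finset Chunk → ℝ) s =>
    hσ.integrable_state (downloadLaw μ) (fun B _ => H s B) s
  unfold Dynkin at hdF hdG ⊢
  simp only [hdrift]
  rw [integral_sub (hi F b) (hi G b), integral_sub (hi F a) (hi G a)]
  have h1 : ∀ s, ∫ x, (drift μ F F' s (R.done (σ x) x s) (σ x s) -
      drift μ G G' s (R.done (σ x) x s) (σ x s)) ∂downloadLaw μ =
      ∫ x, drift μ F F' s (R.done (σ x) x s) (σ x s) ∂downloadLaw μ -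
        ∫ x, drift μ G G' s (R.done (σ x) x s) (σ x s) ∂downloadLaw μ := fun s =>
    integral_sub (hσ.integrable_state _ (drift μ F F' s) s)
      (hσ.integrable_state _ (drift μ G G' s) s)
  simp only [h1]
  rw [intervalIntegral.integral_sub
    (hσ.intervalIntegrable_state _ (continuous_drift hF hF') a b)
    (hσ.intervalIntegrable_state _ (continuous_drift hG hG') a b), ← hdF, ← hdG]
  ring

lemma dynkin_sum (hσ : IsControl R L σ) {μ : ℝ} (hμ : 0 < μ) {a b : ℝ} {ι : Type*} (I : Finset ι)
    {F F' : ι → ℝ → Finset Chunk → ℝ}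
    (hF : ∀ i B s, HasDerivAt (fun s => F i s B) (F' i s B) s)
    (hF' : ∀ i B, Continuous fun s => F' i s B) (hd : ∀ i ∈ I, Dynkin R σ μ a b (F i) (F' i)) :
    Dynkin R σ μ a b (fun s B => ∑ i ∈ I, F i s B) (fun s B => ∑ i ∈ I, F' i s B) := by
  have hν := isProbabilityMeasure_downloadLaw hμ
  have hdrift : ∀ s B S, drift μ (fun s B => ∑ i ∈ I, F i s B) (fun s B => ∑ i ∈ I, F' i s B) s B S
      = ∑ i ∈ I, drift μ (F i) (F' i) s B S := by
    intro s B S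
    simp only [drift, Finset.sum_add_distrib, ← Finset.mul_sum, ← Finset.sum_sub_distrib]
    rw [Finset.sum_comm]
  have hi := fun i s => hσ.integrable_state (downloadLaw μ) (fun B _ => F i s B) s
  unfold Dynkin at hd ⊢
  simp only [hdrift]
  rw [integral_finsetSum _ fun i _ => hi i b, integral_finsetSum _ fun i _ => hi i a,
    ← Finset.sum_sub_distrib, Finset.sum_congr rfl hd]
  have h1 : ∀ s, ∫ x, ∑ i ∈ I, drift μ (F i) (F' i) s (R.done (σ x) x s) (σ x s) ∂downloadLaw μ =
      ∑ i ∈ I, ∫ x, drift μ (F i) (F' i) s (R.done (σ x) x s) (σ x s) ∂downloadLaw μ := fun s =>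
    integral_finsetSum _ fun i _ => hσ.integrable_state _ (drift μ (F i) (F' i) s) s
  simp only [h1]
  rw [intervalIntegral.integral_finsetSum fun i _ =>
    hσ.intervalIntegrable_state _ (continuous_drift (hF i) (hF' i)) a b]

/-- Inclusion-exclusion, one chunk `c` at a time: the indicator of `c ∈ B` is one minus the
indicator that `c` is avoided, and avoided chunks join `A`. -/
lemma dynkin_subset_disjoint (hσ : IsControl R L σ) {μ : ℝ} (hμ : 0 < μ) {a b : ℝ} (ha : 0 ≤ a)
    (hab : a ≤ b) {f f' : ℝ → ℝ} (hf : ∀ s, HasDerivAt f (f' s) s) (hf' : Continuous f')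
    {B₀ : Finset Chunk} (hB : B₀ ⊆ R.chunks) :
    ∀ {A : Finset Chunk}, A ⊆ R.chunks →
    Dynkin R σ μ a b (fun s B => f s * if B₀ ⊆ B ∧ Disjoint B A then 1 else 0)
      (fun s B => f' s * if B₀ ⊆ B ∧ Disjoint B A then 1 else 0) := by
  induction B₀ using Finset.induction_on with
  | empty => intro A hA; simpa using hσ.dynkin_disjoint hμ hA ha hab hf hf'
  | insert c B₁ _ ih =>
    intro A hA
    rw [Finset.insert_subset_iff] at hB
    have h1 := hσ.dynkin_sub hμ
      (fun B s => (hf s).mul_const (if B₁ ⊆ B ∧ Disjoint B A then (1 : ℝ) else 0))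
      (fun B => hf'.mul continuous_const)
      (fun B s => (hf s).mul_const (if B₁ ⊆ B ∧ Disjoint B (insert c A) then (1 : ℝ) else 0))
      (fun B => hf'.mul continuous_const)
      (ih hB.2 hA) (ih hB.2 (Finset.insert_subset hB.1 hA))
    have h2 : ∀ B : Finset Chunk, (if insert c B₁ ⊆ B ∧ Disjoint B A then (1 : ℝ) else 0) =
        (if B₁ ⊆ B ∧ Disjoint B A then (1 : ℝ) else 0) -
          if B₁ ⊆ B ∧ Disjoint B (insert c A) then (1 : ℝ) else 0 := by
      intro B
      simp only [Finset.disjoint_insert_right, Finset.insert_subset_iff]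
      by_cases h3 : c ∈ B <;> by_cases h4 : B₁ ⊆ B <;> by_cases h5 : Disjoint B A <;>
        simp [h3, h4, h5]
    simpa only [h2, mul_sub] using h1

/-- Dynkin's formula for the set of downloaded chunks under an online policy. -/
theorem dynkin (hσ : IsControl R L σ) {μ : ℝ} (hμ : 0 < μ) {a b : ℝ} (ha : 0 ≤ a)
    (hab : a ≤ b) {F F' : ℝ → Finset Chunk → ℝ}
    (hF : ∀ B s, HasDerivAt (fun s => F s B) (F' s B) s) (hF' : ∀ B, Continuous fun s => F' s B) :
    Dynkin R σ μ a b F F' := by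
  -- Any functional is expanded over the atoms `B = B₀`, each written as "contains `B₀` and avoids
  -- its complement".
  have key : ∀ (H : ℝ → Finset Chunk → ℝ) (s : ℝ), ∀ B ⊆ R.chunks, H s B =
      ∑ B₀ ∈ R.chunks.powerset, H s B₀ *
        if B₀ ⊆ B ∧ Disjoint B (R.chunks \ B₀) then 1 else 0 := by
    intro H s B hB
    rw [Finset.sum_eq_single_of_mem B (Finset.mem_powerset.2 hB)]
    · simp [Finset.disjoint_sdiff]
    · intro B₀ _ hne
      rw [if_neg, mul_zero]
      rintro ⟨h1, h2⟩
      refine hne (h1.antisymm fun c hc => ?_)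
      by_contra hc'
      exact Finset.disjoint_left.1 h2 hc (Finset.mem_sdiff.2 ⟨hB hc, hc'⟩)
  refine hσ.dynkin_congr (key F) (key F') ?_
  refine hσ.dynkin_sum hμ _ (fun B₀ B s => (hF B₀ s).mul_const _)
    (fun B₀ B => (hF' B₀).mul continuous_const) fun B₀ hB₀ => ?_
  exact hσ.dynkin_subset_disjoint hμ ha hab (hF B₀) (hF' B₀) (Finset.mem_powerset.1 hB₀)
    Finset.sdiff_subset

end IsControl

end CloudStorage

end

/-! ### Combinatorics of backlogs and of the SERPT-R rule. -/

noncomputable section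

namespace CloudStorage

open Topology Requests
open scoped Classical

namespace Requests

variable {R : Requests} {𝒜 : Finset ℕ} {B : Finset Chunk} {c : Chunk} {m : ℕ}

/-- The least number of further chunks that have to be downloaded in order to complete `m` of the
requests in `𝒜`, when the chunks in `B` are downloaded (`∞` if `𝒜` has fewer than `m` members). -/
def backlog (R : Requests) (𝒜 : Finset ℕ) (B : Finset Chunk) (m : ℕ) : ℕ∞ :=
  (𝒜.powersetCard m).inf fun S => ((∑ i ∈ S, R.missing B i : ℕ) : ℕ∞)

lemma missing_insert (hc : c ∉ B) (i : ℕ) :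
    R.missing (insert c B) i = if c.1 = i then R.missing B i - 1 else R.missing B i := by
  unfold missing
  rw [Finset.filter_insert]
  split_ifs with h
  · rw [Finset.card_insert_of_notMem fun h' => hc (Finset.mem_filter.1 h').1]
    omega
  · rfl

lemma missing_anti {B' : Finset Chunk} (h : B ⊆ B') (i : ℕ) : R.missing B' i ≤ R.missing B i :=
  Nat.sub_le_sub_left (Finset.card_le_card (Finset.filter_subset_filter _ h)) _

lemma missing_le (i : ℕ) : R.missing B i ≤ R.k i := Nat.sub_le _ _

lemma sum_missing_le_insert (hc : c ∉ B) (S : Finset ℕ) :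
    ∑ i ∈ S, R.missing B i ≤ (∑ i ∈ S, R.missing (insert c B) i) + 1 := by
  have h1 : ∑ i ∈ S, R.missing B i ≤
      ∑ i ∈ S, (R.missing (insert c B) i + if c.1 = i then 1 else 0) := by
    refine Finset.sum_le_sum fun i _ => ?_
    rw [missing_insert hc]
    split_ifs <;> omega
  rw [Finset.sum_add_distrib, Finset.sum_ite_eq] at h1
  split_ifs at h1 <;> omega

lemma sum_missing_insert_lt (hc : c ∉ B) (hpos : 0 < R.missing B c.1) {S : Finset ℕ}
    (hS : c.1 ∈ S) : ∑ i ∈ S, R.missing (insert c B) i < ∑ i ∈ S, R.missing B i := by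
  refine Finset.sum_lt_sum (fun i _ => missing_anti (Finset.subset_insert _ _) i) ⟨c.1, hS, ?_⟩
  rw [missing_insert hc, if_pos rfl]
  omega

lemma backlog_le {S : Finset ℕ} (hS : S ⊆ 𝒜) (hm : S.card = m) :
    R.backlog 𝒜 B m ≤ ((∑ i ∈ S, R.missing B i : ℕ) : ℕ∞) :=
  Finset.inf_le (f := fun S => ((∑ i ∈ S, R.missing B i : ℕ) : ℕ∞))
    (Finset.mem_powersetCard.2 ⟨hS, hm⟩)

lemma le_backlog_iff {v : ℕ∞} : v ≤ R.backlog 𝒜 B m ↔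
    ∀ S ⊆ 𝒜, S.card = m → v ≤ ((∑ i ∈ S, R.missing B i : ℕ) : ℕ∞) := by
  simp only [backlog, Finset.le_inf_iff, Finset.mem_powersetCard, and_imp]

lemma exists_backlog_eq (hm : m ≤ 𝒜.card) : ∃ S ⊆ 𝒜, S.card = m ∧
    R.backlog 𝒜 B m = ((∑ i ∈ S, R.missing B i : ℕ) : ℕ∞) := by
  obtain ⟨S, hS, h⟩ := Finset.exists_mem_eq_inf (𝒜.powersetCard m)
    (Finset.powersetCard_nonempty.2 hm) fun S => ((∑ i ∈ S, R.missing B i : ℕ) : ℕ∞)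
  rw [Finset.mem_powersetCard] at hS
  exact ⟨S, hS.1, hS.2, h⟩

lemma backlog_eq_top (hm : 𝒜.card < m) : R.backlog 𝒜 B m = ⊤ := by
  rw [backlog, Finset.powersetCard_eq_empty.2 hm, Finset.inf_empty]

lemma backlog_zero : R.backlog 𝒜 B 0 = 0 := by simp [backlog]

lemma backlog_anti {B' : Finset Chunk} (h : B ⊆ B') : R.backlog 𝒜 B' m ≤ R.backlog 𝒜 B m := by
  rw [le_backlog_iff]
  intro S hS hm
  refine (backlog_le hS hm).trans ?_
  exact_mod_cast Finset.sum_le_sum fun i _ => missing_anti h i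

/-- A chunk belongs to one request, so it lowers the total over any fixed set of requests by at most
one; the minimum inherits this. -/
lemma backlog_sub_one_le (hc : c ∉ B) : R.backlog 𝒜 B m - 1 ≤ R.backlog 𝒜 (insert c B) m := by
  rw [le_backlog_iff]
  intro S hS hm
  rw [tsub_le_iff_right]
  refine (backlog_le hS hm).trans ?_
  exact_mod_cast sum_missing_le_insert hc S

/-- The optimal `m + 1` requests either omit `i` or consist of `i` and `m` others. The infinite
values of too large orders make the formula valid without side conditions. -/
lemma backlog_insert_request {i : ℕ} (hi : i ∉ 𝒜) : R.backlog (insert i 𝒜) B (m + 1) =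
    min (R.backlog 𝒜 B (m + 1)) (R.backlog 𝒜 B m + R.missing B i) := by
  apply le_antisymm
  · rw [le_min_iff]
    constructor
    · rw [le_backlog_iff]
      exact fun S hS hm => backlog_le (hS.trans (Finset.subset_insert _ _)) hm
    · rcases lt_or_ge 𝒜.card m with h | h
      · simp [backlog_eq_top h]
      · obtain ⟨S, hS, hm, heq⟩ := exists_backlog_eq (R := R) (B := B) h
        have hiS : i ∉ S := fun h => hi (hS h)
        have := backlog_le (R := R) (B := B) (Finset.insert_subset_insert i hS)
          (by rw [Finset.card_insert_of_notMem hiS, hm])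
        rw [Finset.sum_insert hiS] at this
        rw [heq]
        refine this.trans (le_of_eq ?_)
        push_cast
        rw [add_comm]
  · rw [le_backlog_iff]
    intro S hS hm
    by_cases hiS : i ∈ S
    · refine (min_le_right _ _).trans ?_
      have hsub : S.erase i ⊆ 𝒜 := by
        rw [← Finset.erase_insert hi]; exact Finset.erase_subset_erase _ hS
      have := backlog_le (R := R) (B := B) hsub
        (m := m) (by rw [Finset.card_erase_of_mem hiS, hm]; rfl)
      rw [← Finset.sum_erase_add _ _ hiS]
      push_cast at this ⊢
      gcongr
    · refine (min_le_left _ _).trans (backlog_le (fun j hj => ?_) hm)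
      rcases Finset.mem_insert.1 (hS hj) with h | h
      · exact absurd (h ▸ hj) hiS
      · exact h

/-- Zero further downloads suffice for `m` requests exactly when `m` of them are complete already.
-/
lemma backlog_pos_iff :
    0 < R.backlog 𝒜 B m ↔ (𝒜.filter fun i => R.missing B i = 0).card < m := by
  rw [← not_iff_not, not_lt, not_lt, nonpos_iff_eq_zero]
  constructor
  · intro h
    have hm : m ≤ 𝒜.card := by
      by_contra hlt
      rw [backlog_eq_top (not_le.1 hlt)] at h
      exact absurd h (by simp)
    obtain ⟨S, hS, hcard, heq⟩ := exists_backlog_eq (R := R) (B := B) hm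
    rw [h] at heq
    have h0 : ∑ i ∈ S, R.missing B i = 0 := by exact_mod_cast heq.symm
    rw [Finset.sum_eq_zero_iff] at h0
    rw [← hcard]
    exact Finset.card_le_card fun i hi => Finset.mem_filter.2 ⟨hS hi, h0 i hi⟩
  · intro h
    obtain ⟨S, hS, hcard⟩ := Finset.exists_subset_card_eq h
    have := backlog_le (R := R) (B := B) (hS.trans (Finset.filter_subset _ _)) hcard
    rw [Finset.sum_eq_zero fun i hi => (Finset.mem_filter.1 (hS hi)).2] at this
    simpa using this

/-- The total number of chunks required by all requests. -/
def total (R : Requests) : ℕ := ∑ i ∈ Finset.range R.N, R.k i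

/-- This uniform bound on the finite values allows the Poisson expectations below to be finite sums.
-/
lemma backlog_le_total_or_eq_top (h𝒜 : 𝒜 ⊆ Finset.range R.N) (B : Finset Chunk) (m : ℕ) :
    R.backlog 𝒜 B m ≤ R.total ∨ R.backlog 𝒜 B m = ⊤ := by
  rcases lt_or_ge 𝒜.card m with h | h
  · exact Or.inr (backlog_eq_top h)
  · obtain ⟨S, hS, -, heq⟩ := exists_backlog_eq (R := R) (B := B) h
    left
    rw [heq]
    have : ∑ i ∈ S, R.missing B i ≤ R.total :=
      (Finset.sum_le_sum fun i _ => missing_le i).trans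
        (Finset.sum_le_sum_of_subset (hS.trans h𝒜))
    exact_mod_cast this

lemma dmin_le {i : ℕ} (hi : i < R.N) : R.dmin ≤ R.n i - R.k i + 1 := Nat.sInf_le ⟨i, hi, rfl⟩

lemma exists_dmin_eq (R : Requests) : ∃ i < R.N, R.dmin = R.n i - R.k i + 1 :=
  Nat.sInf_mem (s := {d | ∃ i < R.N, d = R.n i - R.k i + 1}) ⟨_, 0, R.N_pos, rfl⟩

lemma dmin_pos (R : Requests) : 0 < R.dmin := by
  obtain ⟨i, -, h⟩ := R.exists_dmin_eq
  omega

lemma card_chunks_filter {i : ℕ} (hi : i < R.N) :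
    (R.chunks.filter fun c => c.1 = i).card = R.n i := by
  have : (R.chunks.filter fun c => c.1 = i) = (Finset.range (R.n i)).image (Prod.mk i) := by
    ext ⟨i', j⟩
    simp only [Finset.mem_filter, mem_chunks, Finset.mem_image, Finset.mem_range, Prod.mk.injEq]
    constructor
    · rintro ⟨⟨_, h⟩, rfl⟩
      exact ⟨j, h, rfl, rfl⟩
    · rintro ⟨j', h, rfl, rfl⟩
      exact ⟨⟨hi, h⟩, rfl⟩
  rw [this, Finset.card_image_of_injective _ (Prod.mk_right_injective i), Finset.card_range]

/-- An unfinished request with `r` remaining chunks has at least `r + dmin - 1` available chunks. -/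
lemma missing_add_dmin_le {i : ℕ} (hi : i < R.N) (hpos : 0 < R.missing B i) :
    R.missing B i + R.dmin ≤ (R.chunks.filter fun c => c.1 = i ∧ c ∉ B).card + 1 := by
  have h1 : R.n i ≤ (R.chunks.filter fun c => c.1 = i ∧ c ∉ B).card +
      (B.filter fun c => c.1 = i).card := by
    rw [← card_chunks_filter hi]
    refine (Finset.card_le_card fun c hc => ?_).trans (Finset.card_union_le _ _)
    rw [Finset.mem_filter] at hc
    by_cases hcB : c ∈ B
    · exact Finset.mem_union_right _ (Finset.mem_filter.2 ⟨hcB, hc.2⟩)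
    · exact Finset.mem_union_left _ (Finset.mem_filter.2 ⟨hc.1, hc.2, hcB⟩)
  have h2 := R.dmin_le hi
  have h3 := R.k_le_n i hi
  unfold missing at hpos ⊢
  omega

/-- The `dmin - 1` spare chunks are counted for one unfinished request `i₀` only; each of the others
offers at least as many chunks as it lacks. -/
lemma sum_missing_add_dmin_le {S : Finset ℕ} (hS : S ⊆ Finset.range R.N)
    (hpos : 0 < ∑ i ∈ S, R.missing B i) : ∑ i ∈ S, R.missing B i + R.dmin ≤
      (R.chunks.filter fun c => c.1 ∈ S ∧ 0 < R.missing B c.1 ∧ c ∉ B).card + 1 := by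
  set U := R.chunks.filter fun c => c.1 ∈ S ∧ 0 < R.missing B c.1 ∧ c ∉ B with hU
  have hfib : U.card = ∑ i ∈ S, (U.filter fun c => c.1 = i).card :=
    Finset.card_eq_sum_card_fiberwise fun c hc => (Finset.mem_filter.1 hc).2.1
  have hi : ∀ i ∈ S, 0 < R.missing B i →
      R.missing B i + R.dmin ≤ (U.filter fun c => c.1 = i).card + 1 := by
    intro i hiS hpi
    refine (missing_add_dmin_le (Finset.mem_range.1 (hS hiS)) hpi).trans ?_
    refine Nat.add_le_add_right (Finset.card_le_card fun c hc => ?_) 1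
    obtain ⟨h1, rfl, h3⟩ := Finset.mem_filter.1 hc
    exact Finset.mem_filter.2 ⟨Finset.mem_filter.2 ⟨h1, hiS, hpi, h3⟩, rfl⟩
  have hd := R.dmin_pos
  obtain ⟨i₀, hi₀, hne⟩ := Finset.exists_ne_zero_of_sum_ne_zero hpos.ne'
  have h0 := hi i₀ hi₀ (Nat.pos_of_ne_zero hne)
  have hrest : ∑ i ∈ S.erase i₀, R.missing B i ≤
      ∑ i ∈ S.erase i₀, (U.filter fun c => c.1 = i).card := by
    refine Finset.sum_le_sum fun i hiS => ?_
    rcases Nat.eq_zero_or_pos (R.missing B i) with h | h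
    · omega
    · have := hi i (Finset.mem_of_mem_erase hiS) h
      omega
  rw [hfib, ← Finset.add_sum_erase _ _ hi₀, ← Finset.add_sum_erase _ _ hi₀]
  omega

/-- The set `S` of chunks under service is a SERPT-R assignment for `L` threads, when the requests
in `𝒜` have arrived and the chunks in `B` are downloaded. -/
structure Greedy (R : Requests) (L : ℕ) (𝒜 : Finset ℕ) (B S : Finset Chunk) : Prop where
  card_le : S.card ≤ L
  mem : ∀ c ∈ S, c.1 ∈ 𝒜 ∧ 0 < R.missing B c.1 ∧ c ∉ B
  priority : ∀ c ∈ S, ∀ c' ∈ R.chunks, c'.1 ∈ 𝒜 → 0 < R.missing B c'.1 → c' ∉ B →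
    R.missing B c'.1 < R.missing B c.1 → c' ∈ S
  busy : S.card < L → ∀ c ∈ R.chunks, c.1 ∈ 𝒜 → 0 < R.missing B c.1 → c ∉ B → c ∈ S

/-- Under SERPT-R, either all threads, or at least `v + dmin - 1` of them, reduce a backlog `v`. -/
lemma Greedy.le_card_decreasing {L : ℕ} {S : Finset Chunk} (hS : R.Greedy L 𝒜 B S)
    (h𝒜 : 𝒜 ⊆ Finset.range R.N) {v : ℕ} (hv : R.backlog 𝒜 B m = v) (hpos : 0 < v) :
    (S.card = L ∧ ∀ c ∈ S, R.backlog 𝒜 (insert c B) m < v) ∨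
    v + R.dmin ≤ (S.filter fun c => R.backlog 𝒜 (insert c B) m < v).card + 1 := by
  have hm : m ≤ 𝒜.card := by
    by_contra hlt
    rw [backlog_eq_top (not_le.1 hlt)] at hv
    exact absurd hv (by simp)
  obtain ⟨T, hT, hcard, heq⟩ := exists_backlog_eq (R := R) (B := B) hm
  rw [hv] at heq
  have hsum : v = ∑ i ∈ T, R.missing B i := by exact_mod_cast heq
  have hdrop : ∀ c, c.1 ∈ T → 0 < R.missing B c.1 → c ∉ B →
      R.backlog 𝒜 (insert c B) m < v := by
    intro c hcT hc hcB
    refine (backlog_le hT hcard).trans_lt ?_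
    rw [hsum]
    exact_mod_cast sum_missing_insert_lt hcB hc hcT
  set U := R.chunks.filter fun c => c.1 ∈ T ∧ 0 < R.missing B c.1 ∧ c ∉ B with hU
  -- Either every available chunk of the cheapest set `T` is under service, or some `c'` among them
  -- is not. The latter means that all threads are busy, and with requests lacking no more chunks
  -- than that of `c'`.
  by_cases hUS : U ⊆ S
  · right
    have h1 := sum_missing_add_dmin_le (R := R) (B := B) (hT.trans h𝒜) (hsum ▸ hpos)
    rw [← hsum] at h1
    refine h1.trans (Nat.add_le_add_right (Finset.card_le_card fun c hc => ?_) 1)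
    have h2 := Finset.mem_filter.1 hc
    exact Finset.mem_filter.2 ⟨hUS hc, hdrop c h2.2.1 h2.2.2.1 h2.2.2.2⟩
  · left
    obtain ⟨c', hc'U, hc'S⟩ := Finset.not_subset.1 hUS
    obtain ⟨h1, h2, h3, h4⟩ := Finset.mem_filter.1 hc'U
    refine ⟨le_antisymm hS.card_le (not_lt.1 fun hlt => hc'S (hS.busy hlt c' h1 (hT h2) h3 h4)),
      fun c hc => ?_⟩
    obtain ⟨hcA, hcpos, hcB⟩ := hS.mem c hc
    by_cases hcT : c.1 ∈ T
    · exact hdrop c hcT hcpos hcB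
    -- Replacing the request of `c'` by that of `c` in `T` gives `m` requests of total at most `v`,
    -- and downloading `c` lowers this total strictly.
    · have hle : R.missing B c.1 ≤ R.missing B c'.1 :=
        not_lt.1 fun hlt => hc'S (hS.priority c hc c' h1 (hT h2) h3 h4 hlt)
      have hcT' : c.1 ∉ T.erase c'.1 := fun h => hcT (Finset.mem_of_mem_erase h)
      have hsub : insert c.1 (T.erase c'.1) ⊆ 𝒜 :=
        Finset.insert_subset hcA ((Finset.erase_subset _ _).trans hT)
      have hcard' : (insert c.1 (T.erase c'.1)).card = m := by
        rw [Finset.card_insert_of_notMem hcT', Finset.card_erase_of_mem h2, ← hcard]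
        exact Nat.sub_add_cancel (Finset.card_pos.2 ⟨_, h2⟩)
      refine (backlog_le hsub hcard').trans_lt ?_
      have h5 := sum_missing_insert_lt (R := R) hcB hcpos
        (Finset.mem_insert_self c.1 (T.erase c'.1))
      rw [Finset.sum_insert hcT' (f := fun i => R.missing B i)] at h5
      have h6 := Finset.add_sum_erase T (fun i => R.missing B i) h2
      rw [hsum]
      norm_cast
      omega

end Requests

end CloudStorage

end

/-! ### Comparison of backlogs with a Poisson removal of work at rate `L * μ`. -/

noncomputable section

namespace CloudStorage

open Topology Requests
open scoped Classical

section Poisson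

/-- The expectation of `f (min X K)` for a Poisson random variable `X` with mean `r * t`. -/
def poissonMean (K : ℕ) (r t : ℝ) (f : ℕ → ℝ) : ℝ :=
  f K + ∑ n ∈ Finset.range K, Real.exp (-(r * t)) * (r * t) ^ n / n.factorial * (f n - f K)

variable {K : ℕ} {r t : ℝ} {f g : ℕ → ℝ}

lemma poissonMean_zero (hf : f (K + 1) = f K) : poissonMean K r 0 f = f 0 := by
  unfold poissonMean
  rcases K with _ | K
  · simp
  · rw [Finset.sum_range_succ']
    simp

lemma poissonMean_mono (hr : 0 ≤ r) (ht : 0 ≤ t) (hfg : ∀ n, f n ≤ g n) :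
    poissonMean K r t f ≤ poissonMean K r t g := by
  have h0 : 0 ≤ r * t := mul_nonneg hr ht
  -- A convex combination of values of `f`: the coefficient of `f K` is the tail probability,
  -- nonnegative because partial exponential sums are at most the exponential.
  have key : ∀ f : ℕ → ℝ, poissonMean K r t f =
      (1 - Real.exp (-(r * t)) * ∑ n ∈ Finset.range K, (r * t) ^ n / n.factorial) * f K +
        ∑ n ∈ Finset.range K, Real.exp (-(r * t)) * (r * t) ^ n / n.factorial * f n := by
    intro f
    unfold poissonMean
    simp only [mul_sub, Finset.sum_sub_distrib, ← Finset.sum_mul]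
    rw [Finset.mul_sum]
    simp only [mul_div_assoc]
    ring
  rw [key, key]
  have h1 : Real.exp (-(r * t)) * ∑ n ∈ Finset.range K, (r * t) ^ n / n.factorial ≤ 1 := by
    calc _ ≤ Real.exp (-(r * t)) * Real.exp (r * t) :=
          mul_le_mul_of_nonneg_left (Real.sum_le_exp_of_nonneg h0 K) (Real.exp_pos _).le
      _ = 1 := by rw [← Real.exp_add]; simp
  refine add_le_add (mul_le_mul_of_nonneg_left (hfg K) (by linarith))
    (Finset.sum_le_sum fun n _ => mul_le_mul_of_nonneg_left (hfg n) (by positivity))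

/-- The Poisson weights satisfy `pₙ' = r * (pₙ₋₁ - pₙ)`, and an index shift moves the difference
onto `f`. The hypothesis makes the truncation at `K` compatible with the shift. -/
lemma hasDerivAt_poissonMean (hf : f (K + 1) = f K) (t : ℝ) :
    HasDerivAt (fun t => poissonMean K r t f)
      (r * (poissonMean K r t (fun n => f (n + 1)) - poissonMean K r t f)) t := by
  set p : ℕ → ℝ → ℝ := fun n t => Real.exp (-(r * t)) * (r * t) ^ n / n.factorial with hp
  set q : ℕ → ℝ → ℝ := fun n t => r * (match n with | 0 => 0 | n + 1 => p n t) - r * p n t with hq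
  have hpd : ∀ n, HasDerivAt (p n) (q n t) t := by
    intro n
    have h1 : HasDerivAt (fun t : ℝ => r * t) r t := by
      simpa using (hasDerivAt_id t).const_mul r
    have h2 := (h1.neg.exp.mul (h1.pow n)).div_const (n.factorial : ℝ)
    refine h2.congr_deriv ?_
    rcases n with _ | n
    · simp [hq, hp, mul_comm]
    · have h3 : ((n + 1 : ℕ) : ℝ) ≠ 0 := by positivity
      have h4 : ((n.factorial : ℕ) : ℝ) ≠ 0 := by positivity
      simp only [hq, hp, Nat.factorial_succ, Nat.add_sub_cancel]
      push_cast at h3 ⊢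
      simp only [Pi.neg_apply, Pi.pow_apply]
      field_simp
      ring
  have h1 : HasDerivAt (fun t => poissonMean K r t f)
      (∑ n ∈ Finset.range K, q n t * (f n - f K)) t := by
    have := (HasDerivAt.fun_sum fun n (_ : n ∈ Finset.range K) =>
      (hpd n).mul_const (f n - f K)).const_add (f K)
    exact this
  refine h1.congr_deriv ?_
  have h2 : ∑ n ∈ Finset.range K, (match n with | 0 => 0 | n + 1 => p n t) * (f n - f K) =
      ∑ n ∈ Finset.range K, p n t * (f (n + 1) - f K) := by
    rcases K with _ | K
    · simp
    · rw [Finset.sum_range_succ', Finset.sum_range_succ]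
      simp
  simp only [hq, sub_mul, mul_assoc, Finset.sum_sub_distrib, ← Finset.mul_sum, h2]
  simp only [poissonMean, hf]
  ring

end Poisson

/-- `n` units of work are removed from every coordinate of `w`. -/
def lower (w : ℕ → ℕ∞) (n : ℕ) : ℕ → ℕ∞ := fun m => w m - n

/-- Every coordinate of `w` is infinite or at most `K`. -/
def BoundedBy (K : ℕ) (w : ℕ → ℕ∞) : Prop := ∀ m, w m ≤ K ∨ w m = ⊤

/-- The expectation of `φ` after time `t`, when from every coordinate one unit of work is removed
at rate `r`, starting from the state `w`. -/
def evolve (K : ℕ) (r t : ℝ) (φ : (ℕ → ℕ∞) → ℝ) (w : ℕ → ℕ∞) : ℝ :=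
  poissonMean K r t fun n => φ (lower w n)

section Evolve

variable {K : ℕ} {r t : ℝ} {φ : (ℕ → ℕ∞) → ℝ} {w w' : ℕ → ℕ∞}

lemma lower_mono {n : ℕ} (h : w ≤ w') : lower w n ≤ lower w' n := fun m =>
  tsub_le_tsub_right (h m) _

lemma lower_lower (w : ℕ → ℕ∞) (n n' : ℕ) : lower (lower w n) n' = lower w (n + n') := by
  funext m
  simp only [lower, tsub_tsub, Nat.cast_add]

lemma lower_zero (w : ℕ → ℕ∞) : lower w 0 = w := by
  funext m
  simp [lower]

lemma lower_le (w : ℕ → ℕ∞) (n : ℕ) : lower w n ≤ w := fun _ => tsub_le_self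

lemma BoundedBy.lower_succ (hw : BoundedBy K w) : lower w (K + 1) = lower w K := by
  funext m
  unfold lower
  rcases hw m with h | h
  · rw [tsub_eq_zero_of_le h, tsub_eq_zero_of_le (h.trans (by exact_mod_cast Nat.le_succ K))]
  · rw [h, ENat.top_sub_natCast, ENat.top_sub_natCast]

lemma BoundedBy.lower (hw : BoundedBy K w) (n : ℕ) : BoundedBy K (lower w n) := fun m => by
  rcases hw m with h | h
  · exact Or.inl (tsub_le_self.trans h)
  · right
    show w m - n = ⊤
    rw [h, ENat.top_sub_natCast]

lemma evolve_zero (hw : BoundedBy K w) : evolve K r 0 φ w = φ w := by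
  rw [evolve, poissonMean_zero (by rw [hw.lower_succ]), lower_zero]

lemma evolve_mono (hr : 0 ≤ r) (ht : 0 ≤ t) (hφ : Monotone φ) : Monotone (evolve K r t φ) :=
  fun _ _ h => poissonMean_mono hr ht fun _ => hφ (lower_mono h)

lemma hasDerivAt_evolve (hw : BoundedBy K w) (t : ℝ) :
    HasDerivAt (fun t => evolve K r t φ w)
      (r * (evolve K r t φ (lower w 1) - evolve K r t φ w)) t := by
  have h := hasDerivAt_poissonMean (r := r) (f := fun n => φ (lower w n))
    (by rw [hw.lower_succ]) t
  unfold evolve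
  simp only [lower_lower]
  simpa only [add_comm 1] using h

end Evolve

namespace IsControl

variable {R : Requests} {L : ℕ} {σ : (Chunk → ℝ) → ℝ → Finset Chunk}

/-- Evolving for the time `b - s` still to come interpolates between `φ` of the state at `b` and the
Poisson prediction made at `a`. The sign of the drift then decides whether the policy is slower or
faster than the Poisson removal. -/
lemma dynkin_evolve (hσ : IsControl R L σ) {μ : ℝ} (hμ : 0 < μ) {a b : ℝ} (ha : 0 ≤ a)
    (hab : a ≤ b) {K : ℕ} (r : ℝ) {W : Finset Chunk → ℕ → ℕ∞} (hW : ∀ B, BoundedBy K (W B))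
    (φ : (ℕ → ℕ∞) → ℝ) :
    let F : ℝ → Finset Chunk → ℝ := fun s B => evolve K r (b - s) φ (W B)
    let F' : ℝ → Finset Chunk → ℝ := fun s B =>
      r * (evolve K r (b - s) φ (W B) - evolve K r (b - s) φ (lower (W B) 1))
    (∀ B S, Continuous fun s => drift μ F F' s B S) ∧
    ∫ x, φ (W (R.done (σ x) x b)) ∂downloadLaw μ -
      ∫ x, evolve K r (b - a) φ (W (R.done (σ x) x a)) ∂downloadLaw μ =
    ∫ s in a..b, ∫ x, drift μ F F' s (R.done (σ x) x s) (σ x s) ∂downloadLaw μ := by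
  intro F F'
  have hd : ∀ w, BoundedBy K w → ∀ s, HasDerivAt (fun s => evolve K r (b - s) φ w)
      (r * (evolve K r (b - s) φ w - evolve K r (b - s) φ (lower w 1))) s := by
    intro w hw s
    refine ((hasDerivAt_evolve hw (b - s)).comp_const_sub b s).congr_deriv ?_
    ring
  have hF : ∀ B s, HasDerivAt (fun s => F s B) (F' s B) s := fun B s => hd (W B) (hW B) s
  have hcont : ∀ w, BoundedBy K w → Continuous fun s => evolve K r (b - s) φ w := fun w hw =>
    continuous_iff_continuousAt.2 fun s => (hd w hw s).continuousAt
  have hF' : ∀ B, Continuous fun s => F' s B := fun B =>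
    continuous_const.mul ((hcont _ (hW B)).sub (hcont _ ((hW B).lower 1)))
  refine ⟨continuous_drift hF hF', ?_⟩
  rw [← hσ.dynkin hμ ha hab hF hF']
  congr 1
  refine integral_congr_ae (Eventually.of_forall fun x => ?_)
  simp only [F, sub_self]
  rw [evolve_zero (hW _)]

/-- Under any online policy, the backlogs decrease at most at the rate `L * μ`. -/
lemma evolve_le (hσ : IsControl R L σ) {μ : ℝ} (hμ : 0 < μ) {a b : ℝ} (ha : 0 ≤ a)
    (hab : a ≤ b) {𝒜 : Finset ℕ} (h𝒜 : 𝒜 ⊆ Finset.range R.N) {φ : (ℕ → ℕ∞) → ℝ}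
    (hφ : Monotone φ) :
    ∫ x, evolve R.total (L * μ) (b - a) φ (R.backlog 𝒜 (R.done (σ x) x a)) ∂downloadLaw μ ≤
      ∫ x, φ (R.backlog 𝒜 (R.done (σ x) x b)) ∂downloadLaw μ := by
  have hr : (0 : ℝ) ≤ L * μ := by positivity
  obtain ⟨-, h⟩ := hσ.dynkin_evolve hμ ha hab (L * μ) (W := R.backlog 𝒜)
    (fun B m => backlog_le_total_or_eq_top h𝒜 B m) φ
  rw [← sub_nonneg, h]
  refine intervalIntegral.integral_nonneg hab fun s hs => integral_nonneg fun x => ?_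
  set T := evolve R.total (L * μ) (b - s) φ with hT
  have hTm : Monotone T := evolve_mono hr (by linarith [hs.2]) hφ
  set B := R.done (σ x) x s with hB
  set w := R.backlog 𝒜 B with hw
  have hδ : T (lower w 1) ≤ T w := hTm (lower_le w 1)
  have h1 : ∀ c ∈ σ x s, T (lower w 1) - T w ≤ T (R.backlog 𝒜 (insert c B)) - T w := by
    intro c hc
    have hcB := (available_iff.1 (hσ.available x s c hc)).2.2.2
    have h2 : T (lower w 1) ≤ T (R.backlog 𝒜 (insert c B)) := hTm fun m => by
      simpa [lower] using backlog_sub_one_le (𝒜 := 𝒜) (m := m) hcB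
    linarith
  have h2 := Finset.sum_le_sum h1
  rw [Finset.sum_const, nsmul_eq_mul] at h2
  have h3 : ((σ x s).card : ℝ) ≤ L := by exact_mod_cast hσ.card_le x s
  -- The increment is nonpositive, so using fewer than `L` threads only slows the decrease.
  have h4 : (L : ℝ) * (T (lower w 1) - T w) ≤ ((σ x s).card : ℝ) * (T (lower w 1) - T w) :=
    mul_le_mul_of_nonpos_right h3 (by linarith)
  show 0 ≤ L * μ * (T w - T (lower w 1)) +
    μ * ∑ c ∈ σ x s, (T (R.backlog 𝒜 (insert c B)) - T w)
  have h5 := mul_le_mul_of_nonneg_left (h4.trans h2) hμ.le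
  nlinarith

/-- Under SERPT-R, the backlogs in excess of `L - dmin` decrease at the rate `L * μ`. -/
lemma le_evolve (hσ : IsControl R L σ) {μ : ℝ} (hμ : 0 < μ) {a b : ℝ} (ha : 0 ≤ a)
    (hab : a ≤ b) {𝒜 : Finset ℕ} (h𝒜 : 𝒜 ⊆ Finset.range R.N)
    (hg : ∀ s ∈ Set.Ioo a b, ∀ x, R.Greedy L 𝒜 (R.done (σ x) x s) (σ x s))
    {φ : (ℕ → ℕ∞) → ℝ} (hφ : Monotone φ) :
    ∫ x, φ (lower (R.backlog 𝒜 (R.done (σ x) x b)) (L - R.dmin)) ∂downloadLaw μ ≤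
    ∫ x, evolve R.total (L * μ) (b - a) φ
      (lower (R.backlog 𝒜 (R.done (σ x) x a)) (L - R.dmin)) ∂downloadLaw μ := by
  have hν := isProbabilityMeasure_downloadLaw hμ
  have hr : (0 : ℝ) ≤ L * μ := by positivity
  set D := L - R.dmin with hD
  set W : Finset Chunk → ℕ → ℕ∞ := fun B => lower (R.backlog 𝒜 B) D with hW
  have hWb : ∀ B, BoundedBy R.total (W B) := fun B =>
    BoundedBy.lower (fun m => backlog_le_total_or_eq_top h𝒜 B m) _
  obtain ⟨hc, h⟩ := hσ.dynkin_evolve hμ ha hab (L * μ) hWb φ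
  rw [← sub_nonpos, h]
  have hz : ∫ s in a..b, (0 : ℝ) = 0 := by simp
  rw [← hz]
  -- The rule is assumed only inside the interval: at the right end a new request may arrive.
  refine intervalIntegral.integral_mono_on_of_le_Ioo hab
    (hσ.intervalIntegrable_state _ hc a b) (by simp) fun s hs => integral_nonpos fun x => ?_
  set T := evolve R.total (L * μ) (b - s) φ with hT
  have hTm : Monotone T := evolve_mono hr (by linarith [hs.2]) hφ
  have hgr := hg s hs x
  set B := R.done (σ x) x s with hB
  show L * μ * (T (W B) - T (lower (W B) 1)) + μ * ∑ c ∈ σ x s, (T (W (insert c B)) - T (W B)) ≤ 0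
  have hanti : ∀ c, W (insert c B) ≤ W B := fun c =>
    lower_mono fun m => backlog_anti (Finset.subset_insert c B)
  -- The values `0` and `⊤` are fixed by `lower`; if there are no others, the comparison rate
  -- contributes nothing. One other coordinate already forces all `L` threads to be busy, and then
  -- each download lowers every such coordinate.
  by_cases hall : ∀ m, W B m = 0 ∨ W B m = ⊤
  · have h1 : lower (W B) 1 = W B := by
      funext m
      rcases hall m with h | h <;> simp [lower, h]
    have h2 : ∑ c ∈ σ x s, (T (W (insert c B)) - T (W B)) ≤ 0 :=
      Finset.sum_nonpos fun c _ => sub_nonpos.2 (hTm (hanti c))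
    rw [h1, sub_self, mul_zero, zero_add]
    exact mul_nonpos_of_nonneg_of_nonpos hμ.le h2
  · have hfull : ∀ m, W B m ≠ 0 → W B m ≠ ⊤ → (σ x s).card = L ∧
        ∀ c ∈ σ x s, W (insert c B) m ≤ W B m - 1 := by
      intro m h0 htop
      have hne : R.backlog 𝒜 B m ≠ ⊤ := by
        intro h
        exact htop (by simp [hW, lower, h])
      obtain ⟨v, hv⟩ := ENat.ne_top_iff_exists.1 hne
      have hDv : D < v := by
        by_contra hle
        refine h0 (tsub_eq_zero_of_le ?_)
        rw [← hv]
        exact_mod_cast not_lt.1 hle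
      -- As `v > L - dmin`, the bound `v + dmin - 1` is at least `L`, so the second alternative also
      -- means that all threads lower this backlog.
      rcases hgr.le_card_decreasing h𝒜 hv.symm (by omega) with ⟨h1, h2⟩ | h1
      · refine ⟨h1, fun c hcs => ?_⟩
        have h3 := h2 c hcs
        obtain ⟨v', hv'⟩ := ENat.ne_top_iff_exists.1 h3.ne_top
        simp only [hW, lower, ← hv, ← hv'] at h3 ⊢
        norm_cast at h3 ⊢
        omega
      · have h2 : ((σ x s).filter fun c => R.backlog 𝒜 (insert c B) m < v).card ≤ (σ x s).card :=
          Finset.card_filter_le _ _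
        have h3 := hgr.card_le
        have h4 : (σ x s).card = L := by omega
        refine ⟨h4, fun c hcs => ?_⟩
        have h5 : (σ x s).filter (fun c => R.backlog 𝒜 (insert c B) m < v) = σ x s :=
          Finset.eq_of_subset_of_card_le (Finset.filter_subset _ _) (by omega)
        rw [← h5] at hcs
        have h6 := (Finset.mem_filter.1 hcs).2
        obtain ⟨v', hv'⟩ := ENat.ne_top_iff_exists.1 h6.ne_top
        simp only [hW, lower, ← hv, ← hv'] at h6 ⊢
        norm_cast at h6 ⊢
        omega
    push Not at hall
    obtain ⟨m₀, h0, htop⟩ := hall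
    have hcard := (hfull m₀ h0 htop).1
    have hle : ∀ c ∈ σ x s, T (W (insert c B)) - T (W B) ≤ T (lower (W B) 1) - T (W B) := by
      intro c hcs
      have : W (insert c B) ≤ lower (W B) 1 := by
        intro m
        by_cases hm0 : W B m = 0
        · have := hanti c m
          rw [hm0, nonpos_iff_eq_zero] at this
          simp [this]
        · by_cases hmt : W B m = ⊤
          · simp [lower, hmt]
          · simpa [lower] using (hfull m hm0 hmt).2 c hcs
      linarith [hTm this]
    have hsum := Finset.sum_le_sum hle
    rw [Finset.sum_const, nsmul_eq_mul, hcard] at hsum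
    have := mul_le_mul_of_nonneg_left hsum hμ.le
    nlinarith

end IsControl

end CloudStorage

end

/-! ### Harmonic potential for small backlogs. -/

noncomputable section

namespace CloudStorage

open Topology Requests
open scoped Classical

/-- The sum of `1 / l` over `d ≤ l < min L (v + d)`. -/
def harmonicPotential (d L : ℕ) (v : ℕ∞) : ℝ :=
  ∑ l ∈ Finset.Ico d L, if (l : ℕ∞) < v + d then 1 / (l : ℝ) else 0

section Potential

variable {d L : ℕ} {v v' : ℕ∞}

lemma harmonicPotential_nonneg : 0 ≤ harmonicPotential d L v :=
  Finset.sum_nonneg fun l _ => by split_ifs <;> positivity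

lemma harmonicPotential_le : harmonicPotential d L v ≤ ∑ l ∈ Finset.Ico d L, 1 / (l : ℝ) :=
  Finset.sum_le_sum fun l _ => by
    split_ifs
    · exact le_rfl
    · positivity

lemma harmonicPotential_mono (h : v ≤ v') : harmonicPotential d L v ≤ harmonicPotential d L v' := by
  refine Finset.sum_le_sum fun l _ => ?_
  by_cases h1 : (l : ℕ∞) < v + d
  · rw [if_pos h1, if_pos (h1.trans_le (by gcongr))]
  · rw [if_neg h1]
    split_ifs <;> positivity

/-- The term lost is `l = n + d`, whose denominator is the number of threads guaranteed to lower a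
backlog `n + 1`. Decrease times rate is then at least `μ`, so the potential pays for elapsed time.
-/
lemma harmonicPotential_drop {n : ℕ} (hn : n + 1 + d ≤ L) (h : v < (n + 1 : ℕ)) :
    harmonicPotential d L v ≤ harmonicPotential d L (n + 1 : ℕ) - 1 / ((n + d : ℕ) : ℝ) := by
  have hle : v ≤ n := by
    obtain ⟨w, rfl⟩ := ENat.ne_top_iff_exists.1 h.ne_top
    norm_cast at h ⊢
    omega
  refine (harmonicPotential_mono hle).trans (le_of_eq ?_)
  unfold harmonicPotential
  have hmem : n + d ∈ Finset.Ico d L := Finset.mem_Ico.2 ⟨by omega, by omega⟩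
  rw [← Finset.add_sum_erase _ _ hmem, ← Finset.add_sum_erase (Finset.Ico d L) _ hmem]
  have h1 : ¬ ((n + d : ℕ) : ℕ∞) < (n : ℕ∞) + d := by norm_cast; omega
  have h2 : ((n + d : ℕ) : ℕ∞) < ((n + 1 : ℕ) : ℕ∞) + d := by norm_cast; omega
  rw [if_neg h1, if_pos h2]
  have h3 : ∀ l ∈ (Finset.Ico d L).erase (n + d),
      (if (l : ℕ∞) < (n : ℕ∞) + d then 1 / (l : ℝ) else 0) =
        if (l : ℕ∞) < ((n + 1 : ℕ) : ℕ∞) + d then 1 / (l : ℝ) else 0 := by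
    intro l hl
    have hne := Finset.ne_of_mem_erase hl
    have : ((l : ℕ∞) < (n : ℕ∞) + d) ↔ ((l : ℕ∞) < ((n + 1 : ℕ) : ℕ∞) + d) := by
      norm_cast
      omega
    simp only [this]
  rw [Finset.sum_congr rfl h3]
  ring

end Potential

namespace IsControl

variable {R : Requests} {L : ℕ} {σ : (Chunk → ℝ) → ℝ → Finset Chunk}

/-- Under SERPT-R, the expected time for which a backlog is positive but at most `L - dmin` is
controlled by the harmonic potential. -/
lemma integral_small_backlog_le (hσ : IsControl R L σ) {μ : ℝ} (hμ : 0 < μ) {a b : ℝ} (ha : 0 ≤ a)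
    (hab : a ≤ b) {𝒜 : Finset ℕ} (h𝒜 : 𝒜 ⊆ Finset.range R.N)
    (hg : ∀ s ∈ Set.Ioo a b, ∀ x, R.Greedy L 𝒜 (R.done (σ x) x s) (σ x s)) (m : ℕ) :
    ∫ x, harmonicPotential R.dmin L (R.backlog 𝒜 (R.done (σ x) x b) m) ∂downloadLaw μ +
      μ * ∫ s in a..b, ∫ x, (if 0 < R.backlog 𝒜 (R.done (σ x) x s) m ∧
        R.backlog 𝒜 (R.done (σ x) x s) m ≤ (L - R.dmin : ℕ) then 1 else 0) ∂downloadLaw μ ≤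
    ∫ x, harmonicPotential R.dmin L (R.backlog 𝒜 (R.done (σ x) x a) m) ∂downloadLaw μ := by
  have hν := isProbabilityMeasure_downloadLaw hμ
  set d := R.dmin with hd
  set F : ℝ → Finset Chunk → ℝ := fun _ B => harmonicPotential d L (R.backlog 𝒜 B m) with hF
  set F' : ℝ → Finset Chunk → ℝ := fun _ _ => 0 with hF'
  set I : Finset Chunk → Finset Chunk → ℝ := fun B _ => if 0 < R.backlog 𝒜 B m ∧
        R.backlog 𝒜 B m ≤ (L - d : ℕ) then 1 else 0 with hI
  have hFd : ∀ B s, HasDerivAt (fun s => F s B) (F' s B) s := fun B s => hasDerivAt_const _ _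
  have hF'c : ∀ B, Continuous fun s => F' s B := fun B => continuous_const
  have hdyn := hσ.dynkin hμ ha hab hFd hF'c
  unfold Dynkin at hdyn
  have hle : ∫ s in a..b, ∫ x, drift μ F F' s (R.done (σ x) x s) (σ x s) ∂downloadLaw μ ≤
      ∫ s in a..b, ∫ x, -(μ * I (R.done (σ x) x s) (σ x s)) ∂downloadLaw μ := by
    refine intervalIntegral.integral_mono_on_of_le_Ioo hab
      (hσ.intervalIntegrable_state _ (continuous_drift hFd hF'c) a b)
      (hσ.intervalIntegrable_state _ (H := fun _ B S => -(μ * I B S))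
        (fun _ _ => continuous_const) a b) fun s hs =>
      integral_mono (hσ.integrable_state _ (drift μ F F' s) s)
        (hσ.integrable_state _ (fun B S => -(μ * I B S)) s) fun x => ?_
    have hgr := hg s hs x
    simp only
    set B := R.done (σ x) x s with hB
    rw [drift, hF', zero_add, ← mul_neg]
    refine mul_le_mul_of_nonneg_left ?_ hμ.le
    have hnonpos : ∀ c ∈ σ x s, F s (insert c B) - F s B ≤ 0 := fun c _ =>
      sub_nonpos.2 (harmonicPotential_mono (backlog_anti (Finset.subset_insert c B)))
    by_cases hcase : 0 < R.backlog 𝒜 B m ∧ R.backlog 𝒜 B m ≤ (L - d : ℕ)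
    · have hI1 : I B (σ x s) = 1 := if_pos hcase
      rw [hI1]
      obtain ⟨v, hv⟩ := ENat.ne_top_iff_exists.1 (hcase.2.trans_lt (ENat.natCast_lt_top _)).ne
      rw [← hv] at hcase
      have hcase' : 0 < v ∧ v ≤ L - d := by exact_mod_cast hcase
      obtain ⟨n, rfl⟩ : ∃ n, v = n + 1 := ⟨v - 1, by omega⟩
      have hnd : n + 1 + d ≤ L := by omega
      have hdpos : 0 < d := R.dmin_pos
      set S' := (σ x s).filter fun c => R.backlog 𝒜 (insert c B) m < ((n + 1 : ℕ) : ℕ∞) with hS'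
      -- If all `L` threads lower the backlog, `n + 1 + d ≤ L` gives more than is needed.
      have hcardS' : n + d ≤ S'.card := by
        rcases hgr.le_card_decreasing h𝒜 hv.symm hcase'.1 with ⟨h1, h2⟩ | h1
        · have : S' = σ x s := Finset.filter_true_of_mem h2
          rw [this]
          omega
        · have h2 : n + 1 + d ≤ S'.card + 1 := by convert h1
          omega
      have hdrop : ∀ c ∈ S', F s (insert c B) - F s B ≤ -(1 / ((n + d : ℕ) : ℝ)) := by
        intro c hc
        have := harmonicPotential_drop hnd (Finset.mem_filter.1 hc).2
        simp only [hF, ← hv]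
        linarith
      have hpos : (0 : ℝ) < ((n + d : ℕ) : ℝ) := by
        have : 0 < n + d := by omega
        exact_mod_cast this
      have h1 : ∑ c ∈ σ x s, (F s (insert c B) - F s B) ≤
          ∑ c ∈ S', (F s (insert c B) - F s B) :=
        Finset.sum_le_sum_of_subset_of_nonpos' (Finset.filter_subset _ _) fun c hc _ => hnonpos c hc
      have h2 := Finset.sum_le_sum hdrop
      rw [Finset.sum_const, nsmul_eq_mul] at h2
      have h3 : (1 : ℝ) ≤ S'.card * (1 / ((n + d : ℕ) : ℝ)) := by
        rw [mul_one_div, one_le_div hpos]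
        exact_mod_cast hcardS'
      linarith
    · have hI0 : I B (σ x s) = 0 := if_neg hcase
      rw [hI0, neg_zero]
      exact Finset.sum_nonpos hnonpos
  rw [← hdyn] at hle
  have h2 : ∫ s in a..b, ∫ x, -(μ * I (R.done (σ x) x s) (σ x s)) ∂downloadLaw μ =
      -(μ * ∫ s in a..b, ∫ x, I (R.done (σ x) x s) (σ x s) ∂downloadLaw μ) := by
    simp only [integral_neg, intervalIntegral.integral_neg, integral_const_mul,
      intervalIntegral.integral_const_mul]
  rw [h2] at hle
  linarith

end IsControl

/-! ### Arrivals and stochastic domination of the excess backlog. -/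

namespace Requests

variable {R : Requests}

/-- The set of requests that have arrived by time `t`. -/
def arrivals (R : Requests) (t : ℝ) : Finset ℕ := (Finset.range R.N).filter fun i => R.a i ≤ t

lemma mem_arrivals {t : ℝ} {i : ℕ} : i ∈ R.arrivals t ↔ R.Arrived t i := by
  simp [arrivals, Arrived]

lemma arrivals_eq_range {n : ℕ} (hn : n < R.N) {t : ℝ} (h1 : R.a n ≤ t)
    (h2 : n + 1 < R.N → t < R.a (n + 1)) : R.arrivals t = Finset.range (n + 1) := by
  ext i
  rw [mem_arrivals, Finset.mem_range]
  constructor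
  · rintro ⟨hi, hit⟩
    by_contra hlt
    have h3 : n + 1 < R.N := by omega
    have := R.a_mono (n + 1) i (by omega) hi
    linarith [h2 h3]
  · intro hi
    exact ⟨by omega, (R.a_mono i n (by omega) hn).trans h1⟩

lemma a_nonneg {n : ℕ} (hn : n < R.N) : 0 ≤ R.a n := by
  have := R.a_mono 0 n (Nat.zero_le n) hn
  rwa [R.a_zero] at this

lemma exists_last_arrival {t : ℝ} (ht : 0 ≤ t) :
    ∃ n < R.N, R.a n ≤ t ∧ (n + 1 < R.N → t < R.a (n + 1)) := by
  have h0 : R.a 0 ≤ t := by rw [R.a_zero]; exact ht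
  set P : ℕ → Prop := fun n => n < R.N ∧ R.a n ≤ t with hP
  have hP0 : P 0 := ⟨R.N_pos, h0⟩
  have hspec : P (Nat.findGreatest P R.N) := Nat.findGreatest_spec (Nat.zero_le _) hP0
  refine ⟨_, hspec.1, hspec.2, fun h => ?_⟩
  by_contra hle
  exact Nat.findGreatest_is_greatest (P := P) (Nat.lt_succ_self _) h.le ⟨h, not_lt.1 hle⟩

end Requests

/-- The control `σ` follows the SERPT-R rule at all times. -/
def GreedyControl (R : Requests) (L : ℕ) (σ : (Chunk → ℝ) → ℝ → Finset Chunk) : Prop :=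
  ∀ x t, R.Greedy L (R.arrivals t) (R.done (σ x) x t) (σ x t)

lemma OnlinePolicy.IsSERPTR.greedyControl {L : ℕ} {π : OnlinePolicy L} (hπ : π.IsSERPTR)
    (R : Requests) (u : π.Seed) : GreedyControl R L (π.assign R u) := by
  intro x t
  have hav : ∀ c : Chunk, c ∈ R.chunks → c.1 ∈ R.arrivals t →
      0 < R.missing (R.done (π.assign R u x) x t) c.1 → c ∉ R.done (π.assign R u x) x t →
      R.Available (π.assign R u x) x t c := fun c h1 h2 h3 h4 =>
    available_iff.2 ⟨h1, (mem_arrivals.1 h2).2, h3, h4⟩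
  have hmem : ∀ c ∈ π.assign R u x t, c.1 < R.N ∧ c.1 ∈ R.arrivals t ∧
      0 < R.missing (R.done (π.assign R u x) x t) c.1 ∧ c ∉ R.done (π.assign R u x) x t := by
    intro c hc
    obtain ⟨h1, h2, h3, h4⟩ := available_iff.1 (π.available R u x t c hc)
    rw [mem_chunks] at h1
    exact ⟨h1.1, mem_arrivals.2 ⟨h1.1, h2⟩, h3, h4⟩
  refine ⟨π.card_le R u x t, fun c hc => (hmem c hc).2, fun c hc c' h1 h2 h3 h4 hlt => ?_,
    fun hlt c h1 h2 h3 h4 => (hπ R u x t).2 hlt c (hav c h1 h2 h3 h4)⟩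
  refine (hπ R u x t).1 c hc c' (hav c' h1 h2 h3 h4) ?_
  rwa [remaining_eq (mem_chunks.1 h1).1, remaining_eq (hmem c hc).1]

namespace IsControl

variable {R : Requests} {L : ℕ} {σ τ : (Chunk → ℝ) → ℝ → Finset Chunk}

/-- Only chunks of arrived requests are served, so service up to the arrival is null, while positive
downloading times demand more. -/
lemma notMem_done_of_le_arrival (hσ : IsControl R L σ) {x : Chunk → ℝ} (hx : ∀ c, 0 < x c)
    {c : Chunk} {t : ℝ} (ht : t ≤ R.a c.1) : c ∉ R.done (σ x) x t := by
  intro hc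
  have hz : service (σ x) c t = 0 := by
    have hsub : {s : ℝ | 0 ≤ s ∧ s ≤ t ∧ c ∈ σ x s} ⊆ {t} := fun s hs =>
      le_antisymm hs.2.1 (ht.trans (available_iff.1 (hσ.available x s c hs.2.2)).2.1)
    exact measure_mono_null hsub (by simp)
  have := (mem_done.1 hc).2
  rw [hz, nonpos_iff_eq_zero, ENNReal.ofReal_eq_zero] at this
  exact absurd (hx c) (not_lt.2 this)

lemma missing_eq_of_le_arrival (hσ : IsControl R L σ) {x : Chunk → ℝ} (hx : ∀ c, 0 < x c)
    {i : ℕ} {t : ℝ} (ht : t ≤ R.a i) : R.missing (R.done (σ x) x t) i = R.k i := by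
  have : (R.done (σ x) x t).filter (fun c => c.1 = i) = ∅ := by
    rw [Finset.filter_eq_empty_iff]
    rintro c hc rfl
    exact hσ.notMem_done_of_le_arrival hx ht hc
  rw [missing, this, Finset.card_empty, Nat.sub_zero]

/-- The effect on the backlogs of the arrival of a request that needs `k` chunks. -/
def arrive (k : ℕ) (w : ℕ → ℕ∞) : ℕ → ℕ∞
  | 0 => w 0
  | m + 1 => min (w (m + 1)) (w m + k)

lemma arrive_mono (k : ℕ) : Monotone (arrive k) := fun w w' h m => by
  cases m with
  | zero => exact h 0
  | succ m => exact min_le_min (h _) (add_le_add_left (h m) _)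

lemma backlog_range_succ (B : Finset Chunk) (n : ℕ) :
    R.backlog (Finset.range (n + 1)) B =
      arrive (R.missing B n) (R.backlog (Finset.range n) B) := by
  funext m
  rw [Finset.range_add_one]
  cases m with
  | zero => simp [arrive, backlog_zero]
  | succ m => exact backlog_insert_request (by simp)

/-- Truncated subtraction after adding `k` removes at least as much as before adding it. So the
excess after an arrival is at most the arrival map applied to the excess. -/
lemma lower_arrive_le (k n : ℕ) (w : ℕ → ℕ∞) : lower (arrive k w) n ≤ arrive k (lower w n) := by
  intro m
  cases m with
  | zero => exact le_rfl
  | succ m =>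
    refine le_min (tsub_le_tsub_right (min_le_left _ _) _) ?_
    refine (tsub_le_tsub_right (min_le_right _ _) _).trans ?_
    simp only [lower, tsub_le_iff_right]
    calc w m + k ≤ (w m - n + n) + k := by gcongr; exact le_tsub_add
      _ = w m - n + k + n := by rw [add_right_comm]

/-- A SERPT-R policy has stochastically smaller backlogs in excess of `L - dmin` than any other
online policy. -/
lemma excess_backlog_le (hσ : IsControl R L σ) (hgr : GreedyControl R L σ) (hτ : IsControl R L τ)
    {μ : ℝ} (hμ : 0 < μ) {n : ℕ} (hn : n < R.N) {t : ℝ} (ht : R.a n ≤ t)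
    (ht' : n + 1 < R.N → t ≤ R.a (n + 1)) {φ : (ℕ → ℕ∞) → ℝ} (hφ : Monotone φ) :
    ∫ x, φ (lower (R.backlog (Finset.range (n + 1)) (R.done (σ x) x t)) (L - R.dmin))
      ∂downloadLaw μ ≤
    ∫ x, φ (R.backlog (Finset.range (n + 1)) (R.done (τ x) x t)) ∂downloadLaw μ := by
  have hν := isProbabilityMeasure_downloadLaw hμ
  -- The order is carried for all monotone `φ` at once: the induction hypothesis is needed for the
  -- composite of the arrival map and the evolution up to `t`. All orders `m` must be kept jointly
  -- because arrivals mix them.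
  have step : ∀ n, n < R.N → (∀ φ : (ℕ → ℕ∞) → ℝ, Monotone φ →
      ∫ x, φ (lower (R.backlog (Finset.range n) (R.done (σ x) x (R.a n))) (L - R.dmin))
        ∂downloadLaw μ ≤
      ∫ x, φ (R.backlog (Finset.range n) (R.done (τ x) x (R.a n))) ∂downloadLaw μ) →
      ∀ t, R.a n ≤ t → (n + 1 < R.N → t ≤ R.a (n + 1)) → ∀ φ : (ℕ → ℕ∞) → ℝ, Monotone φ →
      ∫ x, φ (lower (R.backlog (Finset.range (n + 1)) (R.done (σ x) x t)) (L - R.dmin))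
        ∂downloadLaw μ ≤
      ∫ x, φ (R.backlog (Finset.range (n + 1)) (R.done (τ x) x t)) ∂downloadLaw μ := by
    intro n hn ih t ht ht' φ hφ
    have hsub : Finset.range (n + 1) ⊆ Finset.range R.N := Finset.range_mono hn
    have hE : Monotone (evolve R.total (L * μ) (t - R.a n) φ) :=
      evolve_mono (by positivity) (by linarith) hφ
    refine (hσ.le_evolve hμ (a_nonneg hn) ht hsub (fun s hs x => ?_) hφ).trans
      (le_trans ?_ (hτ.evolve_le hμ (a_nonneg hn) ht hsub hφ))
    · have := hgr x s
      rwa [arrivals_eq_range hn hs.1.le fun h => hs.2.trans_le (ht' h)] at this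
    -- For SERPT-R the bound `k n` on the missing chunks of the new request suffices. For `τ`
    -- equality is needed; it holds almost surely, since nothing is downloaded by the arrival.
    · set E := evolve R.total (L * μ) (t - R.a n) φ with hEdef
      refine le_trans (b := ∫ x, (E ∘ arrive (R.k n)) (lower (R.backlog (Finset.range n)
        (R.done (σ x) x (R.a n))) (L - R.dmin)) ∂downloadLaw μ) (integral_mono
          (hσ.integrable_state _ (fun B _ => E (lower (R.backlog (Finset.range (n + 1)) B)
            (L - R.dmin))) _)
          (hσ.integrable_state _ (fun B _ => (E ∘ arrive (R.k n))
            (lower (R.backlog (Finset.range n) B) (L - R.dmin))) _) fun x => ?_)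
        ((ih _ (hE.comp (arrive_mono (R.k n)))).trans (le_of_eq (integral_congr_ae ?_)))
      · refine hE ?_
        rw [backlog_range_succ]
        refine (lower_arrive_le _ _ _).trans ?_
        intro m
        cases m with
        | zero => exact le_rfl
        | succ m =>
          refine min_le_min le_rfl (add_le_add_right ?_ _)
          exact Nat.cast_le.2 (missing_le n)
      · filter_upwards [ae_pos hμ] with x hx
        rw [backlog_range_succ, hτ.missing_eq_of_le_arrival hx le_rfl]
        rfl
  have pre : ∀ n, n < R.N → ∀ φ : (ℕ → ℕ∞) → ℝ, Monotone φ →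
      ∫ x, φ (lower (R.backlog (Finset.range n) (R.done (σ x) x (R.a n))) (L - R.dmin))
        ∂downloadLaw μ ≤
      ∫ x, φ (R.backlog (Finset.range n) (R.done (τ x) x (R.a n))) ∂downloadLaw μ := by
    intro n
    induction n with
    | zero =>
      intro _ φ _
      -- With no requests the state is deterministic and fixed by `lower`, so both sides coincide.
      have h1 : ∀ B, R.backlog (Finset.range 0) B = fun m => if m = 0 then 0 else ⊤ := by
        intro B
        funext m
        split_ifs with h
        · rw [h, backlog_zero]
        · exact backlog_eq_top (by simpa using Nat.pos_of_ne_zero h)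
      have h2 : ∀ B, lower (R.backlog (Finset.range 0) B) (L - R.dmin) =
          R.backlog (Finset.range 0) B := by
        intro B
        funext m
        simp only [lower, h1]
        split_ifs
        · simp
        · exact ENat.top_sub_natCast _
      simp only [h2]
      simp only [h1]
      exact le_rfl
    | succ n ih =>
      intro hn φ hφ
      exact step n (by omega) (ih (by omega)) _ (R.a_mono _ _ (Nat.le_succ n) hn)
        (fun _ => le_rfl) φ hφ
  exact step n hn (pre n hn) t ht ht' φ hφ

end IsControl

end CloudStorage

end

/-! ### Completion times as time spent with positive backlogs. -/

noncomputable section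

namespace CloudStorage

open Topology Requests
open scoped Classical

namespace Requests

variable {R : Requests}

lemma backlog_mono_requests {𝒜 𝒜' : Finset ℕ} (h : 𝒜 ⊆ 𝒜') (B : Finset Chunk) (m : ℕ) :
    R.backlog 𝒜' B m ≤ R.backlog 𝒜 B m :=
  le_backlog_iff.2 fun _ hS hm => backlog_le (hS.trans h) hm

lemma measurableSet_arrivals_eq (𝒜 : Finset ℕ) : MeasurableSet {t : ℝ | R.arrivals t = 𝒜} := by
  have : {t : ℝ | R.arrivals t = 𝒜} = ⋂ i : ℕ, {t | i ∈ R.arrivals t ↔ i ∈ 𝒜} := by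
    ext t
    simp [Finset.ext_iff]
  rw [this]
  refine MeasurableSet.iInter fun i => ?_
  have hm : MeasurableSet {t : ℝ | i ∈ R.arrivals t} := by
    simp only [mem_arrivals, Arrived]
    by_cases hi : i < R.N
    · simp only [hi, true_and]
      exact measurableSet_Ici
    · simp [hi]
  by_cases hi : i ∈ 𝒜
  · simpa only [hi, iff_true] using hm
  · simp only [hi, iff_false]
    exact hm.compl

end Requests

/-- The measure of the times before a persistent property first holds is that first time. -/
lemma volume_setOf_not_eq_iInf {P : ℝ → Prop} (hP : ∀ s t, s ≤ t → P s → P t) :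
    volume {t : ℝ | 0 ≤ t ∧ ¬ P t} = ⨅ (t : ℝ) (_ : 0 ≤ t ∧ P t), ENNReal.ofReal t := by
  apply le_antisymm
  · refine le_iInf₂ fun t ht => ?_
    have hsub : {s : ℝ | 0 ≤ s ∧ ¬ P s} ⊆ Set.Ico 0 t := fun s hs =>
      ⟨hs.1, not_le.1 fun h => hs.2 (hP t s h ht.2)⟩
    refine (measure_mono hsub).trans ?_
    rw [Real.volume_Ico, sub_zero]
  · set c := ⨅ (t : ℝ) (_ : 0 ≤ t ∧ P t), ENNReal.ofReal t with hc
    have hmem : ∀ s : ℝ, 0 ≤ s → ENNReal.ofReal s < c → ¬ P s := fun s hs hlt hPs =>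
      absurd (iInf₂_le (f := fun (t : ℝ) (_ : 0 ≤ t ∧ P t) => ENNReal.ofReal t) s ⟨hs, hPs⟩)
        (not_le.2 hlt)
    by_cases htop : c = ⊤
    · have hsub : Set.Ici (0 : ℝ) ⊆ {s : ℝ | 0 ≤ s ∧ ¬ P s} := fun s hs =>
        ⟨hs, hmem s hs (by rw [htop]; exact ENNReal.ofReal_lt_top)⟩
      refine le_trans ?_ (measure_mono hsub)
      rw [Real.volume_Ici]
      exact le_top
    · have hsub : Set.Ico (0 : ℝ) c.toReal ⊆ {s : ℝ | 0 ≤ s ∧ ¬ P s} := fun s hs =>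
        ⟨hs.1, hmem s hs.1 ((ENNReal.ofReal_lt_iff_lt_toReal hs.1 htop).2 hs.2)⟩
      refine le_trans ?_ (measure_mono hsub)
      rw [Real.volume_Ico, sub_zero, ENNReal.ofReal_toReal htop]

lemma completionTime_eq_volume (R : Requests) (σ : ℝ → Finset Chunk) (x : Chunk → ℝ) {i : ℕ}
    (hi : i < R.N) :
    R.completionTime σ x i = volume {t : ℝ | 0 ≤ t ∧ 0 < R.missing (R.done σ x t) i} := by
  have h := volume_setOf_not_eq_iInf (P := fun t => R.k i ≤ (R.downloaded σ x t i).card)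
    fun s t hst hs => hs.trans (Finset.card_le_card fun j hj =>
      mem_downloaded.2 ⟨(mem_downloaded.1 hj).1, (mem_downloaded.1 hj).2.trans (service_mono hst)⟩)
  rw [completionTime, ← h]
  congr 1
  ext t
  simp only [Set.mem_ofPred_eq, ← remaining_eq hi, remaining]
  refine and_congr_right fun _ => ?_
  omega

namespace IsControl

variable {R : Requests} {L : ℕ} {σ τ : (Chunk → ℝ) → ℝ → Finset Chunk}

lemma measurableSet_history (hσ : IsControl R L σ) (P : Finset ℕ → Finset Chunk → Prop) :
    MeasurableSet {p : ℝ × (Chunk → ℝ) | P (R.arrivals p.1) (R.done (σ p.2) p.2 p.1)} := by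
  have : {p : ℝ × (Chunk → ℝ) | P (R.arrivals p.1) (R.done (σ p.2) p.2 p.1)} =
      ⋃ q : Finset ℕ × Finset Chunk, {p : ℝ × (Chunk → ℝ) | P q.1 q.2 ∧ R.arrivals p.1 = q.1 ∧
        R.done (σ p.2) p.2 p.1 = q.2} := by
    ext p
    simp only [Set.mem_ofPred_eq, Set.mem_iUnion]
    constructor
    · exact fun h => ⟨(_, _), h, rfl, rfl⟩
    · rintro ⟨q, h, h1, h2⟩
      rwa [h1, h2]
  rw [this]
  refine MeasurableSet.iUnion fun q => ?_
  by_cases hq : P q.1 q.2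
  · simp only [hq, true_and]
    exact (measurable_fst (measurableSet_arrivals_eq q.1)).inter
      (measurable_swap (measurableSet_done_eq hσ.measurable measurable_id R q.2))
  · simp [hq]

lemma measurable_prob_history (hσ : IsControl R L σ) {μ : ℝ} (hμ : 0 < μ)
    (P : Finset ℕ → Finset Chunk → Prop) :
    Measurable fun t => downloadLaw μ {x | P (R.arrivals t) (R.done (σ x) x t)} := by
  have := isProbabilityMeasure_downloadLaw hμ
  exact measurable_measure_prodMk_left (hσ.measurableSet_history P)

lemma measurableSet_history_section (hσ : IsControl R L σ) (P : Finset ℕ → Finset Chunk → Prop)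
    (t : ℝ) : MeasurableSet {x | P (R.arrivals t) (R.done (σ x) x t)} :=
  measurable_prodMk_left (hσ.measurableSet_history P)

/-- The expected time for which a backlog is positive but at most `L - dmin` under SERPT-R. -/
lemma lintegral_small_backlog_le (hσ : IsControl R L σ) (hgr : GreedyControl R L σ) {μ : ℝ}
    (hμ : 0 < μ) (m : ℕ) :
    ∫⁻ t in Set.Ioi 0, downloadLaw μ {x | 0 < R.backlog (R.arrivals t) (R.done (σ x) x t) m ∧
      R.backlog (R.arrivals t) (R.done (σ x) x t) m ≤ (L - R.dmin : ℕ)} ≤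
    ENNReal.ofReal (delayGap L μ R.dmin) := by
  have hν := isProbabilityMeasure_downloadLaw hμ
  set P : Finset ℕ → Finset Chunk → Prop := fun 𝒜 B => 0 < R.backlog 𝒜 B m ∧
    R.backlog 𝒜 B m ≤ (L - R.dmin : ℕ) with hP
  set p : ℝ → ENNReal := fun t => downloadLaw μ {x | P (R.arrivals t) (R.done (σ x) x t)} with hp
  have hpm : Measurable p := hσ.measurable_prob_history hμ P
  have hp1 : ∀ t, p t ≤ 1 := fun t => prob_le_one
  have hpi : ∀ a b, IntervalIntegrable (fun t => (p t).toReal) volume a b := fun a b => by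
    rw [intervalIntegrable_iff]
    refine Measure.integrableOn_of_bounded (M := 1) (by simp)
      hpm.ennreal_toReal.aestronglyMeasurable (Eventually.of_forall fun t => ?_)
    rw [Real.norm_eq_abs, abs_of_nonneg ENNReal.toReal_nonneg]
    exact ENNReal.toReal_le_of_le_ofReal zero_le_one (by simpa using hp1 t)
  set H := ∑ l ∈ Finset.Ico R.dmin L, 1 / (l : ℝ) with hH
  set E : ℕ → ℝ → ℝ := fun n t => ∫ x, harmonicPotential R.dmin L
    (R.backlog (Finset.range n) (R.done (σ x) x t) m) ∂downloadLaw μ with hE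
  have hEi : ∀ n t, Integrable (fun x => harmonicPotential R.dmin L
      (R.backlog (Finset.range n) (R.done (σ x) x t) m)) (downloadLaw μ) := fun n t =>
    hσ.integrable_state _ (fun B _ => harmonicPotential R.dmin L
      (R.backlog (Finset.range n) B m)) t
  have step : ∀ n, n < R.N → E n (R.a n) + μ * ∫ s in (0 : ℝ)..R.a n, (p s).toReal ≤ H →
      ∀ t, R.a n ≤ t → (n + 1 < R.N → t ≤ R.a (n + 1)) →
      E (n + 1) t + μ * ∫ s in (0 : ℝ)..t, (p s).toReal ≤ H := by
    intro n hn ih t ht ht'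
    have hsub : Finset.range (n + 1) ⊆ Finset.range R.N := Finset.range_mono hn
    have harr : ∀ s ∈ Set.Ioo (R.a n) t, R.arrivals s = Finset.range (n + 1) := fun s hs =>
      arrivals_eq_range hn hs.1.le fun h => hs.2.trans_le (ht' h)
    have h1 := hσ.integral_small_backlog_le hμ (a_nonneg hn) ht hsub (fun s hs x => by
      have := hgr x s
      rwa [harr s hs] at this) m
    have h2 : ∫ s in R.a n..t, (p s).toReal = ∫ s in R.a n..t, ∫ x,
        (if 0 < R.backlog (Finset.range (n + 1)) (R.done (σ x) x s) m ∧
        R.backlog (Finset.range (n + 1)) (R.done (σ x) x s) m ≤ (L - R.dmin : ℕ) then 1 else 0)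
          ∂downloadLaw μ := by
      rw [intervalIntegral.integral_of_le ht, intervalIntegral.integral_of_le ht,
        integral_Ioc_eq_integral_Ioo, integral_Ioc_eq_integral_Ioo]
      refine setIntegral_congr_fun measurableSet_Ioo fun s hs => ?_
      have h3 := integral_indicator_one (μ := downloadLaw μ)
        (hσ.measurableSet_history_section P s)
      simp only [hp]
      refine Eq.trans h3.symm (integral_congr_ae (Eventually.of_forall fun x => ?_))
      simp only [Set.indicator_apply, Set.mem_ofPred_eq, harr s hs, hP, Pi.one_apply]
    -- An arrival enlarges the family over which the backlog is minimized, hence cannot raise the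
    -- potential.
    have h3 : E (n + 1) (R.a n) ≤ E n (R.a n) := integral_mono (hEi _ _) (hEi _ _) fun x =>
      harmonicPotential_mono (backlog_mono_requests (Finset.range_mono (Nat.le_succ n)) _ _)
    rw [← h2] at h1
    rw [← intervalIntegral.integral_add_adjacent_intervals (hpi 0 (R.a n)) (hpi (R.a n) t),
      mul_add]
    linarith
  have pre : ∀ n, n < R.N → E n (R.a n) + μ * ∫ s in (0 : ℝ)..R.a n, (p s).toReal ≤ H := by
    intro n
    induction n with
    | zero =>
      intro _
      rw [R.a_zero, intervalIntegral.integral_same, mul_zero, add_zero]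
      calc E 0 0 ≤ ∫ _, H ∂downloadLaw μ := integral_mono (hEi _ _) (integrable_const _)
            fun x => harmonicPotential_le
        _ = H := by simp
    | succ n ih =>
      intro hn
      exact step n (by omega) (ih (by omega)) _ (R.a_mono _ _ (Nat.le_succ n) hn) fun _ => le_rfl
  -- Discarding the nonnegative remaining potential leaves a bound independent of the horizon `t`.
  have hfin : ∀ t : ℝ, 0 ≤ t →
      ∫⁻ s in Set.Ioc 0 t, p s ≤ ENNReal.ofReal (delayGap L μ R.dmin) := by
    intro t ht
    obtain ⟨n, hn, h1, h2⟩ := R.exists_last_arrival ht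
    have h3 := step n hn (pre n hn) t h1 fun h => (h2 h).le
    have h4 : 0 ≤ E (n + 1) t := integral_nonneg fun x => harmonicPotential_nonneg
    have h5 : ∫ s in Set.Ioc 0 t, (p s).toReal ≤ delayGap L μ R.dmin := by
      rw [← intervalIntegral.integral_of_le ht, delayGap, one_div, inv_mul_eq_div,
        le_div_iff₀ hμ]
      linarith
    have h6 : ∫⁻ s in Set.Ioc 0 t, p s = ENNReal.ofReal (∫ s in Set.Ioc 0 t, (p s).toReal) := by
      rw [ofReal_integral_eq_lintegral_ofReal]
      · exact lintegral_congr fun s => (ENNReal.ofReal_toReal (measure_ne_top _ _)).symm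
      · exact ((intervalIntegrable_iff_integrableOn_Ioc_of_le ht).1 (hpi 0 t))
      · exact Eventually.of_forall fun s => ENNReal.toReal_nonneg
    rw [h6]
    exact ENNReal.ofReal_le_ofReal h5
  have hunion : Set.Ioi (0 : ℝ) = ⋃ n : ℕ, Set.Ioc (0 : ℝ) n := by
    ext s
    simp only [Set.mem_Ioi, Set.mem_iUnion, Set.mem_Ioc]
    exact ⟨fun h => ⟨_, h, Nat.le_ceil s⟩, fun ⟨_, h, _⟩ => h⟩
  rw [hunion, setLIntegral_iUnion_of_directed]
  · exact iSup_le fun n => hfin n (Nat.cast_nonneg n)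
  · exact (monotone_nat_of_le_succ fun n => Set.Ioc_subset_Ioc_right
      (by exact_mod_cast Nat.le_succ n)).directed_le

/-- With `z` complete requests both sides equal `N - z`. Requests yet to arrive are incomplete on
the left, and on the right the orders beyond the number of arrivals have infinite backlog. -/
lemma card_unfinished_eq (hσ : IsControl R L σ) {x : Chunk → ℝ} (hx : ∀ c, 0 < x c) (t : ℝ) :
    ∑ i ∈ Finset.range R.N, (if 0 < R.missing (R.done (σ x) x t) i then 1 else 0 : ENNReal) =
      ∑ m ∈ Finset.Icc 1 R.N,
        if 0 < R.backlog (R.arrivals t) (R.done (σ x) x t) m then 1 else 0 := by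
  set B := R.done (σ x) x t with hB
  set z := ((Finset.range R.N).filter fun i => R.missing B i = 0).card with hz
  have h1 : (R.arrivals t).filter (fun i => R.missing B i = 0) =
      (Finset.range R.N).filter fun i => R.missing B i = 0 := by
    ext i
    simp only [Finset.mem_filter, mem_arrivals, Arrived, Finset.mem_range]
    constructor
    · exact fun h => ⟨h.1.1, h.2⟩
    · rintro ⟨h, h0⟩
      refine ⟨⟨h, ?_⟩, h0⟩
      by_contra hlt
      have := hσ.missing_eq_of_le_arrival hx (not_le.1 hlt).le
      have hk := R.k_pos i h
      rw [← hB] at this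
      omega
  have h2 : ∀ m, 0 < R.backlog (R.arrivals t) B m ↔ z < m := fun m => by
    rw [backlog_pos_iff, h1]
  simp only [h2]
  rw [← Finset.sum_filter, ← Finset.sum_filter, Finset.sum_const, Finset.sum_const]
  congr 1
  have hzN : z ≤ R.N := by simpa using Finset.card_filter_le (Finset.range R.N) _
  have h3 : (Finset.Icc 1 R.N).filter (fun m => z < m) = Finset.Ioc z R.N := by
    ext m
    simp only [Finset.mem_filter, Finset.mem_Icc, Finset.mem_Ioc]
    omega
  have h4 := Finset.card_filter_add_card_filter_not (s := Finset.range R.N)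
    (fun i => R.missing B i = 0)
  rw [h3, Nat.card_Ioc]
  simp only [Nat.pos_iff_ne_zero]
  rw [Finset.card_range] at h4
  have h5 : ((Finset.range R.N).filter fun i => ¬ R.missing B i = 0).card = R.N - z := by omega
  exact h5

/-- A completion time is the length of the set of times at which the request is incomplete; Tonelli
brings the time integral outside, and the count of incomplete requests is exchanged for the count of
positive backlogs. -/
lemma sum_completionTime_eq (hσ : IsControl R L σ) {μ : ℝ} (hμ : 0 < μ) :
    ∑ i ∈ Finset.range R.N, ∫⁻ x, R.completionTime (σ x) x i ∂downloadLaw μ =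
      ∫⁻ t in Set.Ioi 0, ∑ m ∈ Finset.Icc 1 R.N,
        downloadLaw μ {x | 0 < R.backlog (R.arrivals t) (R.done (σ x) x t) m} := by
  have hν := isProbabilityMeasure_downloadLaw hμ
  have h1 : ∀ i ∈ Finset.range R.N, ∫⁻ x, R.completionTime (σ x) x i ∂downloadLaw μ =
      ∫⁻ t in Set.Ioi 0, downloadLaw μ {x | 0 < R.missing (R.done (σ x) x t) i} := by
    intro i hi
    simp only [fun x => completionTime_eq_volume R (σ x) x (Finset.mem_range.1 hi)]
    have hm : MeasurableSet {p : (Chunk → ℝ) × ℝ |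
        0 ≤ p.2 ∧ 0 < R.missing (R.done (σ p.1) p.1 p.2) i} :=
      (measurableSet_le measurable_const measurable_snd).inter
        (measurable_swap (hσ.measurableSet_history fun _ B => 0 < R.missing B i))
    have h2 := Measure.prod_apply (μ := downloadLaw μ) (ν := (volume : Measure ℝ)) hm
    have h3 := Measure.prod_apply_symm (μ := downloadLaw μ) (ν := (volume : Measure ℝ)) hm
    refine Eq.trans h2.symm (h3.trans ?_)
    rw [← setLIntegral_congr Ioi_ae_eq_Ici.symm, ← lintegral_indicator measurableSet_Ici]
    refine lintegral_congr fun t => ?_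
    by_cases ht : 0 ≤ t
    · rw [Set.indicator_of_mem (Set.mem_Ici.2 ht)]
      simp [ht]
    · rw [Set.indicator_of_notMem (mt Set.mem_Ici.1 ht)]
      simp [ht]
  rw [Finset.sum_congr rfl h1, ← lintegral_finsetSum _ fun i _ =>
    hσ.measurable_prob_history hμ fun _ B => 0 < R.missing B i]
  refine lintegral_congr fun t => ?_
  have h4 : ∀ Q : Finset ℕ → Finset Chunk → Prop,
      downloadLaw μ {x | Q (R.arrivals t) (R.done (σ x) x t)} =
      ∫⁻ x, (if Q (R.arrivals t) (R.done (σ x) x t) then 1 else 0) ∂downloadLaw μ := by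
    intro Q
    rw [← lintegral_indicator_one (hσ.measurableSet_history_section Q t)]
    refine lintegral_congr fun x => ?_
    simp [Set.indicator_apply]
  have h5 : ∀ Q : Finset ℕ → Finset Chunk → Prop, Measurable fun x : Chunk → ℝ =>
      (if Q (R.arrivals t) (R.done (σ x) x t) then 1 else 0 : ENNReal) := fun Q =>
    Measurable.ite (hσ.measurableSet_history_section Q t) measurable_const measurable_const
  rw [Finset.sum_congr rfl fun i _ => h4 fun _ B => 0 < R.missing B i,
    Finset.sum_congr rfl fun m _ => h4 fun 𝒜 B => 0 < R.backlog 𝒜 B m,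
    ← lintegral_finsetSum _ fun i _ => h5 fun _ B => 0 < R.missing B i,
    ← lintegral_finsetSum _ fun m _ => h5 fun 𝒜 B => 0 < R.backlog 𝒜 B m]
  refine lintegral_congr_ae ?_
  filter_upwards [ae_pos hμ] with x hx
  convert hσ.card_unfinished_eq hx t

/-- The total expected completion time under SERPT-R exceeds that of any other online policy by at
most `N` times the delay gap. -/
lemma sum_completionTime_le (hσ : IsControl R L σ) (hgr : GreedyControl R L σ)
    (hτ : IsControl R L τ) {μ : ℝ} (hμ : 0 < μ) :
    ∑ i ∈ Finset.range R.N, ∫⁻ x, R.completionTime (σ x) x i ∂downloadLaw μ ≤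
      ∑ i ∈ Finset.range R.N, ∫⁻ x, R.completionTime (τ x) x i ∂downloadLaw μ +
        R.N * ENNReal.ofReal (delayGap L μ R.dmin) := by
  have hν := isProbabilityMeasure_downloadLaw hμ
  rw [hσ.sum_completionTime_eq hμ, hτ.sum_completionTime_eq hμ]
  set D : ℕ := L - R.dmin with hD
  set p : ℕ → ℝ → ENNReal := fun m t => downloadLaw μ {x |
    0 < R.backlog (R.arrivals t) (R.done (σ x) x t) m ∧
      R.backlog (R.arrivals t) (R.done (σ x) x t) m ≤ D} with hp
  have hpm : ∀ m, Measurable (p m) := fun m =>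
    hσ.measurable_prob_history hμ fun 𝒜 B => 0 < R.backlog 𝒜 B m ∧ R.backlog 𝒜 B m ≤ D
  have hexcess : ∀ t, 0 ≤ t → ∀ m,
      downloadLaw μ {x | (D : ℕ∞) < R.backlog (R.arrivals t) (R.done (σ x) x t) m} ≤
      downloadLaw μ {x | 0 < R.backlog (R.arrivals t) (R.done (τ x) x t) m} := by
    intro t ht m
    obtain ⟨n, hn, h1, h2⟩ := R.exists_last_arrival ht
    have harr := arrivals_eq_range hn h1 h2
    -- The domination is applied to the indicator of a positive coordinate `m`; a positive excess
    -- means a backlog above `D`.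
    have hφ : Monotone fun w : ℕ → ℕ∞ => if 0 < w m then (1 : ℝ) else 0 := by
      intro w w' h
      by_cases h3 : 0 < w m
      · simp [h3, h3.trans_le (h m)]
      · simp only [h3, if_false]
        split_ifs <;> simp
    have h3 := hσ.excess_backlog_le hgr hτ hμ hn h1 (fun h => (h2 h).le) hφ
    have h4 : ∀ {ρ : (Chunk → ℝ) → ℝ → Finset Chunk}, IsControl R L ρ →
        ∀ Q : Finset ℕ → Finset Chunk → Prop,
        ∫ x, (if Q (R.arrivals t) (R.done (ρ x) x t) then (1 : ℝ) else 0) ∂downloadLaw μ =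
        (downloadLaw μ {x | Q (R.arrivals t) (R.done (ρ x) x t)}).toReal := by
      intro ρ hρ Q
      refine Eq.trans (integral_congr_ae (Eventually.of_forall fun x => ?_))
        (integral_indicator_one (hρ.measurableSet_history_section Q t))
      simp [Set.indicator_apply]
    simp only [← harr, lower, tsub_pos_iff_lt, ← hD] at h3
    rw [← ENNReal.toReal_le_toReal (measure_ne_top _ _) (measure_ne_top _ _),
      ← h4 hσ fun 𝒜 B => (D : ℕ∞) < R.backlog 𝒜 B m, ← h4 hτ fun 𝒜 B => 0 < R.backlog 𝒜 B m]
    convert h3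
  have hle : ∀ t ∈ Set.Ioi (0 : ℝ), ∑ m ∈ Finset.Icc 1 R.N,
      downloadLaw μ {x | 0 < R.backlog (R.arrivals t) (R.done (σ x) x t) m} ≤
      ∑ m ∈ Finset.Icc 1 R.N,
        downloadLaw μ {x | 0 < R.backlog (R.arrivals t) (R.done (τ x) x t) m} +
      ∑ m ∈ Finset.Icc 1 R.N, p m t := by
    intro t ht
    rw [← Finset.sum_add_distrib]
    refine Finset.sum_le_sum fun m _ => ?_
    refine le_trans ?_ (add_le_add_left (hexcess t (le_of_lt ht) m) _)
    refine (measure_mono fun x hx => ?_).trans (measure_union_le _ _)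
    rcases lt_or_ge (D : ℕ∞) (R.backlog (R.arrivals t) (R.done (σ x) x t) m) with h | h
    · exact Or.inl h
    · exact Or.inr ⟨hx, h⟩
  refine (setLIntegral_mono' measurableSet_Ioi hle).trans ?_
  rw [lintegral_add_right _ (Finset.measurable_fun_sum _ fun m _ => hpm m),
    lintegral_finsetSum _ fun m _ => hpm m]
  gcongr
  refine (Finset.sum_le_sum fun m _ => hσ.lintegral_small_backlog_le hgr hμ m).trans ?_
  simp

end IsControl

end CloudStorage

end

/-! ### Existence of a SERPT-R policy by event simulation. -/

noncomputable section

namespace CloudStorage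

open Topology Requests
open scoped Classical

section Selection

variable {α β : Type*} [LinearOrder β] {L : ℕ} {key : α → β} {S : Finset α} {c c' : α}

/-- The (at most) `L` elements of `S` with the smallest keys. -/
def smallest (L : ℕ) (key : α → β) (S : Finset α) : Finset α :=
  S.filter fun c => (S.filter fun c' => key c' < key c).card < L

/-- The rank, the number of smaller keys in `S`, is injective and below `L` on the selected
elements. -/
lemma card_smallest_le (hkey : Function.Injective key) : (smallest L key S).card ≤ L := by
  have hinj : Set.InjOn (fun c => (S.filter fun c' => key c' < key c).card)
      (smallest L key S : Set α) := by
    intro c hc c' hc' heq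
    have hlt : ∀ {c c' : α}, c ∈ S → key c < key c' →
        (S.filter fun d => key d < key c).card < (S.filter fun d => key d < key c').card := by
      intro c c' hc h
      refine Finset.card_lt_card ⟨fun d hd => ?_, fun hsub => ?_⟩
      · rw [Finset.mem_filter] at hd ⊢
        exact ⟨hd.1, hd.2.trans h⟩
      · exact lt_irrefl _ (Finset.mem_filter.1 (hsub (Finset.mem_filter.2 ⟨hc, h⟩))).2
    have hcS := (Finset.mem_filter.1 hc).1
    have hcS' := (Finset.mem_filter.1 hc').1
    rcases lt_trichotomy (key c) (key c') with h | h | h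
    · exact absurd heq (hlt hcS h).ne
    · exact hkey h
    · exact absurd heq (hlt hcS' h).ne'
  have := Finset.card_le_card_of_injOn (t := Finset.range L)
    (fun c => (S.filter fun c' => key c' < key c).card)
    (fun c hc => Finset.mem_coe.2 (Finset.mem_range.2 (Finset.mem_filter.1 hc).2)) hinj
  rwa [Finset.card_range] at this

lemma mem_smallest_of_lt (hc : c ∈ smallest L key S) (hc' : c' ∈ S) (h : key c' < key c) :
    c' ∈ smallest L key S := by
  refine Finset.mem_filter.2 ⟨hc', lt_of_le_of_lt (Finset.card_le_card fun d hd => ?_)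
    (Finset.mem_filter.1 hc).2⟩
  rw [Finset.mem_filter] at hd ⊢
  exact ⟨hd.1, hd.2.trans h⟩

/-- Below the rejected element of least key there are at least `L` elements, all of them selected.
-/
lemma smallest_eq_of_card_lt (hlt : (smallest L key S).card < L) : smallest L key S = S := by
  by_contra hne
  obtain ⟨d, hd, hd'⟩ := Finset.exists_of_ssubset
    ((Finset.filter_subset _ S).ssubset_of_ne hne)
  obtain ⟨c, hc, hmin⟩ := Finset.exists_min_image (S \ smallest L key S) key
    ⟨d, Finset.mem_sdiff.2 ⟨hd, hd'⟩⟩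
  rw [Finset.mem_sdiff] at hc
  have hL : L ≤ (S.filter fun c' => key c' < key c).card := by
    by_contra h
    exact hc.2 (Finset.mem_filter.2 ⟨hc.1, not_le.1 h⟩)
  have hsub : (S.filter fun c' => key c' < key c) ⊆ smallest L key S := by
    intro c' hc'
    rw [Finset.mem_filter] at hc'
    by_contra h
    exact absurd hc'.2 (not_lt.2 (hmin c' (Finset.mem_sdiff.2 ⟨hc'.1, h⟩)))
  have := Finset.card_le_card hsub
  omega

end Selection

namespace Requests

/-- The priority of a chunk: the number of remaining chunks of its request, ties being broken by
a fixed enumeration of the chunks. -/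
def priority (R : Requests) (B : Finset Chunk) (c : Chunk) : ℕ ×ₗ ℕ :=
  toLex (R.missing B c.1, Nat.pair c.1 c.2)

/-- The available chunks when the requests in `𝒜` have arrived and the chunks in `B` are
downloaded. -/
def candidates (R : Requests) (𝒜 : Finset ℕ) (B : Finset Chunk) : Finset Chunk :=
  R.chunks.filter fun c => c.1 ∈ 𝒜 ∧ 0 < R.missing B c.1 ∧ c ∉ B

/-- The SERPT-R assignment with ties broken by a fixed enumeration of the chunks. -/
def serptr (R : Requests) (L : ℕ) (𝒜 : Finset ℕ) (B : Finset Chunk) : Finset Chunk :=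
  smallest L (R.priority B) (R.candidates 𝒜 B)

variable {R : Requests} {L : ℕ} {𝒜 : Finset ℕ} {B : Finset Chunk}

lemma priority_injective : Function.Injective (R.priority B) := by
  intro c c' h
  have h1 : (R.missing B c.1, Nat.pair c.1 c.2) = (R.missing B c'.1, Nat.pair c'.1 c'.2) :=
    toLex.injective h
  have h2 := Nat.pair_eq_pair.1 (Prod.mk.inj h1).2
  exact Prod.ext h2.1 h2.2

lemma priority_lt {c c' : Chunk} (h : R.missing B c.1 < R.missing B c'.1) :
    R.priority B c < R.priority B c' := Prod.Lex.toLex_lt_toLex.2 (Or.inl h)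

lemma mem_candidates {c : Chunk} : c ∈ R.candidates 𝒜 B ↔
    c ∈ R.chunks ∧ c.1 ∈ 𝒜 ∧ 0 < R.missing B c.1 ∧ c ∉ B := Finset.mem_filter

lemma serptr_subset : R.serptr L 𝒜 B ⊆ R.candidates 𝒜 B := Finset.filter_subset _ _

lemma serptr_empty : R.serptr L ∅ B = ∅ := by
  rw [← Finset.subset_empty]
  intro c hc
  exact absurd (mem_candidates.1 (serptr_subset hc)).2.1 (by simp)

lemma greedy_serptr : R.Greedy L 𝒜 B (R.serptr L 𝒜 B) where
  card_le := card_smallest_le priority_injective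
  mem c hc := (mem_candidates.1 (serptr_subset hc)).2
  priority c hc c' h1 h2 h3 h4 hlt :=
    mem_smallest_of_lt hc (mem_candidates.2 ⟨h1, h2, h3, h4⟩) (priority_lt hlt)
  busy hlt c h1 h2 h3 h4 := by
    have := smallest_eq_of_card_lt hlt
    rw [serptr, this]
    exact mem_candidates.2 ⟨h1, h2, h3, h4⟩

end Requests

namespace Simulation

variable (R : Requests) (L : ℕ) (x : Chunk → ℝ)

/-- The chunks whose download is complete once each chunk `c` has received the service `A c`. -/
def complete (A : Chunk → ℝ) : Finset Chunk := R.chunks.filter fun c => x c ≤ A c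

/-- The chunks that SERPT-R serves at time `s.1` after the amounts of service `s.2`. -/
def served (s : ℝ × (Chunk → ℝ)) : Finset Chunk :=
  R.serptr L (R.arrivals s.1) (complete R x s.2)

/-- The time until the next download or arrival, but at most `1`. -/
def duration (s : ℝ × (Chunk → ℝ)) : ℝ :=
  R.chunks.fold min
    ((Finset.range R.N).fold min 1 fun i => if s.1 < R.a i then R.a i - s.1 else 1)
    fun c => if c ∈ served R L x s then x c - s.2 c else 1

/-- The time of the `k`-th event of the simulation of SERPT-R, and the amounts of service that the
chunks have received by then. -/
def event : ℕ → ℝ × (Chunk → ℝ)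
  | 0 => (0, 0)
  | k + 1 => ((event k).1 + duration R L x (event k), fun c => (event k).2 c +
      if c ∈ served R L x (event k) then duration R L x (event k) else 0)

/-- The chunks that SERPT-R serves at time `t`. -/
def assign (t : ℝ) : Finset Chunk := R.chunks.filter fun c =>
  ∃ k, (event R L x k).1 ≤ t ∧ t < (event R L x (k + 1)).1 ∧ c ∈ served R L x (event R L x k)

variable {R L x} {s : ℝ × (Chunk → ℝ)} {k : ℕ} {c : Chunk} {t : ℝ}

lemma lt_of_mem_served (hc : c ∈ served R L x s) : c ∈ R.chunks ∧ s.2 c < x c := by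
  obtain ⟨h1, -, -, h4⟩ := mem_candidates.1 (serptr_subset hc)
  refine ⟨h1, not_le.1 fun hle => h4 (Finset.mem_filter.2 ⟨h1, hle⟩)⟩

lemma duration_pos : 0 < duration R L x s := by
  rw [duration, Finset.lt_fold_min, Finset.lt_fold_min]
  refine ⟨⟨one_pos, fun i _ => ?_⟩, fun c _ => ?_⟩
  · split_ifs with h
    · exact sub_pos.2 h
    · exact one_pos
  · split_ifs with h
    · exact sub_pos.2 (lt_of_mem_served h).2
    · exact one_pos

lemma duration_le_sub_service (hc : c ∈ served R L x s) : duration R L x s ≤ x c - s.2 c := by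
  rw [duration, Finset.fold_min_le]
  exact Or.inr ⟨c, (lt_of_mem_served hc).1, by rw [if_pos hc]⟩

lemma duration_le_sub_arrival {i : ℕ} (hi : i < R.N) (h : s.1 < R.a i) :
    duration R L x s ≤ R.a i - s.1 := by
  rw [duration, Finset.fold_min_le, Finset.fold_min_le]
  exact Or.inl (Or.inr ⟨i, Finset.mem_range.2 hi, by rw [if_pos h]⟩)

lemma duration_cases (R : Requests) (L : ℕ) (x : Chunk → ℝ) (s : ℝ × (Chunk → ℝ)) :
    1 ≤ duration R L x s ∨
    (∃ i < R.N, s.1 < R.a i ∧ R.a i ≤ s.1 + duration R L x s) ∨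
    ∃ c ∈ served R L x s, x c ≤ s.2 c + duration R L x s := by
  have h : duration R L x s ≤ duration R L x s := le_rfl
  conv at h => lhs; unfold duration
  rw [Finset.fold_min_le, Finset.fold_min_le] at h
  rcases h with (h | ⟨i, hi, h⟩) | ⟨c, -, h⟩
  · exact Or.inl h
  · split_ifs at h with h1
    · exact Or.inr (Or.inl ⟨i, Finset.mem_range.1 hi, h1, by linarith⟩)
    · exact Or.inl h
  · split_ifs at h with h1
    · exact Or.inr (Or.inr ⟨c, h1, by linarith⟩)
    · exact Or.inl h

lemma event_lt_succ (k : ℕ) : (event R L x k).1 < (event R L x (k + 1)).1 :=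
  lt_add_of_pos_right _ duration_pos

lemma event_strictMono : StrictMono fun k => (event R L x k).1 :=
  strictMono_nat_of_lt_succ event_lt_succ

lemma event_nonneg (k : ℕ) : 0 ≤ (event R L x k).1 :=
  event_strictMono.monotone (Nat.zero_le k)

lemma service_event_nonneg (k : ℕ) (c : Chunk) : 0 ≤ (event R L x k).2 c := by
  induction k with
  | zero => exact le_rfl
  | succ k ih =>
    refine add_nonneg ih ?_
    split_ifs
    · exact duration_pos.le
    · exact le_rfl

/-- Each step takes a full unit of time, meets an arrival or completes a chunk. The last two happen
finitely often, so the event times are unbounded; the cap `1` on `duration` keeps steps finite when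
nothing is pending. -/
lemma le_event (k : ℕ) : (k : ℝ) ≤ (event R L x k).1 +
    (complete R x (event R L x k).2).card + (R.arrivals (event R L x k).1).card := by
  induction k with
  | zero =>
    rw [Nat.cast_zero]
    have := event_nonneg (R := R) (L := L) (x := x) 0
    positivity
  | succ k ih =>
    set s := event R L x k with hs
    set s' := event R L x (k + 1) with hs'
    have h1 : s.1 < s'.1 := event_lt_succ k
    have hc : complete R x s.2 ⊆ complete R x s'.2 := by
      intro c hc
      rw [complete, Finset.mem_filter] at hc ⊢
      refine ⟨hc.1, hc.2.trans (le_add_of_nonneg_right ?_)⟩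
      split_ifs
      · exact duration_pos.le
      · exact le_rfl
    have ha : R.arrivals s.1 ⊆ R.arrivals s'.1 := by
      intro i hi
      rw [mem_arrivals] at hi ⊢
      exact ⟨hi.1, hi.2.trans h1.le⟩
    have hc' : ((complete R x s.2).card : ℝ) ≤ (complete R x s'.2).card := by
      exact_mod_cast Finset.card_le_card hc
    have ha' : ((R.arrivals s.1).card : ℝ) ≤ (R.arrivals s'.1).card := by
      exact_mod_cast Finset.card_le_card ha
    have hs1 : s'.1 = s.1 + duration R L x s := rfl
    push_cast
    rcases duration_cases R L x s with h | ⟨i, hi, h2, h3⟩ | ⟨c, h2, h3⟩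
    · linarith
    · have : (R.arrivals s.1).card < (R.arrivals s'.1).card := Finset.card_lt_card
        ⟨ha, fun hsub => absurd (mem_arrivals.1 (hsub (mem_arrivals.2 ⟨hi, h3⟩))).2
          (not_le.2 h2)⟩
      have : ((R.arrivals s.1).card : ℝ) + 1 ≤ (R.arrivals s'.1).card := by exact_mod_cast this
      linarith
    · obtain ⟨h4, h5⟩ := lt_of_mem_served h2
      have : (complete R x s.2).card < (complete R x s'.2).card := by
        refine Finset.card_lt_card ⟨hc, fun hsub => ?_⟩
        have h6 : c ∈ complete R x s'.2 := by
          refine Finset.mem_filter.2 ⟨h4, ?_⟩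
          show x c ≤ s.2 c + if c ∈ served R L x s then duration R L x s else 0
          rwa [if_pos h2]
        exact absurd (Finset.mem_filter.1 (hsub h6)).2 (not_le.2 h5)
      have : ((complete R x s.2).card : ℝ) + 1 ≤ (complete R x s'.2).card := by
        exact_mod_cast this
      linarith

lemma exists_event_interval (ht : 0 ≤ t) :
    ∃ k, (event R L x k).1 ≤ t ∧ t < (event R L x (k + 1)).1 := by
  have hex : ∃ k, t < (event R L x k).1 := by
    obtain ⟨k, hk⟩ := exists_nat_gt (t + R.chunks.card + R.N)
    refine ⟨k, ?_⟩
    have h1 := le_event (R := R) (L := L) (x := x) k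
    have h2 : ((complete R x (event R L x k).2).card : ℝ) ≤ R.chunks.card := by
      exact_mod_cast Finset.card_filter_le _ _
    have h3 : ((R.arrivals (event R L x k).1).card : ℝ) ≤ R.N := by
      have : (R.arrivals (event R L x k).1).card ≤ (Finset.range R.N).card :=
        Finset.card_filter_le _ _
      rw [Finset.card_range] at this
      exact_mod_cast this
    linarith
  have hpos : 0 < Nat.find hex := by
    rw [Nat.find_pos]
    exact not_lt.2 ht
  refine ⟨Nat.find hex - 1, not_lt.1 (Nat.find_min hex (by omega)), ?_⟩
  rw [Nat.sub_add_cancel hpos]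
  exact Nat.find_spec hex

lemma assign_eq (h1 : (event R L x k).1 ≤ t) (h2 : t < (event R L x (k + 1)).1) :
    assign R L x t = served R L x (event R L x k) := by
  ext c
  rw [assign, Finset.mem_filter]
  constructor
  · rintro ⟨-, k', h3, h4, h5⟩
    have h6 : k < k' + 1 := event_strictMono.lt_iff_lt.1 (h1.trans_lt h4)
    have h7 : k' < k + 1 := event_strictMono.lt_iff_lt.1 (h3.trans_lt h2)
    obtain rfl : k' = k := by omega
    exact h5
  · exact fun h => ⟨(lt_of_mem_served h).1, k, h1, h2, h⟩

lemma assign_of_neg (ht : t < 0) : assign R L x t = ∅ := by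
  rw [assign, Finset.filter_eq_empty_iff]
  rintro c - ⟨k, hk, -⟩
  linarith [event_nonneg (R := R) (L := L) (x := x) k]

lemma service_of_constant {σ : ℝ → Finset Chunk} {S : Finset Chunk} {a : ℝ} (ha : 0 ≤ a)
    (hat : a ≤ t) (h : ∀ r, a ≤ r → r < t → σ r = S) :
    service σ c t = service σ c a + if c ∈ S then ENNReal.ofReal (t - a) else 0 := by
  split_ifs with hc
  · refine le_antisymm (service_le_add σ c a t) ?_
    have hsub : {r : ℝ | 0 ≤ r ∧ r ≤ a ∧ c ∈ σ r} ∪ Set.Ioo a t ⊆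
        {r : ℝ | 0 ≤ r ∧ r ≤ t ∧ c ∈ σ r} := by
      rintro r (hr | hr)
      · exact ⟨hr.1, hr.2.1.trans hat, hr.2.2⟩
      · exact ⟨ha.trans hr.1.le, hr.2.le, by rw [h r hr.1.le hr.2]; exact hc⟩
    have hdisj : Disjoint {r : ℝ | 0 ≤ r ∧ r ≤ a ∧ c ∈ σ r} (Set.Ioo a t) :=
      Set.disjoint_left.2 fun r hr hr' => absurd hr.2.1 (not_le.2 hr'.1)
    refine le_trans (le_of_eq ?_) (measure_mono hsub)
    rw [measure_union hdisj measurableSet_Ioo, Real.volume_Ioo]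
    rfl
  · rw [add_zero]
    refine le_antisymm ?_ (service_mono hat)
    have hsub : {r : ℝ | 0 ≤ r ∧ r ≤ t ∧ c ∈ σ r} ⊆
        {r : ℝ | 0 ≤ r ∧ r ≤ a ∧ c ∈ σ r} ∪ {t} := by
      rintro r ⟨h0, h1, h2⟩
      rcases h1.eq_or_lt with h3 | h3
      · exact Or.inr h3
      · left
        refine ⟨h0, not_lt.1 fun h4 => hc ?_, h2⟩
        rwa [← h r h4.le h3]
    refine (measure_mono hsub).trans ((measure_union_le _ _).trans ?_)
    simp [service]

lemma service_assign_event (k : ℕ) (c : Chunk) :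
    service (assign R L x) c (event R L x k).1 = ENNReal.ofReal ((event R L x k).2 c) := by
  induction k with
  | zero =>
    rw [service_of_nonpos (t := (event R L x 0).1) le_rfl]
    simp [event]
  | succ k ih =>
    rw [service_of_constant (event_nonneg k) (event_lt_succ k).le fun r h1 h2 => assign_eq h1 h2,
      ih]
    show _ = ENNReal.ofReal ((event R L x k).2 c + if c ∈ served R L x (event R L x k) then
      duration R L x (event R L x k) else 0)
    split_ifs
    · rw [ENNReal.ofReal_add (service_event_nonneg k c) duration_pos.le]
      simp [event]
    · simp

/-- By the choice of `duration`, a chunk under service can complete only at the right end of the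
event interval, which is excluded. -/
lemma done_assign_eq (h1 : (event R L x k).1 ≤ t) (h2 : t < (event R L x (k + 1)).1) :
    R.done (assign R L x) x t = complete R x (event R L x k).2 := by
  refine Finset.filter_congr fun c _ => ?_
  rw [service_of_constant (event_nonneg k) h1 fun r h3 h4 => assign_eq h3 (h4.trans h2),
    service_assign_event]
  have h0 := service_event_nonneg (R := R) (L := L) (x := x) k c
  split_ifs with hc
  · rw [← ENNReal.ofReal_add h0 (sub_nonneg.2 h1),
      ENNReal.ofReal_le_ofReal_iff (add_nonneg h0 (sub_nonneg.2 h1))]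
    have h3 := duration_le_sub_service hc
    have h4 : (event R L x (k + 1)).1 = (event R L x k).1 + duration R L x (event R L x k) := rfl
    have h5 := (lt_of_mem_served hc).2
    constructor <;> intro h <;> linarith
  · rw [add_zero, ENNReal.ofReal_le_ofReal_iff h0]

lemma arrivals_eq (h1 : (event R L x k).1 ≤ t) (h2 : t < (event R L x (k + 1)).1) :
    R.arrivals t = R.arrivals (event R L x k).1 := by
  ext i
  simp only [mem_arrivals, Arrived]
  refine and_congr_right fun hi => ⟨fun h => ?_, fun h => h.trans h1⟩
  by_contra hlt
  have h3 := duration_le_sub_arrival (L := L) (x := x) hi (not_le.1 hlt)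
  have h4 : (event R L x (k + 1)).1 = (event R L x k).1 + duration R L x (event R L x k) := rfl
  linarith

/-- The simulated trajectory follows the SERPT-R rule. -/
lemma assign_eq_serptr (R : Requests) (L : ℕ) (x : Chunk → ℝ) (t : ℝ) :
    assign R L x t = R.serptr L (R.arrivals t) (R.done (assign R L x) x t) := by
  rcases lt_or_ge t 0 with ht | ht
  · have : R.arrivals t = ∅ := by
      rw [← Finset.subset_empty]
      intro i hi
      obtain ⟨h1, h2⟩ := mem_arrivals.1 hi
      linarith [a_nonneg h1]
    rw [this, serptr_empty, assign_of_neg ht]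
  · obtain ⟨k, h1, h2⟩ := exists_event_interval (R := R) (L := L) (x := x) ht
    rw [assign_eq h1 h2, done_assign_eq h1 h2, arrivals_eq h1 h2]
    rfl

section Measurability

lemma measurable_fold_min {Ω ι : Type*} [MeasurableSpace Ω] (I : Finset ι) {b : Ω → ℝ}
    {f : ι → Ω → ℝ} (hb : Measurable b) (hf : ∀ i, Measurable (f i)) :
    Measurable fun ω => I.fold min (b ω) fun i => f i ω := by
  induction I using Finset.induction_on with
  | empty => simpa using hb
  | insert i I hi ih =>
    simp only [Finset.fold_insert hi]
    exact (hf i).min ih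

lemma measurableSet_mem_served {s : (Chunk → ℝ) → ℝ × (Chunk → ℝ)} (hs : Measurable s)
    (c : Chunk) : MeasurableSet {x | c ∈ served R L x (s x)} := by
  have hB : ∀ B, MeasurableSet {x | complete R x (s x).2 = B} := by
    intro B
    have : {x | complete R x (s x).2 = B} = ⋂ c : Chunk,
        {x | c ∈ complete R x (s x).2 ↔ c ∈ B} := by
      ext x
      simp [Finset.ext_iff]
    rw [this]
    refine MeasurableSet.iInter fun c => ?_
    have hm : MeasurableSet {x | c ∈ complete R x (s x).2} := by
      simp only [complete, Finset.mem_filter]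
      by_cases hc : c ∈ R.chunks
      · simp only [hc, true_and]
        exact measurableSet_le (measurable_pi_apply c)
          ((measurable_pi_apply c).comp (measurable_snd.comp hs))
      · simp [hc]
    by_cases hc : c ∈ B
    · simpa only [hc, iff_true] using hm
    · simp only [hc, iff_false]
      exact hm.compl
  -- The rule sees `x` only through two finite sets, of which there are countably many.
  have : {x | c ∈ served R L x (s x)} = ⋃ q : Finset ℕ × Finset Chunk,
      {x | c ∈ R.serptr L q.1 q.2 ∧ R.arrivals (s x).1 = q.1 ∧ complete R x (s x).2 = q.2} := by
    ext x
    simp only [Set.mem_ofPred_eq, Set.mem_iUnion]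
    constructor
    · exact fun h => ⟨(_, _), h, rfl, rfl⟩
    · rintro ⟨q, h, h1, h2⟩
      rwa [served, h1, h2]
  rw [this]
  refine MeasurableSet.iUnion fun q => ?_
  by_cases hq : c ∈ R.serptr L q.1 q.2
  · simp only [hq, true_and]
    exact ((measurable_fst.comp hs) (measurableSet_arrivals_eq q.1)).inter (hB q.2)
  · simp [hq]

lemma measurable_duration {s : (Chunk → ℝ) → ℝ × (Chunk → ℝ)} (hs : Measurable s) :
    Measurable fun x => duration R L x (s x) := by
  refine measurable_fold_min _ (measurable_fold_min _ measurable_const fun i => ?_) fun c => ?_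
  · exact Measurable.ite (measurableSet_lt (measurable_fst.comp hs) measurable_const)
      (measurable_const.sub (measurable_fst.comp hs)) measurable_const
  · exact Measurable.ite (measurableSet_mem_served hs c) ((measurable_pi_apply c).sub
      ((measurable_pi_apply c).comp (measurable_snd.comp hs))) measurable_const

lemma measurable_event (R : Requests) (L k : ℕ) : Measurable fun x => event R L x k := by
  induction k with
  | zero => exact measurable_const
  | succ k ih =>
    refine ((measurable_fst.comp ih).add (measurable_duration ih)).prodMk
      (measurable_pi_iff.2 fun c => ((measurable_pi_apply c).comp (measurable_snd.comp ih)).add ?_)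
    exact Measurable.ite (measurableSet_mem_served ih c) (measurable_duration ih) measurable_const

lemma measurableSet_mem_assign (R : Requests) (L : ℕ) (c : Chunk) :
    MeasurableSet {p : (Chunk → ℝ) × ℝ | c ∈ assign R L p.1 p.2} := by
  simp only [assign, Finset.mem_filter]
  by_cases hc : c ∈ R.chunks
  · simp only [hc, true_and, Set.ofPred_exists]
    refine MeasurableSet.iUnion fun k => ?_
    exact (measurableSet_le ((measurable_fst.comp (measurable_event R L k)).comp measurable_fst)
      measurable_snd).inter ((measurableSet_lt measurable_snd
        ((measurable_fst.comp (measurable_event R L (k + 1))).comp measurable_fst)).inter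
          (measurable_fst (measurableSet_mem_served (measurable_event R L k) c)))
  · simp [hc]

end Measurability

end Simulation

namespace Requests

/-- The rule uses only arrived requests and their downloaded chunks, and ties are broken by the
chunk numbers alone. This makes the simulated policy online, although the simulation is driven by
all downloading times. -/
lemma serptr_congr {R R' : Requests} {σ σ' : ℝ → Finset Chunk} {x x' : Chunk → ℝ} {t : ℝ} (L : ℕ)
    (h : ∀ i, R.Arrived t i ↔ R'.Arrived t i)
    (hp : ∀ i, R.Arrived t i → R.k i = R'.k i ∧ R.n i = R'.n i)
    (hd : ∀ i, R.Arrived t i → R.downloaded σ x t i = R'.downloaded σ' x' t i) :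
    R.serptr L (R.arrivals t) (R.done σ x t) = R'.serptr L (R'.arrivals t) (R'.done σ' x' t) := by
  have hm : ∀ i, R.Arrived t i →
      R.missing (R.done σ x t) i = R'.missing (R'.done σ' x' t) i := by
    intro i hi
    rw [← remaining_eq hi.1, ← remaining_eq ((h i).1 hi).1, remaining, remaining, (hp i hi).1,
      hd i hi]
  have hS : R.candidates (R.arrivals t) (R.done σ x t) =
      R'.candidates (R'.arrivals t) (R'.done σ' x' t) := by
    ext ⟨i, j⟩
    simp only [mem_candidates, mem_arrivals, mem_chunks]
    by_cases hi : R.Arrived t i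
    · have hi' := (h i).1 hi
      have hdone : (i, j) ∈ R.done σ x t ↔ (i, j) ∈ R'.done σ' x' t := by
        rw [← mem_downloaded_iff_mem_done hi.1, ← mem_downloaded_iff_mem_done hi'.1, hd i hi]
      simp only [hi, hi', hi.1, hi'.1, (hp i hi).2, hm i hi, hdone]
    · have hi' : ¬ R'.Arrived t i := fun h' => hi ((h i).2 h')
      simp [hi, hi']
  have hkey : ∀ c ∈ R.candidates (R.arrivals t) (R.done σ x t),
      R.priority (R.done σ x t) c = R'.priority (R'.done σ' x' t) c := by
    intro c hc
    rw [priority, priority, hm c.1 (mem_arrivals.1 (mem_candidates.1 hc).2.1)]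
  unfold serptr smallest
  rw [← hS]
  refine Finset.filter_congr fun c hc => ?_
  rw [Finset.filter_congr fun c' hc' => by rw [hkey c hc, hkey c' hc']]

end Requests

/-- The preemptive SERPT-R policy with ties broken by a fixed enumeration of the chunks. -/
def serptrPolicy (L : ℕ) : OnlinePolicy L where
  Seed := Unit
  seedLaw := Measure.dirac ()
  assign R _ x t := Simulation.assign R L x t
  measurable_assign R c := measurable_snd (Simulation.measurableSet_mem_assign R L c)
  card_le R _ x t := by
    rw [Simulation.assign_eq_serptr]
    exact greedy_serptr.card_le
  available R _ x t c hc := by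
    rw [Simulation.assign_eq_serptr] at hc
    obtain ⟨h1, h2, h3, h4⟩ := mem_candidates.1 (serptr_subset hc)
    exact available_iff.2 ⟨h1, (mem_arrivals.1 h2).2, h3, h4⟩
  online R R' _ x x' t h hp hd := by
    rw [Simulation.assign_eq_serptr R, Simulation.assign_eq_serptr R']
    exact serptr_congr L h (fun i hi => (hp i hi).2) fun i hi => hd i hi t le_rfl

lemma isSERPTR_serptrPolicy (L : ℕ) : (serptrPolicy L).IsSERPTR := by
  intro R u x t
  have heq : (serptrPolicy L).assign R u x t =
      R.serptr L (R.arrivals t) (R.done ((serptrPolicy L).assign R u x) x t) :=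
    Simulation.assign_eq_serptr R L x t
  have hg := greedy_serptr (R := R) (L := L) (𝒜 := R.arrivals t)
    (B := R.done ((serptrPolicy L).assign R u x) x t)
  rw [← heq] at hg
  have hav : ∀ c, R.Available ((serptrPolicy L).assign R u x) x t c → c ∈ R.chunks ∧
      c.1 ∈ R.arrivals t ∧ 0 < R.missing (R.done ((serptrPolicy L).assign R u x) x t) c.1 ∧
      c ∉ R.done ((serptrPolicy L).assign R u x) x t := by
    intro c hc
    obtain ⟨h1, h2, h3, h4⟩ := available_iff.1 hc
    exact ⟨h1, mem_arrivals.2 ⟨(mem_chunks.1 h1).1, h2⟩, h3, h4⟩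
  refine ⟨fun c hc c' hc' hlt => ?_, fun hlt c hc => ?_⟩
  · obtain ⟨h1, h2, h3, h4⟩ := hav c' hc'
    have hcN := (mem_arrivals.1 (hg.mem c hc).1).1
    rw [remaining_eq (mem_chunks.1 h1).1, remaining_eq hcN] at hlt
    exact hg.priority c hc c' h1 h2 h3 h4 hlt
  · obtain ⟨h1, h2, h3, h4⟩ := hav c hc
    exact hg.busy hlt c h1 h2 h3 h4

end CloudStorage

end

/-! ### Averaging over seeds, flow times, and infinite streams. -/

noncomputable section

namespace CloudStorage

open Topology Requests

lemma delayGap_anti (L : ℕ) {μ : ℝ} (hμ : 0 < μ) {d d' : ℕ} (h : d ≤ d') :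
    delayGap L μ d' ≤ delayGap L μ d := by
  unfold delayGap
  refine mul_le_mul_of_nonneg_left ?_ (by positivity)
  exact Finset.sum_le_sum_of_subset_of_nonneg (Finset.Ico_subset_Ico_left h)
    fun l _ _ => by positivity

lemma delayGap_le_log (L : ℕ) {μ : ℝ} (hμ : 0 < μ) {d : ℕ} (hd : 0 < d) :
    delayGap L μ d ≤ (Real.log L + 1) / μ := by
  have h1 : ∑ l ∈ Finset.Ico d L, 1 / (l : ℝ) ≤ Real.log L + 1 := by
    calc ∑ l ∈ Finset.Ico d L, 1 / (l : ℝ) ≤ ∑ l ∈ Finset.Icc 1 L, 1 / (l : ℝ) :=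
          Finset.sum_le_sum_of_subset_of_nonneg (fun l hl => by
            rw [Finset.mem_Ico] at hl
            exact Finset.mem_Icc.2 ⟨by omega, by omega⟩) fun l _ _ => by positivity
      _ = ((harmonic L : ℚ) : ℝ) := by
          rw [harmonic_eq_sum_Icc]
          push_cast
          exact Finset.sum_congr rfl fun l _ => one_div _
      _ ≤ 1 + Real.log L := harmonic_le_one_add_log L
      _ = Real.log L + 1 := add_comm _ _
  rw [delayGap, one_div, inv_mul_eq_div]
  gcongr

namespace OnlinePolicy

variable {L : ℕ} {μ : ℝ} {R : Requests}

lemma measurable_lintegral_completionTime (π : OnlinePolicy L) (hμ : 0 < μ) {i : ℕ}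
    (hi : i < R.N) :
    Measurable fun u => ∫⁻ x, R.completionTime (π.assign R u x) x i ∂downloadLaw μ := by
  have := isProbabilityMeasure_downloadLaw hμ
  set σ : π.Seed × (Chunk → ℝ) → ℝ → Finset Chunk := fun ω => π.assign R ω.1 ω.2 with hσ
  have hm : ∀ c, MeasurableSet {p : (π.Seed × (Chunk → ℝ)) × ℝ | c ∈ σ p.1 p.2} := fun c =>
    (measurable_fst.comp measurable_fst).prodMk
      ((measurable_snd.comp measurable_fst).prodMk measurable_snd) (π.measurable_assign R c)
  have hset : MeasurableSet {p : (π.Seed × (Chunk → ℝ)) × ℝ | 0 ≤ p.2 ∧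
      0 < R.missing (R.done (σ p.1) p.1.2 p.2) i} := by
    have h : {p : (π.Seed × (Chunk → ℝ)) × ℝ | 0 < R.missing (R.done (σ p.1) p.1.2 p.2) i} =
        ⋃ B : Finset Chunk, {p | 0 < R.missing B i ∧ R.done (σ p.1) p.1.2 p.2 = B} := by
      ext p
      simp
    refine (measurableSet_le measurable_const measurable_snd).inter ?_
    change MeasurableSet {p : (π.Seed × (Chunk → ℝ)) × ℝ |
      0 < R.missing (R.done (σ p.1) p.1.2 p.2) i}
    rw [h]
    refine MeasurableSet.iUnion fun B => ?_
    by_cases hB : 0 < R.missing B i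
    · simpa only [hB, true_and] using measurableSet_done_eq hm measurable_snd R B
    · simp [hB]
  have h1 : Measurable fun ω : π.Seed × (Chunk → ℝ) => R.completionTime (σ ω) ω.2 i := by
    simp only [fun ω : π.Seed × (Chunk → ℝ) => completionTime_eq_volume R (σ ω) ω.2 hi]
    exact measurable_measure_prodMk_left hset
  exact h1.lintegral_prod_right'

lemma arrival_le_meanCompletion (π : OnlinePolicy L) (hμ : 0 < μ) {i : ℕ} (hi : i < R.N) :
    ENNReal.ofReal (R.a i) ≤ π.meanCompletion μ R i := by
  have := isProbabilityMeasure_downloadLaw hμ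
  have h1 : ∀ u, ENNReal.ofReal (R.a i) ≤
      ∫⁻ x, R.completionTime (π.assign R u x) x i ∂downloadLaw μ := by
    intro u
    have h2 : ∀ᵐ x ∂downloadLaw μ,
        ENNReal.ofReal (R.a i) ≤ R.completionTime (π.assign R u x) x i := by
      filter_upwards [ae_pos hμ] with x hx
      refine le_iInf₂ fun t ht => ENNReal.ofReal_le_ofReal ?_
      by_contra hlt
      have h3 := (π.isControl R u).missing_eq_of_le_arrival hx (not_le.1 hlt).le
      rw [← remaining_eq hi, remaining] at h3
      have hk := R.k_pos i hi
      have := ht.2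
      omega
    calc ENNReal.ofReal (R.a i) = ∫⁻ _, ENNReal.ofReal (R.a i) ∂downloadLaw μ := by simp
      _ ≤ _ := lintegral_mono_ae h2
  calc ENNReal.ofReal (R.a i) = ∫⁻ _, ENNReal.ofReal (R.a i) ∂π.seedLaw := by simp
    _ ≤ _ := lintegral_mono h1

/-- The bound holds for every pair of seeds, so it survives averaging over both independently, even
though the two policies have different seed spaces. -/
lemma sum_meanCompletion_le {π π' : OnlinePolicy L} (hπ : π.IsSERPTR) (hμ : 0 < μ)
    (R : Requests) : ∑ i ∈ Finset.range R.N, π.meanCompletion μ R i ≤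
      ∑ i ∈ Finset.range R.N, π'.meanCompletion μ R i +
        R.N * ENNReal.ofReal (delayGap L μ R.dmin) := by
  have hsum : ∀ ρ : OnlinePolicy L, ∑ i ∈ Finset.range R.N, ρ.meanCompletion μ R i =
      ∫⁻ u, ∑ i ∈ Finset.range R.N, ∫⁻ x, R.completionTime (ρ.assign R u x) x i ∂downloadLaw μ
        ∂ρ.seedLaw := by
    intro ρ
    rw [lintegral_finsetSum' _ fun i hi =>
      (ρ.measurable_lintegral_completionTime hμ (Finset.mem_range.1 hi)).aemeasurable]
    rfl
  rw [hsum π, hsum π']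
  have hG := fun u u' => (π.isControl R u).sum_completionTime_le (hπ.greedyControl R u)
    (π'.isControl R u') hμ
  set G := (R.N : ENNReal) * ENNReal.ofReal (delayGap L μ R.dmin) with hGdef
  calc _ ≤ ∫⁻ _ : π'.Seed, (∫⁻ u, ∑ i ∈ Finset.range R.N,
          ∫⁻ x, R.completionTime (π.assign R u x) x i ∂downloadLaw μ ∂π.seedLaw) ∂π'.seedLaw := by
        simp
    _ ≤ ∫⁻ u', (∑ i ∈ Finset.range R.N,
          ∫⁻ x, R.completionTime (π'.assign R u' x) x i ∂downloadLaw μ + G) ∂π'.seedLaw := by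
        refine lintegral_mono fun u' => ?_
        refine (lintegral_mono fun u => hG u u').trans ?_
        simp
    _ = _ := by
        rw [lintegral_add_right _ measurable_const]
        simp

lemma avgFlowTime_le {π : OnlinePolicy L} (hπ : π.IsSERPTR) (π' : OnlinePolicy L) (hμ : 0 < μ)
    (R : Requests) : π.avgFlowTime μ R ≤
      π'.avgFlowTime μ R + ENNReal.ofReal (delayGap L μ R.dmin) := by
  have hN : (R.N : ENNReal) ≠ 0 := by exact_mod_cast R.N_pos.ne'
  have hN' : (R.N : ENNReal) ≠ ⊤ := ENNReal.natCast_ne_top _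
  set g := ENNReal.ofReal (delayGap L μ R.dmin) with hg
  have key : ∑ i ∈ Finset.range R.N, (π.meanCompletion μ R i - ENNReal.ofReal (R.a i)) ≤
      ∑ i ∈ Finset.range R.N, (π'.meanCompletion μ R i - ENNReal.ofReal (R.a i)) + R.N * g := by
    have hfin : ∑ i ∈ Finset.range R.N, ENNReal.ofReal (R.a i) ≠ ⊤ :=
      (ENNReal.sum_lt_top.2 fun i _ => ENNReal.ofReal_lt_top).ne
    -- The arrival times are finite and cancel. Restoring them exactly for `π` uses that no mean
    -- completion time precedes the arrival; for `π'` an inequality is enough.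
    refine (ENNReal.add_le_add_iff_right hfin).1 ?_
    calc _ = ∑ i ∈ Finset.range R.N, π.meanCompletion μ R i := by
          rw [← Finset.sum_add_distrib]
          exact Finset.sum_congr rfl fun i hi =>
            tsub_add_cancel_of_le (π.arrival_le_meanCompletion hμ (Finset.mem_range.1 hi))
      _ ≤ ∑ i ∈ Finset.range R.N, π'.meanCompletion μ R i + R.N * g :=
          sum_meanCompletion_le hπ hμ R
      _ ≤ ∑ i ∈ Finset.range R.N, ((π'.meanCompletion μ R i - ENNReal.ofReal (R.a i)) +
            ENNReal.ofReal (R.a i)) + R.N * g := by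
          gcongr
          exact le_tsub_add
      _ = _ := by
          rw [Finset.sum_add_distrib]
          ring
  calc π.avgFlowTime μ R ≤ (∑ i ∈ Finset.range R.N,
        (π'.meanCompletion μ R i - ENNReal.ofReal (R.a i)) + R.N * g) / R.N :=
        ENNReal.div_le_div_right key _
    _ = π'.avgFlowTime μ R + g := by
        rw [ENNReal.add_div, mul_comm (R.N : ENNReal) g, ENNReal.mul_div_cancel_right hN hN']
        rfl

end OnlinePolicy

lemma RequestStream.dmin_le_first (S : RequestStream) (m : ℕ) : S.dmin ≤ (S.first m).dmin := by
  obtain ⟨i, -, h⟩ := (S.first m).exists_dmin_eq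
  rw [h]
  exact Nat.sInf_le ⟨i, rfl⟩

lemma RequestStream.dmin_pos (S : RequestStream) : 0 < S.dmin := by
  obtain ⟨i, h⟩ := Nat.sInf_mem (s := {d | ∃ i, d = S.n i - S.k i + 1}) ⟨_, 0, rfl⟩
  rw [RequestStream.dmin, h]
  omega

lemma OnlinePolicy.limAvgFlowTime_le {L : ℕ} {μ : ℝ} {π : OnlinePolicy L} (hπ : π.IsSERPTR)
    (π' : OnlinePolicy L) (hμ : 0 < μ) (S : RequestStream) :
    π.limAvgFlowTime μ S ≤ π'.limAvgFlowTime μ S + ENNReal.ofReal (delayGap L μ S.dmin) := by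
  set g := ENNReal.ofReal (delayGap L μ S.dmin) with hg
  -- The minimal distance of a prefix is at least that of the stream, and the gap decreases in the
  -- distance, so one constant serves all prefixes.
  have h1 : ∀ m, π.avgFlowTime μ (S.first m) ≤ π'.avgFlowTime μ (S.first m) + g := fun m =>
    (avgFlowTime_le hπ π' hμ (S.first m)).trans (add_le_add_right
      (ENNReal.ofReal_le_ofReal (delayGap_anti L hμ (S.dmin_le_first m))) _)
  calc π.limAvgFlowTime μ S ≤
        limsup (fun m : ℕ => π'.avgFlowTime μ (S.first m) + g) atTop :=
        limsup_le_limsup (Eventually.of_forall h1)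
    _ = π'.limAvgFlowTime μ S + g :=
        limsup_add_const atTop _ g (by isBoundedDefault) (by isBoundedDefault)

end CloudStorage

end

theorem theorem2 (L : ℕ) (hL : 0 < L) (μ : ℝ) (hμ : 0 < μ) :
    (∃ π : CloudStorage.OnlinePolicy L, π.IsSERPTR) ∧
    ∀ π : CloudStorage.OnlinePolicy L, π.IsSERPTR →
      (∀ R : CloudStorage.Requests,
        CloudStorage.optFlowTime L μ R ≤ π.avgFlowTime μ R ∧
        π.avgFlowTime μ R ≤ CloudStorage.optFlowTime L μ R +
          ENNReal.ofReal (CloudStorage.delayGap L μ R.dmin) ∧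
        CloudStorage.delayGap L μ R.dmin ≤ (Real.log L + 1) / μ) ∧
      (∀ S : CloudStorage.RequestStream,
        CloudStorage.limOptFlowTime L μ S ≤ π.limAvgFlowTime μ S ∧
        π.limAvgFlowTime μ S ≤ CloudStorage.limOptFlowTime L μ S +
          ENNReal.ofReal (CloudStorage.delayGap L μ S.dmin) ∧
        CloudStorage.delayGap L μ S.dmin ≤ (Real.log L + 1) / μ) := by
  refine ⟨⟨_, CloudStorage.isSERPTR_serptrPolicy L⟩, fun π hπ => ⟨fun R => ⟨iInf_le _ π, ?_,
    CloudStorage.delayGap_le_log L hμ R.dmin_pos⟩, fun S => ⟨iInf_le _ π, ?_,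
    CloudStorage.delayGap_le_log L hμ S.dmin_pos⟩⟩⟩
  · rw [CloudStorage.optFlowTime, ENNReal.iInf_add]
    exact le_iInf fun π' => CloudStorage.OnlinePolicy.avgFlowTime_le hπ π' hμ R
  · rw [CloudStorage.limOptFlowTime, ENNReal.iInf_add]
    exact le_iInf fun π' => CloudStorage.OnlinePolicy.limAvgFlowTime_le hπ π' hμ S
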